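/- Let $k\subset\mathbb C$ be a subfield and let $y\in k\setminus\{0,1\}$ with $y\notin(1,+\infty)$. Let $a,b,c\in\mathbb C$ be generic, i.e. $a,b,c,c-a,c-b\notin\mathbb Z$. Put $k_{\mathrm{dR}}=k(a,b,c)$ and $\mathbb Q_{\mathrm B}=\mathbb Q(e^{2\pi i a},e^{2\pi i b},e^{2\pi i c})$. *De Rham side.* Let $X=\mathbb A^1_{k_{\mathrm{dR}}}\setminus\{0,1,y^{-1}\}$, $\nabla f=df+f\,\bigl(b\,d\log x+(c-b)\,d\log(1-x)-a\,d\log(1-yx)\bigr)$, and $M_{\mathrm{dR}}=H^1(X,\nabla)=\Omega^1(X)/\nabla\mathcal O(X)$, with the classes $$\eta_1=\Bigl[\frac{dx}{x(1-x)}\Bigr],\qquad \eta_2=\Bigl[\frac{dx}{1-yx}\Bigr].$$ *Betti side.* Let $\mathcal L^\vee$ be the rank one local system of $\mathbb Q_{\mathrm B}$-vector spaces on $\mathbb C\setminus\{0,1,y^{-1}\}$ generated by the branches of $x^b(1-x)^{c-b}(1-yx)^{-a}$, and let $M_{\mathrm B}^\vee=H_1(\mathbb C\setminus\{0,1,y^{-1}\},\mathcal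 L^\vee)$. Fix once and for all (independently of $a,b,c$) determinations of $\log y$ and $\log(-1)$. Let $\varphi_1,\varphi_2\in M_{\mathrm B}^\vee$ be classes whose images under the natural map $M_{\mathrm B}^\vee\to H_1^{\mathrm{lf}}(\mathbb C\setminus\{0,1,y^{-1}\},\mathcal L^\vee)$ to locally finite homology are the classes of the following locally finite paths with branches: $p_1(t)=t$ for $t\in(0,1)$, with the branch given by the principal determinations of $\log t$, $\log(1-t)$, $\log(1-yt)$; and $p_2(t)=\frac1{yt}$ for $t\in(0,1)$, with the branch given by $\log x=-\log y-\log t$, $\log(1-x)=\log(-1)+\log(1-yt)-\log y-\log t$, $\log(1-yx)=\log(-1)+\log(1-t)-\log t$. The period matrix $P_{a,b,c}(y)$ has entries $\langle\varphi_i,\mathrm{comp}(\eta_j)\rangle$, where $\mathrm{comp}:M_{\mathrm{dR}}\to\mathrm{Hom}_{\mathbb Q_{\mathrm B}}(M_{\mathrm B}^\vee,\mathbb C)=M_{\mathrm B}\otimes\mathbb C$ is the comparison, given by integration of forms over twisted cycles. *The functions.* With the same branches put $$\mathcal F(a,b,c;y)=\int_0^1x^b(1-x)^{c-b}(1-yx)^{-a}\frac{dx}{x(1-x)}\quad(\mathrm{Re}\,c>\mathrm{Re}\,b>0),$$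 $$\mathcal G(a,b,c;y)=\int_\infty^{y^{-1}}x^b(1-x)^{c-b}(1-yx)^{-a}\frac{dx}{x(1-x)}\quad(\mathrm{Re}\,c<\mathrm{Re}\,a+1<2),$$ the first integral along $p_1$ and the second along $p_2$. Then $\mathcal F$ extends to a holomorphic function of $(a,b,c)$ on the domain $b,\,c-b\notin\mathbb Z_{\le 0}$, and $\mathcal G$ extends to a holomorphic function of $(a,b,c)$ on the domain $a,\,c-a\notin\mathbb Z_{\ge1}$; denote the extensions by the same letters. **Proposition.** For all generic $a,b,c$, classes $\varphi_1,\varphi_2$ as above exist, and for all such classes $$P_{a,b,c}(y)=\begin{pmatrix}\mathcal F(a,b,c;y)&\mathcal F(1+a,1+b,2+c;y)\\ \mathcal G(a,b,c;y)&\mathcal G(1+a,1+b,2+c;y)\end{pmatrix}.$$ -/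

import Mathlib

open scoped ContDiff Polynomial KaehlerDifferential

namespace TwistedPeriods

/-- The complex points `ℂ ∖ {0, 1, y⁻¹}` of the punctured line. -/
def puncturedPlane (y : ℂ) : Set ℂ := {0, 1, y⁻¹}ᶜ

theorem isOpen_puncturedPlane (y : ℂ) : IsOpen (puncturedPlane y) :=
  (Set.toFinite ({0, 1, y⁻¹} : Set ℂ)).isClosed.isOpen_compl

theorem one_sub_mul_ne_zero {y z : ℂ} (hz : z ∈ puncturedPlane y) : 1 - y * z ≠ 0 := by
  have h : z ≠ 0 ∧ z ≠ 1 ∧ z ≠ y⁻¹ := by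
    simpa [puncturedPlane, not_or] using hz
  intro h0
  exact h.2.2 (eq_inv_of_mul_eq_one_right (sub_eq_zero.mp h0).symm)

theorem ne_zero_of_mem {y z : ℂ} (hz : z ∈ puncturedPlane y) : z ≠ 0 := by
  have h : z ≠ 0 ∧ z ≠ 1 ∧ z ≠ y⁻¹ := by
    simpa [puncturedPlane, not_or] using hz
  exact h.1

theorem one_sub_ne_zero {y z : ℂ} (hz : z ∈ puncturedPlane y) : 1 - z ≠ 0 := by
  have h : z ≠ 0 ∧ z ≠ 1 ∧ z ≠ y⁻¹ := by
    simpa [puncturedPlane, not_or] using hz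
  exact sub_ne_zero.mpr (Ne.symm h.2.1)

/-! ### Twisted algebraic de Rham cohomology over a field `K` with a map to `ℂ` -/

section deRham

variable {K : Type*} [Field K] (y a b c : K)

/-- The polynomial `x (1 - x) (1 - y x)`. -/
noncomputable def puncturePoly : K[X] :=
  Polynomial.X * (1 - Polynomial.X) * (1 - Polynomial.C y * Polynomial.X)

/-- The coordinate ring of the affine curve `X = 𝔸¹ ∖ {0, 1, y⁻¹}` over `K`. -/
abbrev CoordRing : Type _ := Localization.Away (puncturePoly y)

/-- The algebraic differential forms `Ω¹(X)`. -/
abbrev Forms : Type _ := Ω[CoordRing y⁄K]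

/-- The coordinate `x`, as a regular function on `X`. -/
noncomputable def coordX : CoordRing y := algebraMap K[X] (CoordRing y) Polynomial.X

/-- The (invertible) regular function `1 - x`. -/
noncomputable def coordOneSub : CoordRing y := 1 - coordX y

/-- The (invertible) regular function `1 - y x`. -/
noncomputable def coordOneSubY : CoordRing y := 1 - algebraMap K (CoordRing y) y * coordX y

variable {y} in
/-- `d log u = u⁻¹ du`, for an invertible regular function `u`. -/
noncomputable def dlog (u : CoordRing y) : Forms y :=
  Ring.inverse u • KaehlerDifferential.D K (CoordRing y) u

/-- The connection form `∇(1) = b dlog(x) + (c - b) dlog(1 - x) - a dlog(1 - y x)`. -/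
noncomputable def connForm : Forms y :=
  b • dlog (coordX y) + (c - b) • dlog (coordOneSub y) - a • dlog (coordOneSubY y)

/-- The connection `∇ f = df + f ∇(1)` on the trivial line bundle on `X`. -/
noncomputable def nabla : CoordRing y →ₗ[K] Forms y :=
  (KaehlerDifferential.D K (CoordRing y)).toLinearMap
    + (LinearMap.toSpanSingleton (CoordRing y) (Forms y) (connForm y a b c)).restrictScalars K

/-- The twisted algebraic de Rham cohomology `H¹(X, ∇)`: since `X` is an affine curve, the first
hypercohomology group of `(Ω^•, ∇)` is the cokernel of `∇ : 𝒪(X) → Ω¹(X)`. -/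
abbrev TwistedDR : Type _ := Forms y ⧸ LinearMap.range (nabla y a b c)

/-- The form `dx / (x (1 - x))`. -/
noncomputable def etaForm1 : Forms y :=
  Ring.inverse (coordX y * coordOneSub y) • KaehlerDifferential.D K (CoordRing y) (coordX y)

/-- The form `dx / (1 - y x)`. -/
noncomputable def etaForm2 : Forms y :=
  Ring.inverse (coordOneSubY y) • KaehlerDifferential.D K (CoordRing y) (coordX y)

/-- The pair of de Rham classes `η₁ = [dx / (x (1 - x))]` and `η₂ = [dx / (1 - y x)]`. -/
noncomputable def etaClass : Fin 2 → TwistedDR y a b c :=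
  ![Submodule.Quotient.mk (etaForm1 y), Submodule.Quotient.mk (etaForm2 y)]

variable {y} in
theorem coord_mul_isUnit : IsUnit (coordX y * coordOneSub y * coordOneSubY y) := by
  have h : coordX y * coordOneSub y * coordOneSubY y
      = algebraMap K[X] (CoordRing y) (puncturePoly y) := by
    have hC : algebraMap K[X] (CoordRing y) (Polynomial.C y) = algebraMap K (CoordRing y) y :=
      (IsScalarTower.algebraMap_apply K K[X] (CoordRing y) y).symm
    simp only [puncturePoly, coordX, coordOneSub, coordOneSubY, map_mul, map_sub, map_one, hC]
  rw [h]
  exact IsLocalization.Away.algebraMap_isUnit _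

variable {y} in
theorem coordX_isUnit : IsUnit (coordX y) :=
  isUnit_of_mul_isUnit_left (isUnit_of_mul_isUnit_left coord_mul_isUnit)

variable {y} in
theorem coordOneSub_isUnit : IsUnit (coordOneSub y) :=
  isUnit_of_mul_isUnit_right (isUnit_of_mul_isUnit_left coord_mul_isUnit)

variable {y} in
theorem coordOneSubY_isUnit : IsUnit (coordOneSubY y) :=
  isUnit_of_mul_isUnit_right coord_mul_isUnit

/-! ### Analytification of algebraic functions and forms -/

variable [Algebra K ℂ]

theorem puncturePoly_aeval (z : ℂ) : Polynomial.aeval z (puncturePoly y)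
    = z * (1 - z) * (1 - algebraMap K ℂ y * z) := by
  simp only [puncturePoly, map_mul, map_sub, map_one, Polynomial.aeval_X, Polynomial.aeval_C]

variable {y} in
theorem puncturePoly_eval_isUnit {z : ℂ} (hz : z ∈ puncturedPlane (algebraMap K ℂ y)) :
    IsUnit (Polynomial.aeval z (puncturePoly y)) := by
  rw [puncturePoly_aeval]
  exact (mul_ne_zero (mul_ne_zero (ne_zero_of_mem hz) (one_sub_ne_zero hz))
    (one_sub_mul_ne_zero hz)).isUnit

variable {y} in
/-- Evaluation of regular functions at a complex point of `X`. -/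
noncomputable def evalHom {z : ℂ} (hz : z ∈ puncturedPlane (algebraMap K ℂ y)) :
    CoordRing y →ₐ[K] ℂ :=
  IsLocalization.Away.liftAlgHom (puncturePoly y)
    (f := Polynomial.aeval z) (puncturePoly_eval_isUnit hz)

open Classical in
variable {y} in
/-- The holomorphic function on `ℂ ∖ {0, 1, y⁻¹}` attached to a regular function. -/
noncomputable def fval (f : CoordRing y) (z : ℂ) : ℂ :=
  if hz : z ∈ puncturedPlane (algebraMap K ℂ y) then evalHom hz f else 0

variable {y}

theorem fval_of_mem {z : ℂ} (hz : z ∈ puncturedPlane (algebraMap K ℂ y)) (f : CoordRing y) :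
    fval f z = evalHom hz f := by
  simp [fval, hz]

theorem fval_add (f g : CoordRing y) : fval (f + g) = fval f + fval g := by
  funext z
  by_cases hz : z ∈ puncturedPlane (algebraMap K ℂ y) <;> simp [fval, hz]

theorem fval_mul (f g : CoordRing y) : fval (f * g) = fval f * fval g := by
  funext z
  by_cases hz : z ∈ puncturedPlane (algebraMap K ℂ y) <;> simp [fval, hz]

theorem fval_smul (r : K) (f : CoordRing y) :
    fval (r • f) = fun z => algebraMap K ℂ r * fval f z := by
  funext z
  by_cases hz : z ∈ puncturedPlane (algebraMap K ℂ y)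
  · rw [fval_of_mem hz, fval_of_mem hz, map_smul, Algebra.smul_def]
  · simp [fval, hz]

theorem fval_differentiableOn (f : CoordRing y) :
    DifferentiableOn ℂ (fval f) (puncturedPlane (algebraMap K ℂ y)) := by
  obtain ⟨n, p, hp⟩ := IsLocalization.Away.surj (puncturePoly y) f
  have key : ∀ z (hz : z ∈ puncturedPlane (algebraMap K ℂ y)),
      fval f z = Polynomial.aeval z p / (Polynomial.aeval z (puncturePoly y)) ^ n := by
    intro z hz
    have hu := (puncturePoly_eval_isUnit hz).ne_zero
    rw [eq_div_iff (pow_ne_zero _ hu), fval_of_mem hz]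
    have h := congrArg (evalHom hz) hp
    simpa [evalHom] using h
  refine DifferentiableOn.congr ?_ key
  refine DifferentiableOn.div ?_ ?_ ?_
  · exact (Polynomial.differentiable_aeval p).differentiableOn
  · exact ((Polynomial.differentiable_aeval _).pow n).differentiableOn
  · intro z hz
    exact pow_ne_zero _ (puncturePoly_eval_isUnit hz).ne_zero

theorem fval_differentiableAt (f : CoordRing y) {z : ℂ}
    (hz : z ∈ puncturedPlane (algebraMap K ℂ y)) : DifferentiableAt ℂ (fval f) z :=
  (fval_differentiableOn f).differentiableAt ((isOpen_puncturedPlane _).mem_nhds hz)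

/-- The functional `η ↦ (η / dx)(z)` on algebraic forms: it sends `f dg` to `f(z) g'(z)`. -/
noncomputable def coeffAt {z : ℂ} (hz : z ∈ puncturedPlane (algebraMap K ℂ y)) :
    Forms y →ₗ[K] ℂ :=
  letI : Module (CoordRing y) ℂ := Module.compHom ℂ (evalHom hz).toRingHom
  haveI : IsScalarTower K (CoordRing y) ℂ :=
    ⟨fun r f w => by
      change evalHom hz (r • f) * w = r • (evalHom hz f * w)
      rw [map_smul, smul_mul_assoc]⟩
  (Derivation.liftKaehlerDifferential
    ({ toFun := fun f => deriv (fval f) z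
       map_add' := fun f g => by
        rw [fval_add, deriv_add (fval_differentiableAt f hz) (fval_differentiableAt g hz)]
       map_smul' := fun r f => by
        rw [fval_smul, deriv_const_mul _ (fval_differentiableAt f hz)]
        exact (Algebra.smul_def r _).symm
       map_one_eq_zero' := by
        have : fval (1 : CoordRing y) =ᶠ[nhds z] fun _ => (1 : ℂ) := by
          filter_upwards [(isOpen_puncturedPlane _).mem_nhds hz] with w hw
          rw [fval_of_mem hw, map_one]
        change deriv (fval (1 : CoordRing y)) z = 0
        rw [this.deriv_eq, deriv_const]
       leibniz' := fun f g => by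
        change deriv (fval (f * g)) z
          = evalHom hz f * deriv (fval g) z + evalHom hz g * deriv (fval f) z
        rw [fval_mul, deriv_mul (fval_differentiableAt f hz) (fval_differentiableAt g hz),
          fval_of_mem hz, fval_of_mem hz]
        ring } : Derivation K (CoordRing y) ℂ)).restrictScalars K

open Classical in
/-- The function `g` on `ℂ ∖ {0, 1, y⁻¹}` such that `η = g dx`. -/
noncomputable def coeff (η : Forms y) (z : ℂ) : ℂ :=
  if hz : z ∈ puncturedPlane (algebraMap K ℂ y) then coeffAt hz η else 0

theorem coeffAt_smul_D {z : ℂ} (hz : z ∈ puncturedPlane (algebraMap K ℂ y)) (f g : CoordRing y) :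
    coeffAt hz (f • KaehlerDifferential.D K (CoordRing y) g) = fval f z * deriv (fval g) z := by
  let : Module (CoordRing y) ℂ := Module.compHom ℂ (evalHom hz).toRingHom
  rw [fval_of_mem hz]
  simp only [coeffAt, LinearMap.coe_restrictScalars, map_smul,
    Derivation.liftKaehlerDifferential_comp_D]
  rfl

theorem coeff_smul_D (f g : CoordRing y) :
    coeff (f • KaehlerDifferential.D K (CoordRing y) g) = fun z => fval f z * deriv (fval g) z := by
  funext z
  by_cases hz : z ∈ puncturedPlane (algebraMap K ℂ y)
  · rw [coeff, dif_pos hz, coeffAt_smul_D]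
  · rw [coeff, dif_neg hz, fval, dif_neg hz, zero_mul]

theorem coeff_add (η θ : Forms y) : coeff (η + θ) = coeff η + coeff θ := by
  funext z
  by_cases hz : z ∈ puncturedPlane (algebraMap K ℂ y) <;> simp [coeff, hz]

theorem coeff_smul (r : K) (η : Forms y) :
    coeff (r • η) = fun z => algebraMap K ℂ r * coeff η z := by
  funext z
  by_cases hz : z ∈ puncturedPlane (algebraMap K ℂ y)
  · simp only [coeff, hz, dif_pos, map_smul, Algebra.smul_def]
  · simp [coeff, hz]

theorem coeff_differentiableOn (η : Forms y) :
    DifferentiableOn ℂ (coeff η) (puncturedPlane (algebraMap K ℂ y)) := by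
  have hη : η ∈ Submodule.span (CoordRing y) (Set.range (KaehlerDifferential.D K (CoordRing y))) := by
    rw [KaehlerDifferential.span_range_derivation]; trivial
  obtain ⟨l, rfl⟩ := Finsupp.mem_span_range_iff_exists_finsupp.mp hη
  clear hη
  induction l using Finsupp.induction_linear with
  | zero =>
    have : coeff (0 : Forms y) = fun _ => 0 := by
      funext z; by_cases hz : z ∈ puncturedPlane (algebraMap K ℂ y) <;> simp [coeff, hz]
    simp [this]
  | add l m hl hm =>
    rw [Finsupp.sum_add_index' (by simp) (by intros; rw [add_smul]), coeff_add]
    exact hl.add hm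
  | single f g =>
    rw [Finsupp.sum_single_index (by simp), coeff_smul_D]
    exact (fval_differentiableOn g).mul
      ((fval_differentiableOn f).deriv (isOpen_puncturedPlane _))

theorem fval_coordX {z : ℂ} (hz : z ∈ puncturedPlane (algebraMap K ℂ y)) :
    fval (coordX y) z = z := by
  rw [fval_of_mem hz]; simp [evalHom, coordX]

theorem fval_coordOneSub {z : ℂ} (hz : z ∈ puncturedPlane (algebraMap K ℂ y)) :
    fval (coordOneSub y) z = 1 - z := by
  rw [fval_of_mem hz, coordOneSub, map_sub, map_one, ← fval_of_mem hz, fval_coordX hz]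

theorem fval_coordOneSubY {z : ℂ} (hz : z ∈ puncturedPlane (algebraMap K ℂ y)) :
    fval (coordOneSubY y) z = 1 - algebraMap K ℂ y * z := by
  rw [fval_of_mem hz, coordOneSubY, map_sub, map_one, map_mul, ← fval_of_mem hz, ← fval_of_mem hz,
    fval_coordX hz, fval_of_mem hz, AlgHom.commutes]

theorem fval_inverse {u : CoordRing y} (hu : IsUnit u) {z : ℂ}
    (hz : z ∈ puncturedPlane (algebraMap K ℂ y)) :
    fval (Ring.inverse u) z = (fval u z)⁻¹ := by
  refine eq_inv_of_mul_eq_one_left ?_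
  rw [fval_of_mem hz, fval_of_mem hz, ← map_mul, Ring.inverse_mul_cancel _ hu, map_one]

theorem deriv_fval_eq {f : CoordRing y} {g : ℂ → ℂ}
    (h : ∀ z ∈ puncturedPlane (algebraMap K ℂ y), fval f z = g z) {z : ℂ}
    (hz : z ∈ puncturedPlane (algebraMap K ℂ y)) : deriv (fval f) z = deriv g z := by
  refine Filter.EventuallyEq.deriv_eq ?_
  filter_upwards [(isOpen_puncturedPlane _).mem_nhds hz] with w hw using h w hw

/-- The logarithmic derivative of `x^b (1 - x)^(c - b) (1 - y x)^(-a)`. -/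
noncomputable def logDerivBranch (a b c y z : ℂ) : ℂ :=
  b / z - (c - b) / (1 - z) + a * y / (1 - y * z)

theorem coeff_connForm {z : ℂ} (hz : z ∈ puncturedPlane (algebraMap K ℂ y)) :
    coeff (connForm y a b c) z = logDerivBranch (algebraMap K ℂ a) (algebraMap K ℂ b)
      (algebraMap K ℂ c) (algebraMap K ℂ y) z := by
  have hd2 : deriv (fun z : ℂ => 1 - z) z = -1 := by
    rw [deriv_const_sub, deriv_id'']
  have hd3 : deriv (fun z : ℂ => 1 - algebraMap K ℂ y * z) z = - algebraMap K ℂ y := by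
    rw [deriv_const_sub, deriv_const_mul _ differentiableAt_fun_id, deriv_id'', mul_one]
  rw [connForm, sub_eq_add_neg, ← neg_smul, coeff_add, coeff_add, coeff_smul, coeff_smul,
    coeff_smul]
  simp only [Pi.add_apply, dlog, coeff_smul_D, fval_inverse coordX_isUnit hz,
    fval_inverse coordOneSub_isUnit hz, fval_inverse coordOneSubY_isUnit hz,
    fval_coordX hz, fval_coordOneSub hz, fval_coordOneSubY hz,
    deriv_fval_eq (fun z hz => fval_coordX hz) hz,
    deriv_fval_eq (fun z hz => fval_coordOneSub hz) hz,
    deriv_fval_eq (fun z hz => fval_coordOneSubY hz) hz, hd2, hd3, deriv_id'', map_sub, map_neg,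
    logDerivBranch]
  ring

theorem coeff_smul_fun (f : CoordRing y) (η : Forms y) :
    coeff (f • η) = fun z => fval f z * coeff η z := by
  funext z
  by_cases hz : z ∈ puncturedPlane (algebraMap K ℂ y)
  · rw [coeff, coeff, dif_pos hz, dif_pos hz, fval_of_mem hz]
    let : Module (CoordRing y) ℂ := Module.compHom ℂ (evalHom hz).toRingHom
    simp only [coeffAt, LinearMap.coe_restrictScalars, map_smul]
    rfl
  · simp [coeff, hz]

theorem coeff_nabla (f : CoordRing y) {z : ℂ} (hz : z ∈ puncturedPlane (algebraMap K ℂ y)) :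
    coeff (nabla y a b c f) z = deriv (fval f) z + fval f z * logDerivBranch (algebraMap K ℂ a)
      (algebraMap K ℂ b) (algebraMap K ℂ c) (algebraMap K ℂ y) z := by
  have h : nabla y a b c f
      = (1 : CoordRing y) • KaehlerDifferential.D K (CoordRing y) f + f • connForm y a b c := by
    simp [nabla]
  rw [h, coeff_add, coeff_smul_D, coeff_smul_fun, Pi.add_apply, coeff_connForm a b c hz,
    fval_of_mem hz 1, map_one, one_mul]

end deRham

end TwistedPeriods

namespace TwistedPeriods

/-! ### Smooth singular chains with coefficients in the local system of branches

Smooth singular simplices of `ℂ ∖ {0, 1, y⁻¹}` are used (they compute singular homology), so that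
differential forms can be integrated over them. -/

/-- The Betti coefficient field `ℚ(e^{2πia}, e^{2πib}, e^{2πic})`. -/
noncomputable abbrev QB (a b c : ℂ) : IntermediateField ℚ ℂ :=
  IntermediateField.adjoin ℚ
    {Complex.exp (2 * Real.pi * Complex.I * a), Complex.exp (2 * Real.pi * Complex.I * b),
      Complex.exp (2 * Real.pi * Complex.I * c)}

/-- The standard `n`-simplex. -/
abbrev Simplex (n : ℕ) : Type := stdSimplex ℝ (Fin (n + 1))

/-- Smooth singular `n`-simplices of `ℂ ∖ {0, 1, y⁻¹}`: maps from the standard simplex that are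
restrictions of smooth maps on the ambient space `ℝⁿ⁺¹`. -/
abbrev SmoothSimplex (y : ℂ) (n : ℕ) : Type :=
  {σ : Simplex n → ℂ //
    (∃ g : (Fin (n + 1) → ℝ) → ℂ, ContDiff ℝ ∞ g ∧ ∀ p : Simplex n, σ p = g p.1) ∧
      ∀ p, σ p ∈ puncturedPlane y}

/-- The inclusion of the `i`-th face (opposite to the `i`-th vertex) in the standard simplex. -/
noncomputable def faceMap {n : ℕ} (i : Fin (n + 2)) : Simplex n → Simplex (n + 1) :=
  stdSimplex.map i.succAbove

/-- The linear map extending `faceMap i`. -/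
noncomputable def faceLin {n : ℕ} (i : Fin (n + 2)) :
    (Fin (n + 1) → ℝ) →L[ℝ] (Fin (n + 2) → ℝ) :=
  LinearMap.toContinuousLinearMap (FunOnFinite.linearMap ℝ ℝ i.succAbove)

theorem faceMap_coe {n : ℕ} (i : Fin (n + 2)) (p : Simplex n) :
    (faceMap i p).1 = faceLin i p.1 := rfl

/-- The `i`-th face of a smooth singular simplex. -/
noncomputable def face {y : ℂ} {n : ℕ} (i : Fin (n + 2)) (σ : SmoothSimplex y (n + 1)) :
    SmoothSimplex y n :=
  ⟨fun p => σ.1 (faceMap i p), by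
    obtain ⟨⟨g, hg, hgσ⟩, hU⟩ := σ.2
    refine ⟨⟨fun v => g (faceLin i v), hg.comp (faceLin i).contDiff, fun p => ?_⟩, fun p => hU _⟩
    exact hgσ (faceMap i p)⟩

section Betti

variable (a b c y : ℂ)

/-- `s` is a branch of `x^b (1 - x)^(c - b) (1 - y x)^(-a)` along the simplex `σ`, obtained from
continuous determinations of `log x`, `log (1 - x)` and `log (1 - y x)` along `σ`. -/
def IsBranch {y : ℂ} {n : ℕ} (σ : SmoothSimplex y n) (s : Simplex n → ℂ) : Prop :=
  ∃ l₀ l₁ l₂ : C(Simplex n, ℂ),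
    (∀ p, Complex.exp (l₀ p) = σ.1 p) ∧ (∀ p, Complex.exp (l₁ p) = 1 - σ.1 p) ∧
    (∀ p, Complex.exp (l₂ p) = 1 - y * σ.1 p) ∧
    ∀ p, s p = Complex.exp (b * l₀ p + (c - b) * l₁ p - a * l₂ p)

/-- The sections along `σ` of the rank one local system of `ℚ_B`-vector spaces spanned by the
branches of `x^b (1 - x)^(c - b) (1 - y x)^(-a)`. -/
noncomputable def sections {y : ℂ} {n : ℕ} (σ : SmoothSimplex y n) :
    Submodule (QB a b c) (Simplex n → ℂ) :=
  Submodule.span (QB a b c) {s | IsBranch a b c σ s}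

/-- Possibly infinite families of functions along the singular simplices. -/
abbrev RawChain (y : ℂ) (n : ℕ) : Type := SmoothSimplex y n → Simplex n → ℂ

/-- Locally finite twisted chains: formal sums `∑ σ ⊗ s_σ` with `s_σ` a section along `σ`, such
that every compact subset of `ℂ ∖ {0, 1, y⁻¹}` meets only finitely many simplices of the sum. -/
noncomputable def lfChains (n : ℕ) : Submodule (QB a b c) (RawChain y n) where
  carrier := {C | (∀ σ, C σ ∈ sections a b c σ) ∧
    ∀ L : Set ℂ, L ⊆ puncturedPlane y → IsCompact L → {σ | C σ ≠ 0 ∧ ∃ p, σ.1 p ∈ L}.Finite}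
  zero_mem' := ⟨fun σ => zero_mem _, fun L _ _ => by simp⟩
  add_mem' {C D} hC hD := ⟨fun σ => add_mem (hC.1 σ) (hD.1 σ), fun L hL hK => by
    refine ((hC.2 L hL hK).union (hD.2 L hL hK)).subset ?_
    rintro σ ⟨h, hp⟩
    by_cases h0 : C σ = 0
    · exact Or.inr ⟨fun h1 => h (by simp [h0, h1]), hp⟩
    · exact Or.inl ⟨h0, hp⟩⟩
  smul_mem' r C hC := ⟨fun σ => Submodule.smul_mem _ r (hC.1 σ), fun L hL hK => by
    refine (hC.2 L hL hK).subset ?_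
    rintro σ ⟨h, hp⟩
    exact ⟨fun h0 => h (by simp [h0]), hp⟩⟩

/-- Ordinary (finite) twisted chains. -/
noncomputable def finChains (n : ℕ) : Submodule (QB a b c) (RawChain y n) where
  carrier := {C | (∀ σ, C σ ∈ sections a b c σ) ∧ {σ | C σ ≠ 0}.Finite}
  zero_mem' := ⟨fun σ => zero_mem _, by simp⟩
  add_mem' {C D} hC hD := ⟨fun σ => add_mem (hC.1 σ) (hD.1 σ), by
    refine (hC.2.union hD.2).subset ?_
    intro σ h
    by_cases h0 : C σ = 0
    · exact Or.inr fun h1 => h (by simp [h0, h1])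
    · exact Or.inl h0⟩
  smul_mem' r C hC := ⟨fun σ => Submodule.smul_mem _ r (hC.1 σ), by
    refine hC.2.subset ?_
    intro σ h h0
    exact h (by simp [h0])⟩

theorem finChains_le_lfChains (n : ℕ) : finChains a b c y n ≤ lfChains a b c y n :=
  fun _ hC => ⟨hC.1, fun _ _ _ => hC.2.subset fun _ h => h.1⟩

open Classical in
/-- The contribution of the simplex `σ` to the coefficient of `τ` in the boundary of `C`. -/
noncomputable def bdryTerm {y : ℂ} {n : ℕ} (C : RawChain y (n + 1)) (τ : SmoothSimplex y n)
    (σ : SmoothSimplex y (n + 1)) : Simplex n → ℂ :=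
  ∑ i : Fin (n + 2), if face i σ = τ then (-1 : ℂ) ^ (i : ℕ) • (C σ ∘ faceMap i) else 0

/-- The boundary `∂ (σ ⊗ s) = ∑ᵢ (-1)ⁱ (∂ᵢ σ ⊗ s|∂ᵢ σ)` of a (locally finite) twisted chain. -/
noncomputable def bdry {y : ℂ} {n : ℕ} (C : RawChain y (n + 1)) : RawChain y n :=
  fun τ => ∑ᶠ σ, bdryTerm C τ σ

variable {a b c y}

theorem bdryTerm_support_finite {n : ℕ} {C : RawChain y (n + 1)}
    (hC : C ∈ lfChains a b c y (n + 1)) (τ : SmoothSimplex y n) :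
    (Function.support (bdryTerm C τ)).Finite := by
  have p : Simplex n := Classical.arbitrary _
  refine (hC.2 {τ.1 p} (by simpa using τ.2.2 p) isCompact_singleton).subset ?_
  intro σ hσ
  obtain ⟨i, -, hi⟩ := Finset.exists_ne_zero_of_sum_ne_zero hσ
  by_cases h : face i σ = τ
  · rw [if_pos h] at hi
    refine ⟨fun h0 => hi (by funext q; simp [h0]), faceMap i p, ?_⟩
    rw [← h]; rfl
  · exact absurd (if_neg h) hi

theorem bdry_add {n : ℕ} {C D : RawChain y (n + 1)}
    (hC : C ∈ lfChains a b c y (n + 1)) (hD : D ∈ lfChains a b c y (n + 1)) :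
    bdry (C + D) = bdry C + bdry D := by
  funext τ
  rw [Pi.add_apply, bdry, bdry, bdry,
    ← finsum_add_distrib (bdryTerm_support_finite hC τ) (bdryTerm_support_finite hD τ)]
  refine finsum_congr fun σ => ?_
  rw [bdryTerm, bdryTerm, bdryTerm, ← Finset.sum_add_distrib]
  refine Finset.sum_congr rfl fun i _ => ?_
  split_ifs
  · funext q; simp [mul_add]
  · simp

theorem bdry_smul {n : ℕ} {C : RawChain y (n + 1)} (hC : C ∈ lfChains a b c y (n + 1))
    (r : QB a b c) : bdry (r • C) = r • bdry C := by
  funext τ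
  rw [Pi.smul_apply, bdry, bdry, smul_finsum' r (bdryTerm_support_finite hC τ)]
  refine finsum_congr fun σ => ?_
  rw [bdryTerm, bdryTerm, Finset.smul_sum]
  refine Finset.sum_congr rfl fun i _ => ?_
  split_ifs
  · funext q; simp
  · simp

theorem bdry_zero {n : ℕ} : bdry (0 : RawChain y (n + 1)) = 0 := by
  funext τ
  rw [Pi.zero_apply, bdry]
  refine finsum_eq_zero_of_forall_eq_zero fun σ => ?_
  refine Finset.sum_eq_zero fun i _ => ?_
  split_ifs
  · funext q; simp
  · rfl

variable (a b c y)

/-- The cycles in a space `A` of (locally finite) twisted `1`-chains. -/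
noncomputable def cyclesOf (A : Submodule (QB a b c) (RawChain y 1))
    (hA : A ≤ lfChains a b c y 1) : Submodule (QB a b c) (RawChain y 1) where
  carrier := {C | C ∈ A ∧ bdry C = 0}
  zero_mem' := ⟨zero_mem _, bdry_zero⟩
  add_mem' {C D} hC hD := ⟨add_mem hC.1 hD.1, by
    rw [bdry_add (hA hC.1) (hA hD.1), hC.2, hD.2, add_zero]⟩
  smul_mem' r C hC := ⟨Submodule.smul_mem _ r hC.1, by
    rw [bdry_smul (hA hC.1), hC.2, smul_zero]⟩

/-- The boundaries of a space `A` of (locally finite) twisted `2`-chains. -/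
noncomputable def boundariesOf (A : Submodule (QB a b c) (RawChain y 2))
    (hA : A ≤ lfChains a b c y 2) : Submodule (QB a b c) (RawChain y 1) where
  carrier := {C | ∃ D ∈ A, bdry D = C}
  zero_mem' := ⟨0, zero_mem _, bdry_zero⟩
  add_mem' := by
    rintro _ _ ⟨D, hD, rfl⟩ ⟨E, hE, rfl⟩
    exact ⟨D + E, add_mem hD hE, bdry_add (hA hD) (hA hE)⟩
  smul_mem' := by
    rintro r _ ⟨D, hD, rfl⟩
    exact ⟨r • D, Submodule.smul_mem _ r hD, bdry_smul (hA hD) r⟩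

/-- Ordinary twisted `1`-cycles. -/
noncomputable abbrev Z1 : Submodule (QB a b c) (RawChain y 1) :=
  cyclesOf a b c y (finChains a b c y 1) (finChains_le_lfChains a b c y 1)

/-- Ordinary twisted `1`-boundaries. -/
noncomputable abbrev B1 : Submodule (QB a b c) (RawChain y 1) :=
  boundariesOf a b c y (finChains a b c y 2) (finChains_le_lfChains a b c y 2)

/-- Locally finite twisted `1`-cycles. -/
noncomputable abbrev Z1lf : Submodule (QB a b c) (RawChain y 1) :=
  cyclesOf a b c y (lfChains a b c y 1) le_rfl

/-- Locally finite twisted `1`-boundaries. -/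
noncomputable abbrev B1lf : Submodule (QB a b c) (RawChain y 1) :=
  boundariesOf a b c y (lfChains a b c y 2) le_rfl

/-- The twisted homology `H₁(ℂ ∖ {0, 1, y⁻¹}, 𝓛^∨)`. -/
abbrev H1 : Type := Z1 a b c y ⧸ (B1 a b c y).submoduleOf (Z1 a b c y)

/-- The locally finite twisted homology `H₁^lf(ℂ ∖ {0, 1, y⁻¹}, 𝓛^∨)`. -/
abbrev H1lf : Type := Z1lf a b c y ⧸ (B1lf a b c y).submoduleOf (Z1lf a b c y)

theorem Z1_le_Z1lf : Z1 a b c y ≤ Z1lf a b c y :=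
  fun _ hC => ⟨finChains_le_lfChains a b c y 1 hC.1, hC.2⟩

/-- The natural map from ordinary to locally finite homology. -/
noncomputable def toLf : H1 a b c y →ₗ[QB a b c] H1lf a b c y :=
  Submodule.mapQ _ _ (Submodule.inclusion (Z1_le_Z1lf a b c y)) (by
    rintro z ⟨D, hD, hz⟩
    exact ⟨D, finChains_le_lfChains a b c y 2 hD, hz⟩)

end Betti

end TwistedPeriods

namespace TwistedPeriods

/-! ### Integration of twisted forms over twisted chains -/

section Integration

variable {a b c y : ℂ}

/-- The path `t ↦ (1 - t, t)` from vertex `0` to vertex `1` of the standard `1`-simplex. -/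
noncomputable def edgePt (t : ℝ) : Simplex 1 :=
  stdSimplexHomeomorphUnitInterval.symm (Set.projIcc 0 1 zero_le_one t)

/-- The integral `∫_σ s · g dx` over a singular `1`-simplex `σ`. -/
noncomputable def segInt (g : ℂ → ℂ) (σ : SmoothSimplex y 1) (s : Simplex 1 → ℂ) : ℂ :=
  ∫ t in (0 : ℝ)..1, s (edgePt t) * g (σ.1 (edgePt t)) *
    derivWithin (fun u => σ.1 (edgePt u)) (Set.Icc 0 1) t

theorem edgePt_coe {t : ℝ} (ht : t ∈ Set.Icc (0 : ℝ) 1) : (edgePt t).1 = ![1 - t, t] := by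
  rw [edgePt, Set.projIcc_of_mem _ ht]; rfl

theorem continuous_edgePt : Continuous edgePt :=
  stdSimplexHomeomorphUnitInterval.symm.continuous.comp continuous_projIcc

theorem hasDerivWithinAt_edge {E : Type*} [NormedAddCommGroup E] [NormedSpace ℝ E]
    {F : (Fin 2 → ℝ) → E} {F' : (Fin 2 → ℝ) →L[ℝ] E} {t : ℝ} (ht : t ∈ Set.Icc (0 : ℝ) 1)
    (hF : HasFDerivWithinAt F F' (stdSimplex ℝ (Fin 2)) (edgePt t).1) :
    HasDerivWithinAt (fun u => F (edgePt u).1) (F' ![-1, 1]) (Set.Icc 0 1) t := by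
  have h1 : HasDerivWithinAt (fun u : ℝ => (edgePt u).1) ![-1, 1] (Set.Icc 0 1) t := by
    have h2 : HasDerivWithinAt (fun u : ℝ => ![1 - u, u]) ![-1, 1] (Set.Icc 0 1) t := by
      rw [hasDerivWithinAt_pi]
      intro i
      fin_cases i
      · exact (hasDerivWithinAt_id t (Set.Icc 0 1)).const_sub 1
      · exact hasDerivWithinAt_id t (Set.Icc 0 1)
    exact h2.congr (fun u hu => edgePt_coe hu) (edgePt_coe ht)
  exact hF.comp_hasDerivWithinAt t h1 (fun u _ => (edgePt u).2)

/-- `F` is a primitive of the pulled back form `s · σ^*(g dx)` on the standard simplex, where the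
smooth function `G` extends `σ`. -/
def IsPrim {n : ℕ} (g : ℂ → ℂ) (σ : SmoothSimplex y n) (s : Simplex n → ℂ)
    (G F : (Fin (n + 1) → ℝ) → ℂ) : Prop :=
  ∀ p : Simplex n, HasFDerivWithinAt F ((s p * g (σ.1 p)) • fderiv ℝ G p.1)
    (stdSimplex ℝ (Fin (n + 1))) p.1

theorem edge_hasDerivWithinAt {σ : SmoothSimplex y 1} {G : (Fin 2 → ℝ) → ℂ}
    (hG : ContDiff ℝ ∞ G) (hσ : ∀ p : Simplex 1, σ.1 p = G p.1) {t : ℝ}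
    (ht : t ∈ Set.Icc (0 : ℝ) 1) :
    HasDerivWithinAt (fun u => σ.1 (edgePt u)) (fderiv ℝ G (edgePt t).1 ![-1, 1])
      (Set.Icc 0 1) t := by
  have h := hasDerivWithinAt_edge ht
    ((hG.differentiable (by simp)) (edgePt t).1).hasFDerivAt.hasFDerivWithinAt
  exact h.congr (fun u _ => hσ _) (hσ _)

theorem segInt_intervalIntegrable {g : ℂ → ℂ} (hg : ContinuousOn g (puncturedPlane y))
    (σ : SmoothSimplex y 1) {s : Simplex 1 → ℂ} (hs : Continuous s) :
    IntervalIntegrable (fun t => s (edgePt t) * g (σ.1 (edgePt t)) *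
      derivWithin (fun u => σ.1 (edgePt u)) (Set.Icc 0 1) t) MeasureTheory.volume 0 1 := by
  obtain ⟨⟨G, hG, hσ⟩, hU⟩ := σ.2
  apply ContinuousOn.intervalIntegrable
  rw [Set.uIcc_of_le zero_le_one]
  have hc : Continuous fun t => s (edgePt t) * g (σ.1 (edgePt t)) *
      fderiv ℝ G (edgePt t).1 ![-1, 1] := by
    have hσc : Continuous fun t => σ.1 (edgePt t) := by
      simp only [hσ]
      exact hG.continuous.comp (continuous_subtype_val.comp continuous_edgePt)
    refine ((hs.comp continuous_edgePt).mul ?_).mul ?_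
    · exact hg.comp_continuous hσc (fun t => hU _)
    · exact ((hG.continuous_fderiv (by simp)).comp
        (continuous_subtype_val.comp continuous_edgePt)).clm_apply continuous_const
  refine hc.continuousOn.congr fun t ht => ?_
  change _ * _ * _ = _ * _ * _
  rw [(edge_hasDerivWithinAt hG hσ ht).derivWithin (uniqueDiffOn_Icc_zero_one t ht)]

theorem segInt_eq_sub {g : ℂ → ℂ} (hg : ContinuousOn g (puncturedPlane y))
    {σ : SmoothSimplex y 1} {s : Simplex 1 → ℂ} (hs : Continuous s) {G F : (Fin 2 → ℝ) → ℂ}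
    (hG : ContDiff ℝ ∞ G) (hσ : ∀ p : Simplex 1, σ.1 p = G p.1) (hF : IsPrim g σ s G F) :
    segInt g σ s = F (Pi.single 1 1) - F (Pi.single 0 1) := by
  have hd : ∀ t ∈ Set.Icc (0 : ℝ) 1, HasDerivWithinAt (fun u => F (edgePt u).1)
      (s (edgePt t) * g (σ.1 (edgePt t)) *
        derivWithin (fun u => σ.1 (edgePt u)) (Set.Icc 0 1) t) (Set.Icc 0 1) t := by
    intro t ht
    rw [(edge_hasDerivWithinAt hG hσ ht).derivWithin (uniqueDiffOn_Icc_zero_one t ht)]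
    exact hasDerivWithinAt_edge ht (hF (edgePt t))
  have h := intervalIntegral.integral_eq_sub_of_hasDerivAt_of_le zero_le_one
    (fun t ht => (hd t ht).continuousWithinAt)
    (fun t ht => (hd t (Set.Ioo_subset_Icc_self ht)).hasDerivAt (Icc_mem_nhds ht.1 ht.2))
    (segInt_intervalIntegrable hg σ hs)
  have h0 : (edgePt 0).1 = Pi.single 0 1 := by
    rw [edgePt_coe (by simp)]; ext i; fin_cases i <;> simp
  have h1 : (edgePt 1).1 = Pi.single 1 1 := by
    rw [edgePt_coe (by simp)]; ext i; fin_cases i <;> simp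
  rw [segInt, h, h0, h1]

theorem IsPrim.face {n : ℕ} {g : ℂ → ℂ} {σ : SmoothSimplex y (n + 1)} {s : Simplex (n + 1) → ℂ}
    {G F : (Fin (n + 2) → ℝ) → ℂ} (hG : ContDiff ℝ ∞ G) (hF : IsPrim g σ s G F)
    (i : Fin (n + 2)) :
    IsPrim g (face i σ) (s ∘ faceMap i) (G ∘ faceLin i) (F ∘ faceLin i) := by
  intro p
  have h := (hF (faceMap i p)).comp p.1 (faceLin i).hasFDerivWithinAt
    (t := stdSimplex ℝ (Fin (n + 2))) (s := stdSimplex ℝ (Fin (n + 1)))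
    (fun q hq => (faceMap i ⟨q, hq⟩).2)
  have hd : fderiv ℝ (G ∘ faceLin i) p.1 = (fderiv ℝ G (faceMap i p).1).comp (faceLin i) := by
    rw [fderiv_comp _ ((hG.differentiable (by simp)) _) (faceLin i).differentiableAt,
      ContinuousLinearMap.fderiv]
    rfl
  rw [hd]
  exact h

theorem section_continuous {n : ℕ} {σ : SmoothSimplex y n} {s : Simplex n → ℂ}
    (hs : s ∈ sections a b c σ) : Continuous s := by
  induction hs using Submodule.span_induction with
  | mem s h =>
    obtain ⟨l₀, l₁, l₂, -, -, -, h⟩ := h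
    rw [funext h]
    fun_prop
  | zero => exact continuous_const
  | add s t _ _ hs ht => exact hs.add ht
  | smul r s _ hs => exact continuous_const.mul hs

theorem section_face {n : ℕ} {σ : SmoothSimplex y (n + 1)} {s : Simplex (n + 1) → ℂ}
    (hs : s ∈ sections a b c σ) (i : Fin (n + 2)) :
    s ∘ faceMap i ∈ sections a b c (face i σ) := by
  induction hs using Submodule.span_induction with
  | mem s h =>
    obtain ⟨l₀, l₁, l₂, h0, h1, h2, h⟩ := h
    let f : C(Simplex n, Simplex (n + 1)) := ⟨faceMap i, stdSimplex.continuous_map _⟩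
    exact Submodule.subset_span ⟨l₀.comp f, l₁.comp f, l₂.comp f, fun p => h0 _, fun p => h1 _,
      fun p => h2 _, fun p => h _⟩
  | zero => exact zero_mem _
  | add s t _ _ hs ht => exact add_mem hs ht
  | smul r s _ hs => exact Submodule.smul_mem _ r hs

/-- Extension by zero from the standard simplex to the ambient space. -/
noncomputable def extendZero {n : ℕ} (s : Simplex n → ℂ) : (Fin (n + 1) → ℝ) → ℂ :=
  Function.extend Subtype.val s 0

theorem extendZero_apply {n : ℕ} (s : Simplex n → ℂ) (p : Simplex n) :
    extendZero s p.1 = s p := Subtype.val_injective.extend_apply _ _ _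

theorem extendZero_of_mem {n : ℕ} (s : Simplex n → ℂ) {q : Fin (n + 1) → ℝ}
    (hq : q ∈ stdSimplex ℝ (Fin (n + 1))) : extendZero s q = s ⟨q, hq⟩ :=
  extendZero_apply s ⟨q, hq⟩

theorem hasFDerivWithinAt_log {n : ℕ} (l : C(Simplex n, ℂ)) {u : (Fin (n + 1) → ℝ) → ℂ}
    {u' : (Fin (n + 1) → ℝ) →L[ℝ] ℂ} (p : Simplex n) (hl : ∀ q, Complex.exp (l q) = u q.1)
    (hu : HasFDerivAt u u' p.1) :
    HasFDerivWithinAt (extendZero l) ((u p.1)⁻¹ • u') (stdSimplex ℝ (Fin (n + 1))) p.1 := by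
  have hne : u p.1 ≠ 0 := by rw [← hl]; exact Complex.exp_ne_zero _
  have h1 : HasFDerivAt (fun q => l p + Complex.log (u q / u p.1)) ((u p.1)⁻¹ • u') p.1 := by
    have h2 : HasFDerivAt (fun q => u q / u p.1) ((u p.1)⁻¹ • u') p.1 := by
      simpa only [div_eq_mul_inv] using hu.mul_const (u p.1)⁻¹
    have hlog : HasDerivAt Complex.log 1 (u p.1 / u p.1) := by
      rw [div_self hne]
      simpa using Complex.hasDerivAt_log Complex.one_mem_slitPlane
    simpa using (hlog.comp_hasFDerivAt p.1 h2).const_add (l p)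
  refine h1.hasFDerivWithinAt.congr_of_eventuallyEq ?_ ?_
  · rw [Filter.EventuallyEq, eventually_nhdsWithin_iff]
    have hev : ∀ᶠ q in nhds p, ‖l q - l p‖ < 1 := by
      have : Filter.Tendsto (fun q => ‖l q - l p‖) (nhds p) (nhds 0) := by
        have h : Continuous fun q => ‖l q - l p‖ := by fun_prop
        simpa using h.tendsto p
      exact this.eventually (gt_mem_nhds one_pos)
    rw [nhds_subtype, Filter.eventually_comap] at hev
    filter_upwards [hev] with q hq hqs
    have h1 := hq ⟨q, hqs⟩ rfl
    have him := (Complex.abs_im_le_norm (l ⟨q, hqs⟩ - l p)).trans_lt h1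
    rw [abs_lt] at him
    rw [show q = (⟨q, hqs⟩ : Simplex n).1 from rfl, extendZero_apply, ← hl, ← hl, ← Complex.exp_sub,
      Complex.log_exp (by linarith [Real.pi_gt_three]) (by linarith [Real.pi_gt_three])]
    ring
  · rw [extendZero_apply, div_self hne, Complex.log_one, add_zero]

theorem section_hasFDerivWithinAt {n : ℕ} {σ : SmoothSimplex y n} {s : Simplex n → ℂ}
    (hs : s ∈ sections a b c σ) {G : (Fin (n + 1) → ℝ) → ℂ} (hG : ContDiff ℝ ∞ G)
    (hσ : ∀ p : Simplex n, σ.1 p = G p.1) (p : Simplex n) :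
    HasFDerivWithinAt (extendZero s) ((s p * logDerivBranch a b c y (σ.1 p)) • fderiv ℝ G p.1)
      (stdSimplex ℝ (Fin (n + 1))) p.1 := by
  have hGp : HasFDerivAt G (fderiv ℝ G p.1) p.1 := ((hG.differentiable (by simp)) p.1).hasFDerivAt
  induction hs using Submodule.span_induction with
  | mem s h =>
    obtain ⟨l₀, l₁, l₂, h0, h1, h2, h⟩ := h
    have d0 := hasFDerivWithinAt_log l₀ p (u := G) (fun q => by rw [h0, hσ]) hGp
    have d1 := hasFDerivWithinAt_log l₁ p (u := fun q => 1 - G q) (fun q => by rw [h1, hσ])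
      (hGp.const_sub 1)
    have d2 := hasFDerivWithinAt_log l₂ p (u := fun q => 1 - y * G q) (fun q => by rw [h2, hσ])
      ((hGp.const_mul y).const_sub 1)
    have d := (((d0.const_mul b).add (d1.const_mul (c - b))).sub (d2.const_mul a)).cexp
    have d' := d.congr (f₁ := extendZero s) (fun q hq => by
      simp [extendZero_of_mem _ hq, h]) (by
      rw [extendZero_apply, h]; simp [extendZero_apply])
    refine d'.congr_fderiv ?_
    ext v
    rw [h, logDerivBranch, hσ]
    simp [extendZero_apply]
    ring
  | zero =>
    have : extendZero (0 : Simplex n → ℂ) = fun _ => 0 := by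
      funext q; simp only [extendZero, Function.extend]; split_ifs <;> rfl
    rw [this]
    refine (hasFDerivWithinAt_const (0 : ℂ) p.1 (stdSimplex ℝ (Fin (n + 1)))).congr_fderiv ?_
    rw [Pi.zero_apply, zero_mul]
    ext v; simp
  | add s t _ _ hs ht =>
    refine ((hs.add ht).congr (f₁ := extendZero (s + t)) (fun q hq => ?_) ?_).congr_fderiv ?_
    · simp [extendZero_of_mem _ hq]
    · simp [extendZero_apply]
    · ext v; simp; ring
  | smul r s _ hs =>
    refine ((hs.const_mul (r : ℂ)).congr (f₁ := extendZero (r • s)) (fun q hq => ?_) ?_).congr_fderiv ?_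
    · simp only [extendZero_of_mem _ hq]; rfl
    · simp only [extendZero_apply]; rfl
    · rw [smul_smul, ← mul_assoc]; rfl

theorem exists_isPrim {n : ℕ} {g : ℂ → ℂ} (hg : DifferentiableOn ℂ g (puncturedPlane y))
    {σ : SmoothSimplex y n} {s : Simplex n → ℂ}
    (hs : s ∈ sections a b c σ) {G : (Fin (n + 1) → ℝ) → ℂ} (hG : ContDiff ℝ ∞ G)
    (hσ : ∀ p : Simplex n, σ.1 p = G p.1) : ∃ F, IsPrim g σ s G F := by
  have hder : ∀ p ∈ stdSimplex ℝ (Fin (n + 1)), HasFDerivWithinAt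
      (fun q => (extendZero s q * g (G q)) • fderiv ℝ G q)
      ((extendZero s p * g (G p)) • fderiv ℝ (fderiv ℝ G) p +
        ((extendZero s p * (deriv g (G p) + g (G p) * logDerivBranch a b c y (G p))) •
          fderiv ℝ G p).smulRight (fderiv ℝ G p)) (stdSimplex ℝ (Fin (n + 1))) p := by
    intro p hp
    have hU : G p ∈ puncturedPlane y := by
      have := σ.2.2 ⟨p, hp⟩; rwa [hσ] at this
    have hGp : HasFDerivAt G (fderiv ℝ G p) p := ((hG.differentiable (by simp)) p).hasFDerivAt
    have hgG : HasFDerivAt (fun q => g (G q)) (deriv g (G p) • fderiv ℝ G p) p :=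
      (hg.differentiableAt ((isOpen_puncturedPlane y).mem_nhds hU)).hasDerivAt.comp_hasFDerivAt p hGp
    have hG2 : HasFDerivAt (fderiv ℝ G) (fderiv ℝ (fderiv ℝ G) p) p :=
      (((hG.fderiv_right (m := ∞) (by simp)).differentiable (by simp)) p).hasFDerivAt
    have h1 := section_hasFDerivWithinAt hs hG hσ ⟨p, hp⟩
    have h2 := (h1.mul hgG.hasFDerivWithinAt).smul hG2.hasFDerivWithinAt
    refine h2.congr_fderiv ?_
    ext v w
    have e : extendZero s p = s ⟨p, hp⟩ := extendZero_apply s ⟨p, hp⟩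
    simp only [e, hσ, Pi.mul_apply, add_apply, smul_apply, ContinuousLinearMap.smulRight_apply,
      smul_eq_mul]
    ring
  obtain ⟨F, hF⟩ := (convex_stdSimplex ℝ (Fin (n + 1))).exists_forall_hasFDerivWithinAt_of_hasFDerivWithinAt_symmetric
    hder (by
      intro p hp v _ w _
      have hsym : fderiv ℝ (fderiv ℝ G) p v w = fderiv ℝ (fderiv ℝ G) p w v :=
        (hG.contDiffAt.isSymmSndFDerivAt (by simpa using (mod_cast le_top : ((2 : ℕ∞) : WithTop ℕ∞) ≤ ∞))).eq v w
      simp [hsym]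
      ring)
  refine ⟨F, fun p => (hF p.1 p.2).congr_fderiv ?_⟩
  rw [extendZero_apply, hσ]

end Integration

end TwistedPeriods

namespace TwistedPeriods

section Comparison

variable {a b c y : ℂ}

theorem apply_sum_sections {n : ℕ} {τ : SmoothSimplex y n} {φ : (Simplex n → ℂ) → ℂ}
    (hadd : ∀ s ∈ sections a b c τ, ∀ t ∈ sections a b c τ, φ (s + t) = φ s + φ t)
    (hzero : φ 0 = 0) {ι : Type*} (S : Finset ι) (f : ι → Simplex n → ℂ)
    (hf : ∀ i ∈ S, f i ∈ sections a b c τ) : φ (∑ i ∈ S, f i) = ∑ i ∈ S, φ (f i) := by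
  classical
  induction S using Finset.induction_on with
  | empty => simpa using hzero
  | insert i S hi ih =>
    rw [Finset.sum_insert hi, Finset.sum_insert hi,
      hadd _ (hf i (Finset.mem_insert_self _ _)) _
        (Submodule.sum_mem _ fun j hj => hf j (Finset.mem_insert_of_mem hj)),
      ih fun j hj => hf j (Finset.mem_insert_of_mem hj)]

theorem sign_smul_section {n : ℕ} (s : Simplex n → ℂ) (i : ℕ) :
    (-1 : ℂ) ^ i • s = (-1 : QB a b c) ^ i • s := by
  funext p
  simp [Algebra.smul_def]

/-- Summation of a fibrewise linear functional over the boundary of a finite chain. -/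
theorem finsum_bdry {n : ℕ} {C : RawChain y (n + 1)} (hC : C ∈ finChains a b c y (n + 1))
    (φ : SmoothSimplex y n → (Simplex n → ℂ) → ℂ)
    (hadd : ∀ τ, ∀ s ∈ sections a b c τ, ∀ t ∈ sections a b c τ, φ τ (s + t) = φ τ s + φ τ t)
    (hsmul : ∀ τ, ∀ s ∈ sections a b c τ, ∀ r : QB a b c, φ τ (r • s) = (r : ℂ) * φ τ s) :
    ∑ᶠ τ, φ τ (bdry C τ)
      = ∑ᶠ σ, ∑ i : Fin (n + 2), (-1 : ℂ) ^ (i : ℕ) * φ (face i σ) (C σ ∘ faceMap i) := by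
  classical
  have hzero : ∀ τ, φ τ 0 = 0 := fun τ => by
    simpa using hsmul τ 0 (zero_mem _) 0
  have hC0 : ∀ σ, C σ = 0 → ∀ i : Fin (n + 2), C σ ∘ faceMap i = 0 := fun σ h i => by
    funext q; simp [h]
  have hR : ∑ᶠ σ, ∑ i : Fin (n + 2), (-1 : ℂ) ^ (i : ℕ) * φ (face i σ) (C σ ∘ faceMap i)
      = ∑ σ ∈ hC.2.toFinset, ∑ i : Fin (n + 2),
          (-1 : ℂ) ^ (i : ℕ) * φ (face i σ) (C σ ∘ faceMap i) := by
    refine finsum_eq_sum_of_support_subset _ fun σ hσ => ?_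
    simp only [Set.Finite.coe_toFinset, Set.mem_ofPred_eq]
    intro h0
    refine hσ (Finset.sum_eq_zero fun i _ => ?_)
    rw [hC0 σ h0 i, hzero, mul_zero]
  have hb : ∀ τ, bdry C τ = ∑ σ ∈ hC.2.toFinset, bdryTerm C τ σ := by
    intro τ
    refine finsum_eq_sum_of_support_subset _ fun σ hσ => ?_
    simp only [Set.Finite.coe_toFinset, Set.mem_ofPred_eq]
    intro h0
    refine hσ (Finset.sum_eq_zero fun i _ => ?_)
    rw [hC0 σ h0 i, smul_zero, ite_self]
  have hterm : ∀ τ σ (i : Fin (n + 2)),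
      (if face i σ = τ then (-1 : ℂ) ^ (i : ℕ) • (C σ ∘ faceMap i) else 0) ∈ sections a b c τ := by
    intro τ σ i
    split_ifs with h
    · rw [← h, sign_smul_section (a := a) (b := b) (c := c)]
      exact Submodule.smul_mem _ _ (section_face (hC.1 σ) i)
    · exact zero_mem _
  have hφ : ∀ τ, φ τ (bdry C τ) = ∑ σ ∈ hC.2.toFinset, ∑ i : Fin (n + 2),
      if face i σ = τ then (-1 : ℂ) ^ (i : ℕ) * φ (face i σ) (C σ ∘ faceMap i) else 0 := by
    intro τ
    have hm : ∀ σ, bdryTerm C τ σ ∈ sections a b c τ := fun σ =>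
      Submodule.sum_mem _ fun i _ => hterm τ σ i
    rw [hb, apply_sum_sections (hadd τ) (hzero τ) _ _ fun σ _ => hm σ]
    refine Finset.sum_congr rfl fun σ _ => ?_
    rw [bdryTerm, apply_sum_sections (hadd τ) (hzero τ) _ _ fun i _ => hterm τ σ i]
    refine Finset.sum_congr rfl fun i _ => ?_
    split_ifs with h
    · rw [sign_smul_section (a := a) (b := b) (c := c), ← h,
        hsmul _ _ (section_face (hC.1 σ) i)]
      simp
    · exact hzero τ
  have hsupp : ∀ σ (i : Fin (n + 2)), (Function.support fun τ => if face i σ = τ then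
      (-1 : ℂ) ^ (i : ℕ) * φ (face i σ) (C σ ∘ faceMap i) else 0).Finite := by
    intro σ i
    refine (Set.finite_singleton (face i σ)).subset fun τ hτ => ?_
    by_contra h
    exact hτ (if_neg fun h' => h h'.symm)
  rw [hR, finsum_congr hφ, finsum_sum_comm]
  · refine Finset.sum_congr rfl fun σ _ => ?_
    rw [finsum_sum_comm _ _ fun i _ => hsupp σ i]
    refine Finset.sum_congr rfl fun i _ => ?_
    rw [finsum_eq_single _ (face i σ) fun τ hτ => if_neg (Ne.symm hτ), if_pos rfl]
  · intro σ _
    refine (Set.finite_iUnion fun i => hsupp σ i).subset fun τ hτ => ?_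
    obtain ⟨i, -, hi⟩ := Finset.exists_ne_zero_of_sum_ne_zero hτ
    exact Set.mem_iUnion.mpr ⟨i, hi⟩

theorem segInt_add {g : ℂ → ℂ} (hg : ContinuousOn g (puncturedPlane y)) (σ : SmoothSimplex y 1)
    {s t : Simplex 1 → ℂ} (hs : Continuous s) (ht : Continuous t) :
    segInt g σ (s + t) = segInt g σ s + segInt g σ t := by
  rw [segInt, segInt, segInt, ← intervalIntegral.integral_add (segInt_intervalIntegrable hg σ hs)
    (segInt_intervalIntegrable hg σ ht)]
  refine intervalIntegral.integral_congr fun u _ => ?_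
  simp only [Pi.add_apply]
  ring

theorem segInt_smul (g : ℂ → ℂ) (σ : SmoothSimplex y 1) (s : Simplex 1 → ℂ) (r : QB a b c) :
    segInt g σ (r • s) = (r : ℂ) * segInt g σ s := by
  rw [segInt, segInt, ← intervalIntegral.integral_const_mul]
  refine intervalIntegral.integral_congr fun u _ => ?_
  simp only [Pi.smul_apply, Algebra.smul_def]
  rw [mul_assoc, mul_assoc, mul_assoc]
  rfl

theorem segInt_zero (g : ℂ → ℂ) (σ : SmoothSimplex y 1) : segInt g σ 0 = 0 := by
  simp [segInt]

/-- The integral `∫_C g dx = ∑_σ ∫_σ s_σ g dx` of a form over a twisted chain `C = ∑ σ ⊗ s_σ`. -/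
noncomputable def chainInt (g : ℂ → ℂ) (C : RawChain y 1) : ℂ := ∑ᶠ σ, segInt g σ (C σ)

theorem segInt_support_finite (g : ℂ → ℂ) {C : RawChain y 1} (hC : C ∈ finChains a b c y 1) :
    (Function.support fun σ => segInt g σ (C σ)).Finite := by
  refine hC.2.subset fun σ hσ h0 => hσ ?_
  change segInt g σ (C σ) = 0
  rw [h0, segInt_zero]

theorem chainInt_add {g : ℂ → ℂ} (hg : ContinuousOn g (puncturedPlane y)) {C D : RawChain y 1}
    (hC : C ∈ finChains a b c y 1) (hD : D ∈ finChains a b c y 1) :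
    chainInt g (C + D) = chainInt g C + chainInt g D := by
  rw [chainInt, chainInt, chainInt,
    ← finsum_add_distrib (segInt_support_finite g hC) (segInt_support_finite g hD)]
  exact finsum_congr fun σ =>
    segInt_add hg σ (section_continuous (hC.1 σ)) (section_continuous (hD.1 σ))

theorem chainInt_smul (g : ℂ → ℂ) {C : RawChain y 1} (hC : C ∈ finChains a b c y 1)
    (r : QB a b c) : chainInt g (r • C) = (r : ℂ) * chainInt g C := by
  rw [chainInt, chainInt, mul_finsum' _ _ (segInt_support_finite g hC)]
  exact finsum_congr fun σ => segInt_smul g σ (C σ) r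

/-- Stokes' formula: the integral of a holomorphic form over a twisted boundary vanishes. -/
theorem chainInt_bdry {g : ℂ → ℂ} (hg : DifferentiableOn ℂ g (puncturedPlane y))
    {C : RawChain y 2} (hC : C ∈ finChains a b c y 2) : chainInt g (bdry C) = 0 := by
  rw [chainInt, finsum_bdry hC (fun τ s => segInt g τ s)
    (fun τ s hs t ht => segInt_add hg.continuousOn τ (section_continuous hs)
      (section_continuous ht)) (fun τ s _ r => segInt_smul g τ s r)]
  refine finsum_eq_zero_of_forall_eq_zero fun σ => ?_
  obtain ⟨⟨G, hG, hσ⟩, hU⟩ := id σ.2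
  obtain ⟨F, hF⟩ := exists_isPrim hg (hC.1 σ) hG hσ
  have key : ∀ i : Fin 3, segInt g (face i σ) (C σ ∘ faceMap i)
      = F (Pi.single (i.succAbove 1) 1) - F (Pi.single (i.succAbove 0) 1) := by
    intro i
    have hv : ∀ j : Fin 2, faceLin i (Pi.single j 1) = Pi.single (i.succAbove j) 1 := fun j =>
      congrArg Subtype.val (stdSimplex.map_vertex (S := ℝ) i.succAbove j)
    rw [segInt_eq_sub hg.continuousOn (section_continuous (section_face (hC.1 σ) i))
      (hG.comp (faceLin i).contDiff) (fun p => hσ (faceMap i p)) (hF.face hG i)]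
    simp only [Function.comp_apply, hv]
  rw [Fin.sum_univ_three, key, key, key]
  have e0 : (0 : Fin 3).succAbove 0 = 1 := rfl
  have e1 : (0 : Fin 3).succAbove 1 = 2 := rfl
  have e2 : (1 : Fin 3).succAbove 0 = 0 := rfl
  have e3 : (1 : Fin 3).succAbove 1 = 2 := rfl
  have e4 : (2 : Fin 3).succAbove 0 = 0 := rfl
  have e5 : (2 : Fin 3).succAbove 1 = 1 := rfl
  rw [e0, e1, e2, e3, e4, e5]
  simp

/-- The integral of `∇ f` over a twisted cycle vanishes. -/
theorem chainInt_exact {f g : ℂ → ℂ} (hf : DifferentiableOn ℂ f (puncturedPlane y))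
    (hgf : ∀ z ∈ puncturedPlane y, g z = deriv f z + f z * logDerivBranch a b c y z)
    (hg : ContinuousOn g (puncturedPlane y))
    {C : RawChain y 1} (hC : C ∈ finChains a b c y 1) (hz : bdry C = 0) : chainInt g C = 0 := by
  let v : Simplex 0 := stdSimplex.vertex 0
  have h := finsum_bdry hC (fun τ s => s v * f (τ.1 v))
    (fun τ s _ t _ => by simp [add_mul]) (fun τ s _ r => by
      rw [← mul_assoc]; rfl)
  rw [hz] at h
  simp only [Pi.zero_apply, zero_mul, finsum_zero] at h
  rw [chainInt, h]
  refine finsum_congr fun σ => ?_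
  obtain ⟨⟨G, hG, hσ⟩, hU⟩ := id σ.2
  have hF : IsPrim g σ (C σ) G (fun q => extendZero (C σ) q * f (G q)) := by
    intro p
    have hGp : HasFDerivAt G (fderiv ℝ G p.1) p.1 :=
      ((hG.differentiable (by simp)) p.1).hasFDerivAt
    have hUp : G p.1 ∈ puncturedPlane y := by rw [← hσ]; exact hU p
    have hfG : HasFDerivAt (fun q => f (G q)) (deriv f (G p.1) • fderiv ℝ G p.1) p.1 :=
      (hf.differentiableAt ((isOpen_puncturedPlane y).mem_nhds hUp)).hasDerivAt.comp_hasFDerivAt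
        p.1 hGp
    refine ((section_hasFDerivWithinAt (hC.1 σ) hG hσ p).mul hfG.hasFDerivWithinAt).congr_fderiv ?_
    ext w
    rw [hgf _ (hU p), hσ, extendZero_apply]
    simp only [add_apply, smul_apply, smul_eq_mul]
    ring
  rw [segInt_eq_sub hg (section_continuous (hC.1 σ)) hG hσ hF, Fin.sum_univ_two]
  have hv0 : faceMap (0 : Fin 2) v = stdSimplex.vertex 1 := stdSimplex.map_vertex _ _
  have hv1 : faceMap (1 : Fin 2) v = stdSimplex.vertex 0 := stdSimplex.map_vertex _ _
  have hG0 : G (Pi.single 0 1) = σ.1 (stdSimplex.vertex 0) :=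
    (hσ (stdSimplex.vertex 0)).symm
  have hG1 : G (Pi.single 1 1) = σ.1 (stdSimplex.vertex 1) :=
    (hσ (stdSimplex.vertex 1)).symm
  have hs0 : extendZero (C σ) (Pi.single 0 1) = C σ (stdSimplex.vertex 0) :=
    extendZero_apply _ (stdSimplex.vertex 0)
  have hs1 : extendZero (C σ) (Pi.single 1 1) = C σ (stdSimplex.vertex 1) :=
    extendZero_apply _ (stdSimplex.vertex 1)
  simp only [Function.comp_apply, hv0, hv1, hG0, hG1, hs0, hs1, face]
  simp
  ring

end Comparison

/-! ### The comparison pairing -/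

section Pairing

variable {K : Type*} [Field K] [Algebra K ℂ] (y a b c : K)

/-- Integration of a form over twisted homology classes. -/
noncomputable def periodOfForm (η : Forms y) :
    H1 (algebraMap K ℂ a) (algebraMap K ℂ b) (algebraMap K ℂ c) (algebraMap K ℂ y)
      →ₗ[QB (algebraMap K ℂ a) (algebraMap K ℂ b) (algebraMap K ℂ c)] ℂ :=
  Submodule.liftQ _
    { toFun := fun C => chainInt (coeff η) C.1
      map_add' := fun C D =>
        chainInt_add (coeff_differentiableOn η).continuousOn C.2.1 D.2.1
      map_smul' := fun r C => chainInt_smul (coeff η) C.2.1 r }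
    (by
      rintro ⟨C, hC⟩ ⟨D, hD, hDC⟩
      change chainInt (coeff η) C = 0
      change bdry D = C at hDC
      rw [← hDC]
      exact chainInt_bdry (coeff_differentiableOn η) hD)

theorem chainInt_coeff_add {a b c : ℂ} (η θ : Forms y) {C : RawChain (algebraMap K ℂ y) 1}
    (hC : C ∈ finChains a b c (algebraMap K ℂ y) 1) :
    chainInt (coeff (η + θ)) C = chainInt (coeff η) C + chainInt (coeff θ) C := by
  rw [chainInt, chainInt, chainInt,
    ← finsum_add_distrib (segInt_support_finite _ hC) (segInt_support_finite _ hC)]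
  refine finsum_congr fun σ => ?_
  have hs := section_continuous (hC.1 σ)
  rw [segInt, segInt, segInt, ← intervalIntegral.integral_add
    (segInt_intervalIntegrable (coeff_differentiableOn η).continuousOn σ hs)
    (segInt_intervalIntegrable (coeff_differentiableOn θ).continuousOn σ hs)]
  refine intervalIntegral.integral_congr fun u _ => ?_
  simp only [coeff_add, Pi.add_apply]
  ring

theorem chainInt_coeff_smul {a b c : ℂ} (r : K) (η : Forms y) {C : RawChain (algebraMap K ℂ y) 1}
    (hC : C ∈ finChains a b c (algebraMap K ℂ y) 1) :
    chainInt (coeff (r • η)) C = algebraMap K ℂ r * chainInt (coeff η) C := by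
  rw [chainInt, chainInt, mul_finsum' _ _ (segInt_support_finite _ hC)]
  refine finsum_congr fun σ => ?_
  rw [segInt, segInt, ← intervalIntegral.integral_const_mul]
  refine intervalIntegral.integral_congr fun u _ => ?_
  simp only [coeff_smul]
  ring

/-- The comparison between de Rham and Betti cohomology: the class of a form `η` is sent to the
functional `[∑ σ ⊗ s_σ] ↦ ∑ ∫_σ s_σ η` on `H₁(ℂ ∖ {0, 1, y⁻¹}, 𝓛^∨)`. -/
noncomputable def comparison : TwistedDR y a b c →ₗ[K]
    (H1 (algebraMap K ℂ a) (algebraMap K ℂ b) (algebraMap K ℂ c) (algebraMap K ℂ y)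
      →ₗ[QB (algebraMap K ℂ a) (algebraMap K ℂ b) (algebraMap K ℂ c)] ℂ) :=
  Submodule.liftQ _
    { toFun := periodOfForm y a b c
      map_add' := fun η θ => by
        refine Submodule.linearMap_qext _ (LinearMap.ext fun C => ?_)
        exact chainInt_coeff_add y η θ C.2.1
      map_smul' := fun r η => by
        refine Submodule.linearMap_qext _ (LinearMap.ext fun C => ?_)
        exact (chainInt_coeff_smul y r η C.2.1).trans (Algebra.smul_def r _).symm }
    (by
      rintro _ ⟨f, rfl⟩
      refine Submodule.linearMap_qext _ (LinearMap.ext fun C => ?_)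
      exact chainInt_exact (fval_differentiableOn f) (fun z hz => coeff_nabla a b c f hz)
        (coeff_differentiableOn _).continuousOn C.2.1 C.2.2)

end Pairing

end TwistedPeriods

namespace TwistedPeriods

/-! ### The object `M_{a,b,c}(y)`: coefficient fields, realizations, comparison -/

/-- Genericity: none of `a, b, c, c - a, c - b` is an integer. -/
def Generic (a b c : ℂ) : Prop :=
  ∀ n : ℤ, a ≠ n ∧ b ≠ n ∧ c ≠ n ∧ c - a ≠ n ∧ c - b ≠ n

section Realizations

variable (k : Subfield ℂ) (y : k) (a b c : ℂ)

/-- The de Rham coefficient field `k(a, b, c)`. -/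
noncomputable abbrev kDR : IntermediateField k ℂ := IntermediateField.adjoin k {a, b, c}

/-- `a` as an element of `k(a, b, c)`. -/
noncomputable def aDR : kDR k a b c := ⟨a, IntermediateField.subset_adjoin _ _ (by simp)⟩

/-- `b` as an element of `k(a, b, c)`. -/
noncomputable def bDR : kDR k a b c := ⟨b, IntermediateField.subset_adjoin _ _ (by simp)⟩

/-- `c` as an element of `k(a, b, c)`. -/
noncomputable def cDR : kDR k a b c := ⟨c, IntermediateField.subset_adjoin _ _ (by simp)⟩

/-- `y` as an element of `k(a, b, c)`. -/
noncomputable def yDR : kDR k a b c := algebraMap k (kDR k a b c) y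

/-- The de Rham realization `M_{a,b,c}(y)_dR`, a vector space over `k(a, b, c)`. -/
abbrev MdR : Type :=
  TwistedDR (yDR k y a b c) (aDR k a b c) (bDR k a b c) (cDR k a b c)

/-- The dual `M_{a,b,c}(y)_B^∨ = H₁(ℂ ∖ {0, 1, y⁻¹}, 𝓛^∨)` of the Betti realization, a vector
space over `ℚ(e^{2πia}, e^{2πib}, e^{2πic})`. -/
abbrev MBdual (a b c y : ℂ) : Type := H1 a b c y

/-- The comparison `M_dR → M_B ⊗ ℂ = Hom(M_B^∨, ℂ)`. -/
noncomputable def comp : MdR k y a b c →ₗ[kDR k a b c]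
    (MBdual a b c (y : ℂ) →ₗ[QB a b c] ℂ) :=
  comparison (yDR k y a b c) (aDR k a b c) (bDR k a b c) (cDR k a b c)

/-- The de Rham classes `η₁ = [dx / (x (1 - x))]` and `η₂ = [dx / (1 - y x)]`. -/
noncomputable def eta : Fin 2 → MdR k y a b c :=
  etaClass (yDR k y a b c) (aDR k a b c) (bDR k a b c) (cDR k a b c)

/-- The matrix of the comparison with respect to the families `(η₁, η₂)` and `(φ₁, φ₂)`. -/
noncomputable def periodMatrix (φ : Fin 2 → MBdual a b c (y : ℂ)) : Matrix (Fin 2) (Fin 2) ℂ :=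
  Matrix.of fun i j => comp k y a b c (eta k y a b c j) (φ i)

end Realizations

/-! ### The two locally finite paths with their branches -/

/-- The path `p₁(t) = t` from `0` to `1`. -/
noncomputable def path1 (t : ℝ) : ℂ := t

/-- The path `p₂(t) = 1 / (y t)` from `∞` to `y⁻¹`. -/
noncomputable def path2 (y : ℂ) (t : ℝ) : ℂ := 1 / (y * t)

/-- The canonical branch of `x^b (1 - x)^(c - b) (1 - y x)^(-a)` along `x = p₁(t)`, `0 < t < 1`. -/
noncomputable def branch1 (a b c y : ℂ) (t : ℝ) : ℂ :=
  Complex.exp (b * Complex.log t + (c - b) * Complex.log (1 - t) - a * Complex.log (1 - y * t))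

/-- The branch of `x^b (1 - x)^(c - b) (1 - y x)^(-a)` along `x = p₂(t)`, `0 < t < 1`, given by
determinations `ly` of `log y` and `lm` of `log (-1)` through
`log x = -log y - log t`, `log (1 - x) = log (-1) + log (1 - y t) - log y - log t` and
`log (1 - y x) = log (-1) + log (1 - t) - log t`. -/
noncomputable def branch2 (ly lm a b c y : ℂ) (t : ℝ) : ℂ :=
  Complex.exp (b * (-ly - Complex.log t)
    + (c - b) * (lm + Complex.log (1 - y * t) - ly - Complex.log t)
    - a * (lm + Complex.log (1 - t) - Complex.log t))

/-- The locally finite twisted chain of a path `γ : (0, 1) → ℂ` with a function `s` along it: the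
interval `(0, 1)` is subdivided into the images of `[n, n + 1]`, `n ∈ ℤ`, under the sigmoid
function `ℝ → (0, 1)`. -/
noncomputable def pathChain (y : ℂ) (γ s : ℝ → ℂ) : RawChain y 1 := fun σ p =>
  open Classical in
  ∑ᶠ n : ℤ, if ∀ q, σ.1 q = γ (Real.sigmoid (n + q.1 1)) then s (Real.sigmoid (n + p.1 1)) else 0

/-- The path `γ` with the branch `s` is a locally finite cycle, whose class corresponds to `φ` under
the natural map from ordinary to locally finite homology. -/
def CorrespondsTo {a b c y : ℂ} (φ : MBdual a b c y) (γ s : ℝ → ℂ) : Prop :=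
  ∃ h : pathChain y γ s ∈ Z1lf a b c y, toLf a b c y φ = Submodule.Quotient.mk ⟨_, h⟩

/-- `φ₁`, `φ₂` are the Betti homology classes attached to `p₁`, `p₂` with their branches. -/
def IsBettiPair (ly lm : ℂ) {a b c y : ℂ} (φ : Fin 2 → MBdual a b c y) : Prop :=
  CorrespondsTo (φ 0) path1 (branch1 a b c y) ∧
    CorrespondsTo (φ 1) (path2 y) (branch2 ly lm a b c y)

/-! ### The functions `𝓕` and `𝓖` -/

/-- `F` is holomorphic on `D` and extends the restriction of `f` to `R`. -/
def IsContinuation (D R : Set (ℂ × ℂ × ℂ)) (f F : ℂ × ℂ × ℂ → ℂ) : Prop :=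
  DifferentiableOn ℂ F D ∧ Set.EqOn F f R

/-- The domain `b, c - b ∉ ℤ_{≤ 0}` of triples `(a, b, c)`. -/
def domF : Set (ℂ × ℂ × ℂ) := {p | ∀ n : ℕ, p.2.1 ≠ -(n : ℂ) ∧ p.2.2 - p.2.1 ≠ -(n : ℂ)}

/-- The region `Re c > Re b > 0` of triples `(a, b, c)`. -/
def regF : Set (ℂ × ℂ × ℂ) := {p | 0 < p.2.1.re ∧ p.2.1.re < p.2.2.re}

/-- The integral `∫₀¹ x^b (1 - x)^(c - b) (1 - y x)^(-a) dx / (x (1 - x))`. -/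
noncomputable def integralF (y : ℂ) (p : ℂ × ℂ × ℂ) : ℂ :=
  ∫ t in (0 : ℝ)..1, branch1 p.1 p.2.1 p.2.2 y t * (1 / (path1 t * (1 - path1 t)))

/-- The analytic continuation `𝓕(a, b, c; y)` of the integral to `b, c - b ∉ ℤ_{≤ 0}`. -/
noncomputable def calF (a b c y : ℂ) : ℂ :=
  Classical.epsilon (IsContinuation domF regF (integralF y)) (a, b, c)

/-- The domain `a, c - a ∉ ℤ_{≥ 1}` of triples `(a, b, c)`. -/
def domG : Set (ℂ × ℂ × ℂ) := {p | ∀ n : ℕ, p.1 ≠ (n : ℂ) + 1 ∧ p.2.2 - p.1 ≠ (n : ℂ) + 1}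

/-- The region `Re c < Re a + 1 < 2` of triples `(a, b, c)`. -/
def regG : Set (ℂ × ℂ × ℂ) := {p | p.2.2.re < p.1.re + 1 ∧ p.1.re + 1 < 2}

/-- The integral `∫_∞^{1/y} x^b (1 - x)^(c - b) (1 - y x)^(-a) dx / (x (1 - x))` along
`x = p₂(t) = 1 / (y t)`, `dx = -dt / (y t²)`. -/
noncomputable def integralG (ly lm y : ℂ) (p : ℂ × ℂ × ℂ) : ℂ :=
  ∫ t in (0 : ℝ)..1, branch2 ly lm p.1 p.2.1 p.2.2 y t * (1 / (path2 y t * (1 - path2 y t)))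
    * (-(1 / (y * (t : ℂ) ^ 2)))

/-- The analytic continuation `𝓖(a, b, c; y)` of the integral to `a, c - a ∉ ℤ_{≥ 1}`. -/
noncomputable def calG (ly lm a b c y : ℂ) : ℂ :=
  Classical.epsilon (IsContinuation domG regG (integralG ly lm y)) (a, b, c)

end TwistedPeriods

open TwistedPeriods

namespace TwistedPeriods

/-! ### The integral `𝓕` on its domain of convergence -/

section ConvergenceF

/-! The integral of `g dx` along a locally finite path diverges for most parameters, and integrals
over locally finite boundaries need not vanish, so the periods of `φ₁`, `φ₂` cannot be read off from
`p₁`, `p₂` directly. They are determined where the path integrals converge, and contiguity relations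
carry the result to all generic parameters.

Convergent range. Genericity makes the monodromy of the branches around `0`, `1`, `y⁻¹` and `∞`
nontrivial, so `∇ m = g dx` has a single-valued solution near each puncture, namely an average over
circles (`exists_local_solution`, `exists_solution_outside_compact`). Correcting each `∫_σ s g dx`
by the boundary values of `s m` gives a functional that vanishes on simplices away from a compact
set. Hence Stokes holds for locally finite chains, and the period of a finite cycle is a finite sum
of corrected integrals over the path (`chainInt_eq_finsum_correctedInt`). This sum telescopes, and
in the convergent range `s m` tends to zero at both ends, which leaves the integral along the path
(`PathChart.chainInt_eq_integral`, `CircleBound.tendsto_zero`).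

All generic parameters. Multiplication by `x^i (1 - x)^j (1 - y x)^k` shifts `(a, b, c)` by
integers, so one fixed cycle has a family of periods indexed by `ℤ³`. Exact forms give contiguity
relations among them (`chainInt_monoForm`). The continued function `𝓕` obeys the same relations
(`calF_contiguous`), and these determine a family from its members with large exponents, where both
families are the same convergent integral (`eq_calF_of_contiguous`). Both `η₁` and `η₂` are monomial
forms, which explains the shift by `(1, 1, 2)` between the columns.

Second path. The substitution `x = 1 / (y t)` turns `𝓖` into an explicit constant times `𝓕` at `(1 +
b - c, 1 + a - c, 2 - c)` (`integralG_eq`, `calG_eq`).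

The continuation of `𝓕` itself is built by solving the contiguity relations step by step, and it is
unique by the identity theorem along complex lines (`eqOn_of_eqOn_of_lines`). The classes `φ₁`, `φ₂`
exist because each tail of a path is, modulo locally finite boundaries, a loop around the puncture
divided by the monodromy minus one (`PathChart.exists_correspondsTo`). -/

theorem one_sub_mul_mem_slitPlane {y : ℂ} (hy1 : y ≠ 1) (hy : ∀ r : ℝ, 1 < r → y ≠ r)
    {t : ℝ} (ht : t ∈ Set.Icc (0 : ℝ) 1) : 1 - y * t ∈ Complex.slitPlane := by
  rw [Complex.mem_slitPlane_iff]
  by_contra! h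
  obtain ⟨h1, h2⟩ := h
  simp at h1 h2
  have ht0 : t ≠ 0 := by rintro rfl; norm_num at h1
  have hpos : 0 < t := lt_of_le_of_ne ht.1 (Ne.symm ht0)
  have him : y.im = 0 := h2.resolve_right ht0
  -- A nonpositive real value `1 - y t` with `0 < t ≤ 1` forces `y` to be real with `y ≥ 1 / t ≥ 1`.
  -- This is the only use of `y ∉ (1, +∞)`; afterwards only the statement that `1 - y t` avoids the
  -- cut of the logarithm on the closed interval is needed.
  have hre : 1 ≤ y.re := by nlinarith [ht.2]
  have hyre : y = (y.re : ℂ) := by apply Complex.ext <;> simp [him]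
  rcases hre.lt_or_eq with h | h
  · exact hy _ h hyre
  · rw [← h] at hyre; exact hy1 (by simpa using hyre)

/-- The integrand of `integralF`. -/
noncomputable def integrandF (y : ℂ) (p : ℂ × ℂ × ℂ) (t : ℝ) : ℂ :=
  branch1 p.1 p.2.1 p.2.2 y t * (1 / (path1 t * (1 - path1 t)))

theorem log_one_sub_mul_continuousOn {y : ℂ}
    (hS : ∀ t ∈ Set.Icc (0 : ℝ) 1, 1 - y * t ∈ Complex.slitPlane) :
    ContinuousOn (fun t : ℝ => Complex.log (1 - y * t)) (Set.Icc 0 1) := by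
  intro t ht
  refine ContinuousWithinAt.clog ?_ (hS t ht)
  fun_prop

theorem log_ofReal_continuousOn : ContinuousOn (fun t : ℝ => Complex.log t) (Set.Ioo 0 1) := by
  intro t ht
  refine ContinuousWithinAt.clog (by fun_prop) (Complex.ofReal_mem_slitPlane.2 ht.1)

theorem log_one_sub_continuousOn :
    ContinuousOn (fun t : ℝ => Complex.log (1 - t)) (Set.Ioo 0 1) := by
  intro t ht
  refine ContinuousWithinAt.clog (by fun_prop) ?_
  rw [← Complex.ofReal_one, ← Complex.ofReal_sub]
  exact Complex.ofReal_mem_slitPlane.2 (by linarith [ht.2])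

theorem integrandF_continuousOn {y : ℂ}
    (hS : ∀ t ∈ Set.Icc (0 : ℝ) 1, 1 - y * t ∈ Complex.slitPlane) (p : ℂ × ℂ × ℂ) :
    ContinuousOn (integrandF y p) (Set.Ioo 0 1) := by
  unfold integrandF branch1 path1
  have h2 := (log_one_sub_mul_continuousOn hS).mono Set.Ioo_subset_Icc_self
  have h0 := log_ofReal_continuousOn
  have h1 := log_one_sub_continuousOn
  refine ContinuousOn.mul (by fun_prop) (ContinuousOn.div (by fun_prop) (by fun_prop) ?_)
  intro t ht
  refine mul_ne_zero (by exact_mod_cast ht.1.ne') ?_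
  rw [← Complex.ofReal_one, ← Complex.ofReal_sub]
  exact_mod_cast (by linarith [ht.2] : (0:ℝ) < 1 - t).ne'

theorem aestronglyMeasurable_of_continuousOn_Ioo {E : Type*} [NormedAddCommGroup E]
    [NormedSpace ℝ E] {f : ℝ → E} (hf : ContinuousOn f (Set.Ioo 0 1)) :
    MeasureTheory.AEStronglyMeasurable f (MeasureTheory.volume.restrict (Set.uIoc 0 1)) := by
  rw [Set.uIoc_of_le zero_le_one,
    ← MeasureTheory.Measure.restrict_congr_set MeasureTheory.Ioo_ae_eq_Ioc]
  exact hf.aestronglyMeasurable measurableSet_Ioo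

/-- `log t` and `log (1 - t)` are real and nonpositive, so only the real parts of `b` and `c - b`
matter and lowering them to `δ` increases the bound. The third factor is bounded because its
logarithm is. The bound is uniform in the parameters, as needed for domination. -/
theorem norm_integrandF_le {y : ℂ} {M : ℝ}
    (hM : ∀ t ∈ Set.Icc (0 : ℝ) 1, ‖Complex.log (1 - y * t)‖ ≤ M) {p : ℂ × ℂ × ℂ} {δ A : ℝ}
    (h1 : δ ≤ p.2.1.re) (h2 : δ ≤ (p.2.2 - p.2.1).re) (hA : ‖p.1‖ ≤ A) {t : ℝ}
    (ht : t ∈ Set.Ioo (0 : ℝ) 1) :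
    ‖integrandF y p t‖ ≤ Real.exp (A * M) * (t ^ (δ - 1) * (1 - t) ^ (δ - 1)) := by
  have ht1 : 0 < 1 - t := by linarith [ht.2]
  have hc : (1 : ℂ) - t = ((1 - t : ℝ) : ℂ) := by push_cast; rfl
  have hMt := hM t (Set.Ioo_subset_Icc_self ht)
  have hM0 : 0 ≤ M := (norm_nonneg _).trans hMt
  have hA0 : 0 ≤ A := (norm_nonneg _).trans hA
  rw [integrandF, branch1, path1, hc, norm_mul, Complex.norm_exp, ← Complex.ofReal_log ht.1.le,
    ← Complex.ofReal_log ht1.le, ← Complex.ofReal_mul, norm_div, norm_one, Complex.norm_real,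
    Real.norm_of_nonneg (by have := ht.1; positivity), Real.rpow_sub_one ht.1.ne', Real.rpow_sub_one ht1.ne',
    Real.rpow_def_of_pos ht.1, Real.rpow_def_of_pos ht1]
  have e : Real.exp (A * M) * (Real.exp (Real.log t * δ) / t * (Real.exp (Real.log (1 - t) * δ) / (1 - t)))
      = Real.exp (Real.log t * δ + Real.log (1 - t) * δ + A * M) * (1 / (t * (1 - t))) := by
    rw [Real.exp_add, Real.exp_add]; field_simp
  rw [e]
  have h0 := ht.1
  refine mul_le_mul_of_nonneg_right (Real.exp_le_exp.mpr ?_) (by positivity)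
  have l0 : Real.log t ≤ 0 := Real.log_nonpos ht.1.le ht.2.le
  have l1 : Real.log (1 - t) ≤ 0 := Real.log_nonpos ht1.le (by linarith)
  have e0 : (p.2.1 * (Real.log t : ℂ)).re = p.2.1.re * Real.log t := Complex.re_mul_ofReal _ _
  have e1 : ((p.2.2 - p.2.1) * (Real.log (1 - t) : ℂ)).re
      = (p.2.2 - p.2.1).re * Real.log (1 - t) := Complex.re_mul_ofReal _ _
  have e2 : -(p.1 * Complex.log (1 - y * t)).re ≤ A * M := by
    have := Complex.abs_re_le_norm (p.1 * Complex.log (1 - y * t))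
    rw [norm_mul] at this
    have h3 : ‖p.1‖ * ‖Complex.log (1 - y * t)‖ ≤ A * M := by gcongr
    linarith [neg_abs_le (p.1 * Complex.log (1 - y * t)).re]
  rw [Complex.sub_re, Complex.add_re, e0, e1]
  nlinarith

/-- This is the convergence of the Beta integral `B(δ, δ)`. -/
theorem rpow_mul_rpow_intervalIntegrable {δ : ℝ} (hδ : 0 < δ) :
    IntervalIntegrable (fun t : ℝ => t ^ (δ - 1) * (1 - t) ^ (δ - 1)) MeasureTheory.volume 0 1 := by
  have h := (Complex.betaIntegral_convergent (u := δ) (v := δ) (by simpa) (by simpa)).norm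
  refine h.congr_uIoo ?_
  rw [Set.uIoo_of_le zero_le_one]
  intro t ht
  have ht1 : 0 < 1 - t := by linarith [ht.2]
  have hc : (1 : ℂ) - t = ((1 - t : ℝ) : ℂ) := by push_cast; rfl
  simp only [norm_mul, hc]
  rw [Complex.norm_cpow_eq_rpow_re_of_pos ht.1, Complex.norm_cpow_eq_rpow_re_of_pos ht1]
  simp

theorem exists_log_bound {y : ℂ}
    (hS : ∀ t ∈ Set.Icc (0 : ℝ) 1, 1 - y * t ∈ Complex.slitPlane) :
    ∃ M : ℝ, 0 ≤ M ∧ ∀ t ∈ Set.Icc (0 : ℝ) 1, ‖Complex.log (1 - y * t)‖ ≤ M := by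
  obtain ⟨M, hM⟩ := isCompact_Icc.exists_bound_of_continuousOn (log_one_sub_mul_continuousOn hS)
  exact ⟨M, (norm_nonneg _).trans (hM 0 (by simp)), hM⟩

theorem integrandF_intervalIntegrable {y : ℂ}
    (hS : ∀ t ∈ Set.Icc (0 : ℝ) 1, 1 - y * t ∈ Complex.slitPlane) {p : ℂ × ℂ × ℂ} (hp : p ∈ regF) :
    IntervalIntegrable (integrandF y p) MeasureTheory.volume 0 1 := by
  obtain ⟨M, -, hM⟩ := exists_log_bound hS
  set δ := min p.2.1.re (p.2.2 - p.2.1).re with hδ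
  have hδ0 : 0 < δ := lt_min hp.1 (by rw [Complex.sub_re]; linarith [hp.2])
  refine ((rpow_mul_rpow_intervalIntegrable hδ0).const_mul (Real.exp (‖p.1‖ * M))).mono_fun
    (aestronglyMeasurable_of_continuousOn_Ioo (integrandF_continuousOn hS p)) ?_
  rw [Set.uIoc_of_le zero_le_one,
    ← MeasureTheory.Measure.restrict_congr_set MeasureTheory.Ioo_ae_eq_Ioc]
  filter_upwards [MeasureTheory.ae_restrict_mem measurableSet_Ioo] with t ht
  exact (norm_integrandF_le hM (min_le_left _ _) (min_le_right _ _) le_rfl ht).trans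
    (le_abs_self _)

/-- Differentiation in the parameters produces a factor `log t`; half of the exponent `δ` pays for
it. -/
theorem rpow_half_mul_abs_log_le {δ t : ℝ} (hδ : 0 < δ) (h0 : 0 < t) (h1 : t ≤ 1) :
    t ^ (δ - 1) * |Real.log t| ≤ 2 / δ * t ^ (δ / 2 - 1) := by
  have h := (Real.abs_log_mul_self_rpow_lt t (δ / 2) h0 h1 (by positivity)).le
  rw [abs_mul, abs_of_nonneg (Real.rpow_nonneg h0.le _)] at h
  have e : t ^ (δ - 1) = t ^ (δ / 2) * t ^ (δ / 2 - 1) := by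
    rw [← Real.rpow_add h0]; ring_nf
  rw [e]
  calc _ = |Real.log t| * t ^ (δ / 2) * t ^ (δ / 2 - 1) := by ring
    _ ≤ 1 / (δ / 2) * t ^ (δ / 2 - 1) := by gcongr
    _ = _ := by rw [one_div_div]

theorem isOpen_regF : IsOpen regF := by
  simp only [regF, Set.ofPred_and]
  refine IsOpen.inter (isOpen_lt continuous_const ?_) (isOpen_lt ?_ ?_)
  all_goals fun_prop

theorem integralF_differentiableOn {y : ℂ}
    (hS : ∀ t ∈ Set.Icc (0 : ℝ) 1, 1 - y * t ∈ Complex.slitPlane) :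
    DifferentiableOn ℂ (integralF y) regF := by
  intro p hp
  obtain ⟨M, hM0, hM⟩ := exists_log_bound hS
  -- With `δ` half the distance to the boundary of the region, the estimates hold with the same `A`
  -- and `δ` on the whole neighbourhood `s` of `p`.
  let A : ℝ := ‖p.1‖ + 1
  let δ : ℝ := min p.2.1.re (p.2.2 - p.2.1).re / 2
  have hm : 0 < min p.2.1.re (p.2.2 - p.2.1).re :=
    lt_min hp.1 (by rw [Complex.sub_re]; linarith [hp.2])
  have hδ0 : 0 < δ := half_pos hm
  let s : Set (ℂ × ℂ × ℂ) := {q | δ < q.2.1.re ∧ δ < (q.2.2 - q.2.1).re ∧ ‖q.1‖ < A}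
  have hs : s ∈ nhds p := by
    refine IsOpen.mem_nhds ?_ ?_
    · simp only [s, Set.ofPred_and]
      refine IsOpen.inter (isOpen_lt continuous_const ?_)
        (IsOpen.inter (isOpen_lt continuous_const ?_) (isOpen_lt ?_ continuous_const))
      all_goals fun_prop
    · exact ⟨(half_lt_self hm).trans_le (min_le_left _ _),
        (half_lt_self hm).trans_le (min_le_right _ _), by simp [A]⟩
  let π0 : ℂ × ℂ × ℂ →L[ℂ] ℂ := ContinuousLinearMap.fst ℂ ℂ (ℂ × ℂ)
  let π1 : ℂ × ℂ × ℂ →L[ℂ] ℂ := (ContinuousLinearMap.fst ℂ ℂ ℂ).comp (ContinuousLinearMap.snd ℂ ℂ (ℂ × ℂ))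
  let π2 : ℂ × ℂ × ℂ →L[ℂ] ℂ := (ContinuousLinearMap.snd ℂ ℂ ℂ).comp (ContinuousLinearMap.snd ℂ ℂ (ℂ × ℂ))
  let ℓ : ℝ → (ℂ × ℂ × ℂ →L[ℂ] ℂ) := fun t =>
    Complex.log t • π1 + Complex.log (1 - t) • (π2 - π1) - Complex.log (1 - y * t) • π0
  have hπ0 : ‖π0‖ ≤ 1 := ContinuousLinearMap.norm_fst_le _ _ _
  have hsnd : ‖ContinuousLinearMap.snd ℂ ℂ (ℂ × ℂ)‖ ≤ 1 := ContinuousLinearMap.norm_snd_le _ _ _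
  have hπ1 : ‖π1‖ ≤ 1 := (ContinuousLinearMap.opNorm_comp_le _ _).trans
    (mul_le_one₀ (ContinuousLinearMap.norm_fst_le _ _ _) (norm_nonneg _) hsnd)
  have hπ2 : ‖π2‖ ≤ 1 := (ContinuousLinearMap.opNorm_comp_le _ _).trans
    (mul_le_one₀ (ContinuousLinearMap.norm_snd_le _ _ _) (norm_nonneg _) hsnd)
  -- The three summands of the constant bound the three terms of `ℓ t`: `log t`, then `log (1 - t)`
  -- with `‖π2 - π1‖ ≤ 2`, then `log (1 - y t)`.
  let bound : ℝ → ℝ := fun t => Real.exp (A * M) * (2 / δ + 2 * (2 / δ) + M) *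
    (t ^ (δ / 2 - 1) * (1 - t) ^ (δ / 2 - 1))
  have hder : ∀ t q, HasFDerivAt (fun q => integrandF y q t) (integrandF y q t • ℓ t) q := by
    intro t q
    have h1 : HasFDerivAt (fun q : ℂ × ℂ × ℂ => q.2.1 * Complex.log t
        + (q.2.2 - q.2.1) * Complex.log (1 - t) - q.1 * Complex.log (1 - y * t)) (ℓ t) q := by
      refine (ℓ t).hasFDerivAt.congr_of_eventuallyEq (Filter.Eventually.of_forall fun r => ?_)
      simp [ℓ, π0, π1, π2]; ring
    refine (h1.cexp.mul_const _).congr_fderiv ?_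
    ext <;> simp [integrandF, branch1] <;> ring
  have key := intervalIntegral.hasFDerivAt_integral_of_dominated_of_fderiv_le
    (F := fun q t => integrandF y q t) (F' := fun q t => integrandF y q t • ℓ t)
    (bound := bound) (μ := MeasureTheory.volume) (a := 0) (b := 1) hs
    (Filter.Eventually.of_forall fun q =>
      aestronglyMeasurable_of_continuousOn_Ioo (integrandF_continuousOn hS q))
    (integrandF_intervalIntegrable hS hp)
    (aestronglyMeasurable_of_continuousOn_Ioo ?_) ?_
    ((rpow_mul_rpow_intervalIntegrable (half_pos hδ0)).const_mul _)
    (Filter.Eventually.of_forall fun t _ q _ => hder t q)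
  · exact key.differentiableAt.differentiableWithinAt
  · have h2 := (log_one_sub_mul_continuousOn hS).mono Set.Ioo_subset_Icc_self
    have h0 := log_ofReal_continuousOn
    have h1 := log_one_sub_continuousOn
    have h3 := integrandF_continuousOn hS p
    simp only [ℓ]
    fun_prop
  · refine Filter.Eventually.of_forall fun t ht q hq => ?_
    rw [Set.uIoc_of_le zero_le_one] at ht
    rcases ht.2.lt_or_eq with ht1 | ht1
    swap
    -- The half-open interval contains `t = 1`, where division by zero gives the integrand the value
    -- `0`.
    · have : integrandF y q t = 0 := by subst ht1; simp [integrandF, path1]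
      have hb : 0 ≤ bound t := by
        have := ht.1
        have : 0 ≤ 1 - t := by linarith
        positivity
      rw [norm_smul, this, norm_zero, zero_mul]
      exact hb
    have hlt : 0 < 1 - t := by linarith
    have hc : (1 : ℂ) - t = ((1 - t : ℝ) : ℂ) := by push_cast; rfl
    have hF := norm_integrandF_le hM hq.1.le hq.2.1.le hq.2.2.le ⟨ht.1, ht1⟩
    have hℓ : ‖ℓ t‖ ≤ |Real.log t| + 2 * |Real.log (1 - t)| + M := by
      refine (norm_sub_le _ _).trans (add_le_add ((norm_add_le _ _).trans (add_le_add ?_ ?_)) ?_)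
      · rw [norm_smul, ← Complex.ofReal_log ht.1.le, Complex.norm_real, Real.norm_eq_abs]
        exact mul_le_of_le_one_right (abs_nonneg _) hπ1
      · rw [norm_smul, hc, ← Complex.ofReal_log hlt.le, Complex.norm_real, Real.norm_eq_abs, mul_comm]
        gcongr
        exact (norm_sub_le _ _).trans (by linarith)
      · rw [norm_smul]
        exact (mul_le_of_le_one_right (norm_nonneg _) hπ0).trans (hM t ⟨ht.1.le, ht1.le⟩)
    rw [norm_smul]
    refine (mul_le_mul hF hℓ (norm_nonneg _) (by have := ht.1; positivity)).trans ?_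
    have i0 := rpow_half_mul_abs_log_le hδ0 ht.1 ht1.le
    have i1 := rpow_half_mul_abs_log_le hδ0 hlt (by linarith [ht.1])
    have j0 : t ^ (δ - 1) ≤ t ^ (δ / 2 - 1) :=
      Real.rpow_le_rpow_of_exponent_ge ht.1 ht1.le (by linarith)
    have j1 : (1 - t) ^ (δ - 1) ≤ (1 - t) ^ (δ / 2 - 1) :=
      Real.rpow_le_rpow_of_exponent_ge hlt (by linarith [ht.1]) (by linarith)
    have k0 := Real.rpow_nonneg ht.1.le (δ - 1)
    have k1 := Real.rpow_nonneg hlt.le (δ - 1)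
    have k2 := Real.rpow_nonneg ht.1.le (δ / 2 - 1)
    simp only [bound]
    set u := t ^ (δ - 1)
    set v := (1 - t) ^ (δ - 1)
    set u' := t ^ (δ / 2 - 1)
    set v' := (1 - t) ^ (δ / 2 - 1)
    have n0 : (u * |Real.log t|) * v ≤ 2 / δ * u' * v' :=
      mul_le_mul i0 j1 k1 (by positivity)
    have n1 : u * (v * |Real.log (1 - t)|) ≤ u' * (2 / δ * v') :=
      mul_le_mul j0 i1 (by positivity) k2
    have n2 : u * v ≤ u' * v' := mul_le_mul j0 j1 k1 k2
    have n3 := mul_le_mul_of_nonneg_right n2 hM0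
    rw [mul_assoc, mul_assoc, mul_assoc]
    refine mul_le_mul_of_nonneg_left ?_ (Real.exp_pos _).le
    linarith

end ConvergenceF

/-! ### Contiguity relations and analytic continuation of `𝓕` -/

section ContinuationF

theorem integrandF_eq {y : ℂ} (a b d : ℂ) {t : ℝ} (ht : t ∈ Set.Ioo (0 : ℝ) 1) (i j k : ℕ)
    (hy : 1 - y * t ≠ 0) :
    integrandF y (a + k, b + i, b + i + (d + j)) t
      = t ^ i * (1 - t) ^ j / (1 - y * t) ^ k * integrandF y (a, b, b + d) t := by
  have h0 : (t : ℂ) ≠ 0 := by exact_mod_cast ht.1.ne'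
  have h1 : (1 : ℂ) - t ≠ 0 := by
    rw [← Complex.ofReal_one, ← Complex.ofReal_sub]
    exact_mod_cast (by linarith [ht.2] : (0:ℝ) < 1 - t).ne'
  have e0 : (t : ℂ) ^ i = Complex.exp (i * Complex.log t) := by
    rw [Complex.exp_nat_mul, Complex.exp_log h0]
  have e1 : (1 - t : ℂ) ^ j = Complex.exp (j * Complex.log (1 - t)) := by
    rw [Complex.exp_nat_mul, Complex.exp_log h1]
  have e2 : (1 - y * t : ℂ) ^ k = Complex.exp (k * Complex.log (1 - y * t)) := by
    rw [Complex.exp_nat_mul, Complex.exp_log hy]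
  rw [e0, e1, e2, integrandF, integrandF, branch1, branch1, ← Complex.exp_add, ← Complex.exp_sub,
    ← mul_assoc, ← Complex.exp_add]
  congr 2
  ring

/-- The factor `t ^ b` tends to zero and the remaining factors are continuous at `t = 0`. Together
with the analogue at `t = 1`, this removes the boundary terms in the integration by parts. -/
theorem branch1_tendsto_zero (y a : ℂ) {b d : ℂ}
    (hb : 0 < b.re) :
    Filter.Tendsto (branch1 a b (b + d) y) (nhdsWithin 0 (Set.Ioi 0)) (nhds 0) := by
  have h0 : Filter.Tendsto (fun t : ℝ => Complex.exp (b * Complex.log t))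
      (nhdsWithin 0 (Set.Ioi 0)) (nhds 0) := by
    rw [tendsto_zero_iff_norm_tendsto_zero]
    have h : Filter.Tendsto (fun t : ℝ => Real.exp (b.re * Real.log t))
        (nhdsWithin 0 (Set.Ioi 0)) (nhds 0) :=
      Real.tendsto_exp_atBot.comp (Real.tendsto_log_nhdsGT_zero.const_mul_atBot hb)
    refine h.congr' ?_
    filter_upwards [self_mem_nhdsWithin] with t ht
    rw [Complex.norm_exp, ← Complex.ofReal_log (le_of_lt ht), Complex.re_mul_ofReal]
  have h1 : Filter.Tendsto (fun t : ℝ =>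
      Complex.exp (d * Complex.log (1 - t) - a * Complex.log (1 - y * t)))
      (nhdsWithin 0 (Set.Ioi 0)) (nhds (Complex.exp (d * Complex.log (1 - (0 : ℝ))
        - a * Complex.log (1 - y * (0 : ℝ))))) := by
    refine tendsto_nhdsWithin_of_tendsto_nhds (ContinuousAt.tendsto ?_)
    have c1 : ContinuousAt (fun t : ℝ => Complex.log (1 - t)) 0 :=
      ContinuousAt.clog (by fun_prop) (by simp)
    have c2 : ContinuousAt (fun t : ℝ => Complex.log (1 - y * t)) 0 :=
      ContinuousAt.clog (by fun_prop) (by simp)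
    fun_prop
  have := h0.mul h1
  rw [zero_mul] at this
  refine this.congr fun t => ?_
  rw [branch1, ← Complex.exp_add]
  congr 1; ring

theorem branch1_tendsto_one {y : ℂ}
    (hS : ∀ t ∈ Set.Icc (0 : ℝ) 1, 1 - y * t ∈ Complex.slitPlane) (a : ℂ) {b d : ℂ}
    (hd : 0 < d.re) :
    Filter.Tendsto (branch1 a b (b + d) y) (nhdsWithin 1 (Set.Iio 1)) (nhds 0) := by
  have h0 : Filter.Tendsto (fun t : ℝ => Complex.exp (d * Complex.log (1 - t)))
      (nhdsWithin 1 (Set.Iio 1)) (nhds 0) := by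
    rw [tendsto_zero_iff_norm_tendsto_zero]
    have hs : Filter.Tendsto (fun t : ℝ => 1 - t) (nhdsWithin 1 (Set.Iio 1))
        (nhdsWithin 0 (Set.Ioi 0)) := by
      refine tendsto_nhdsWithin_iff.2 ⟨?_, ?_⟩
      · refine tendsto_nhdsWithin_of_tendsto_nhds ?_
        have : ContinuousAt (fun t : ℝ => 1 - t) 1 := by fun_prop
        simpa [ContinuousAt] using this
      · filter_upwards [self_mem_nhdsWithin] with t ht
        exact sub_pos.2 (Set.mem_Iio.1 ht)
    have h : Filter.Tendsto (fun t : ℝ => Real.exp (d.re * Real.log (1 - t)))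
        (nhdsWithin 1 (Set.Iio 1)) (nhds 0) :=
      Real.tendsto_exp_atBot.comp
        ((Real.tendsto_log_nhdsGT_zero.comp hs).const_mul_atBot hd)
    refine h.congr' ?_
    filter_upwards [self_mem_nhdsWithin] with t ht
    rw [Complex.norm_exp, ← Complex.ofReal_one, ← Complex.ofReal_sub,
      ← Complex.ofReal_log (sub_pos.2 (Set.mem_Iio.1 ht)).le, Complex.re_mul_ofReal]
  have h1 : Filter.Tendsto (fun t : ℝ =>
      Complex.exp (b * Complex.log t - a * Complex.log (1 - y * t)))
      (nhdsWithin 1 (Set.Iio 1)) (nhds (Complex.exp (b * Complex.log (1 : ℝ)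
        - a * Complex.log (1 - y * (1 : ℝ))))) := by
    refine tendsto_nhdsWithin_of_tendsto_nhds (ContinuousAt.tendsto ?_)
    have c1 : ContinuousAt (fun t : ℝ => Complex.log t) 1 :=
      ContinuousAt.clog (by fun_prop) (by simp)
    have c2 : ContinuousAt (fun t : ℝ => Complex.log (1 - y * t)) 1 :=
      ContinuousAt.clog (by fun_prop) (hS 1 (by simp))
    fun_prop
  have := h0.mul h1
  rw [zero_mul] at this
  refine this.congr fun t => ?_
  rw [branch1, ← Complex.exp_add]
  congr 1; ring

/-- The coefficient functions appearing in the two contiguity relations: `I` is viewed as a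
function of `(b, d, a)`, where `d = c - b`. -/
def Contiguous (y : ℂ) (I : ℂ → ℂ → ℂ → ℂ) (b d a : ℂ) : Prop :=
  b * I b d a = (b + d) * I (b + 1) d a - a * y * I (b + 1) (d + 1) (a + 1) ∧
    d * I b d a = (b + d) * I b (d + 1) a + a * y * I (b + 1) (d + 1) (a + 1)

/-- Two linear relations are behind this: `1 = t + (1 - t)`, and the vanishing of the integral of
the derivative of `t^b (1 - t)^d (1 - y t)^(-a)`. Each of the two combinations eliminates one of the
integrals with a single shift. They are chosen so that the right-hand side only raises `b` and `d`,
while the left-hand coefficient is `b` or `d`, nonzero on `domF`. -/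
theorem integralF_contiguous {y : ℂ}
    (hS : ∀ t ∈ Set.Icc (0 : ℝ) 1, 1 - y * t ∈ Complex.slitPlane) (a : ℂ) {b d : ℂ}
    (hb : 0 < b.re) (hd : 0 < d.re) :
    Contiguous y (fun b d a => integralF y (a, b, b + d)) b d a := by
  have hmem : ∀ (i j k : ℕ), (a + k, b + i, b + i + (d + j)) ∈ regF := by
    intro i j k
    simp only [regF, Set.mem_ofPred_eq, Complex.add_re, Complex.natCast_re]
    constructor <;> linarith [Nat.cast_nonneg (α := ℝ) i, Nat.cast_nonneg (α := ℝ) j]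
  have hint : ∀ (i j k : ℕ), IntervalIntegrable (integrandF y (a + k, b + i, b + i + (d + j)))
      MeasureTheory.volume 0 1 := fun i j k => integrandF_intervalIntegrable hS (hmem i j k)
  have hF : ∀ p, integralF y p = ∫ t in (0 : ℝ)..1, integrandF y p t := fun p => rfl
  have hne : ∀ t ∈ Set.Ioo (0 : ℝ) 1, 1 - y * t ≠ 0 := fun t ht =>
    Complex.slitPlane_ne_zero (hS t (Set.Ioo_subset_Icc_self ht))
  have h000 := hint 0 0 0
  have h100 := hint 1 0 0
  have h010 := hint 0 1 0
  have h111 := hint 1 1 1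
  have q000 := fun t ht => integrandF_eq (y := y) a b d (t := t) ht 0 0 0 (hne t ht)
  have q100 := fun t ht => integrandF_eq (y := y) a b d (t := t) ht 1 0 0 (hne t ht)
  have q010 := fun t ht => integrandF_eq (y := y) a b d (t := t) ht 0 1 0 (hne t ht)
  have q111 := fun t ht => integrandF_eq (y := y) a b d (t := t) ht 1 1 1 (hne t ht)
  simp only [Nat.cast_zero, Nat.cast_one, add_zero, pow_zero, pow_one] at h000 h100 h010 h111 q000 q100 q010 q111
  have r0 : (∫ t in (0 : ℝ)..1, integrandF y (a, b, b + d) t)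
      = (∫ t in (0 : ℝ)..1, integrandF y (a, b + 1, b + 1 + d) t)
        + ∫ t in (0 : ℝ)..1, integrandF y (a, b, b + (d + 1)) t := by
    rw [← intervalIntegral.integral_add h100 h010]
    refine intervalIntegral.integral_congr_Ioo_of_le zero_le_one fun t ht => ?_
    simp only [q100 t ht, q010 t ht]
    ring
  have r1 : b * (∫ t in (0 : ℝ)..1, integrandF y (a, b, b + (d + 1)) t)
      - d * (∫ t in (0 : ℝ)..1, integrandF y (a, b + 1, b + 1 + d) t)
      + a * y * (∫ t in (0 : ℝ)..1, integrandF y (a + 1, b + 1, b + 1 + (d + 1)) t) = 0 := by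
    rw [← intervalIntegral.integral_const_mul, ← intervalIntegral.integral_const_mul,
      ← intervalIntegral.integral_const_mul, ← intervalIntegral.integral_sub
        (h010.const_mul _) (h100.const_mul _), ← intervalIntegral.integral_add
        ((h010.const_mul _).sub (h100.const_mul _)) (h111.const_mul _)]
    -- The combined integrand is the derivative of the branch `t^b (1 - t)^d (1 - y t)^(-a)`, which
    -- tends to zero at both endpoints.
    rw [intervalIntegral.integral_eq_sub_of_hasDerivAt_of_tendsto zero_lt_one
      (f := branch1 a b (b + d) y) ?_ (((h010.const_mul _).sub (h100.const_mul _)).add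
        (h111.const_mul _)) (branch1_tendsto_zero y a hb) (branch1_tendsto_one hS a hd), sub_zero]
    intro t ht
    have t0 : (t : ℂ) ∈ Complex.slitPlane := Complex.ofReal_mem_slitPlane.2 ht.1
    have t1 : 1 - (t : ℂ) ∈ Complex.slitPlane := by
      rw [← Complex.ofReal_one, ← Complex.ofReal_sub]
      exact Complex.ofReal_mem_slitPlane.2 (by linarith [ht.2])
    have t2 := hS t (Set.Ioo_subset_Icc_self ht)
    have d0 : HasDerivAt (fun t : ℝ => (t : ℂ)) 1 t := Complex.ofRealCLM.hasDerivAt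
    have l0 := d0.clog_real t0
    have l1 := (d0.const_sub 1).clog_real t1
    have l2 := ((d0.const_mul y).const_sub 1).clog_real t2
    have D := (((l0.const_mul b).add (l1.const_mul (b + d - b))).sub (l2.const_mul a)).cexp
    refine D.congr_deriv ?_
    simp only [q100 t ht, q010 t ht, q111 t ht]
    have n0 := Complex.slitPlane_ne_zero t0
    have n1 := Complex.slitPlane_ne_zero t1
    have n2 := Complex.slitPlane_ne_zero t2
    simp only [integrandF, branch1, path1]
    simp only [Pi.add_apply, Pi.sub_apply]
    field_simp
    ring
  simp only [Contiguous, hF]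
  constructor
  · linear_combination b * r0 + r1
  · linear_combination d * r0 - r1

/-- One step of analytic continuation in the variable `b`. -/
noncomputable def stepB (y : ℂ) (I : ℂ × ℂ × ℂ → ℂ) (p : ℂ × ℂ × ℂ) : ℂ :=
  (p.2.2 * I (p.1, p.2.1 + 1, p.2.2 + 1) - p.1 * y * I (p.1 + 1, p.2.1 + 1, p.2.2 + 2)) / p.2.1

/-- One step of analytic continuation in the variable `d = c - b`. -/
noncomputable def stepD (y : ℂ) (I : ℂ × ℂ × ℂ → ℂ) (p : ℂ × ℂ × ℂ) : ℂ :=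
  (p.2.2 * I (p.1, p.2.1, p.2.2 + 1) + p.1 * y * I (p.1 + 1, p.2.1 + 1, p.2.2 + 2))
    / (p.2.2 - p.2.1)

/-- The `n`-th step of the analytic continuation of `integralF`. -/
noncomputable def extF (y : ℂ) : ℕ → ℂ × ℂ × ℂ → ℂ
  | 0 => integralF y
  | n + 1 => stepB y (stepD y (extF y n))

/-- The part `Re b > -m`, `Re (c - b) > -n` of the domain `domF`. -/
def strip (m n : ℕ) : Set (ℂ × ℂ × ℂ) :=
  {p | -(m : ℝ) < p.2.1.re ∧ -(n : ℝ) < (p.2.2 - p.2.1).re} ∩ domF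

/-! ### Strips exhausting the domain of `𝓕`, and the continuation step by step. -/

theorem strip_zero : strip 0 0 = regF := by
  ext p
  simp only [strip, regF, domF, Set.mem_inter_iff, Set.mem_ofPred_eq, Nat.cast_zero, neg_zero,
    Complex.sub_re, sub_pos]
  refine ⟨fun h => h.1, fun h => ⟨h, fun n => ⟨fun h0 => ?_, fun h0 => ?_⟩⟩⟩
  · have h1 := h.1
    rw [h0] at h1
    simp at h1
    linarith [Nat.cast_nonneg (α := ℝ) n]
  · have h1 := congrArg Complex.re h0
    simp at h1
    linarith [h.2, Nat.cast_nonneg (α := ℝ) n]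

theorem isClosed_range_neg_natCast : IsClosed (Set.range fun n : ℕ => -(n : ℂ)) := by
  have h : Set.range (fun n : ℕ => -(n : ℂ))
      = (fun x : ℝ => (x : ℂ)) '' (Int.cast '' {n : ℤ | n ≤ 0}) := by
    ext z
    constructor
    · rintro ⟨n, rfl⟩
      exact ⟨_, ⟨-(n : ℤ), by simp, rfl⟩, by simp⟩
    · rintro ⟨_, ⟨n, hn, rfl⟩, rfl⟩
      refine ⟨n.natAbs, ?_⟩
      obtain ⟨m, rfl⟩ := Int.exists_eq_neg_ofNat hn
      simp
  rw [h]
  refine Complex.isometry_ofReal.isClosedEmbedding.isClosedMap _ ?_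
  exact Int.isClosedEmbedding_coe_real.isClosedMap _ (isClosed_discrete _)

theorem isOpen_domF : IsOpen domF := by
  have h : domF = (fun p : ℂ × ℂ × ℂ => p.2.1) ⁻¹' (Set.range fun n : ℕ => -(n : ℂ))ᶜ ∩
      (fun p : ℂ × ℂ × ℂ => p.2.2 - p.2.1) ⁻¹' (Set.range fun n : ℕ => -(n : ℂ))ᶜ := by
    ext p
    simp [domF, forall_and, eq_comm]
  rw [h]
  exact (isClosed_range_neg_natCast.isOpen_compl.preimage (by fun_prop)).inter
    (isClosed_range_neg_natCast.isOpen_compl.preimage (by fun_prop))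

theorem isOpen_strip (m n : ℕ) : IsOpen (strip m n) := by
  refine IsOpen.inter ?_ isOpen_domF
  simp only [Set.ofPred_and]
  refine IsOpen.inter (isOpen_lt continuous_const ?_) (isOpen_lt continuous_const ?_)
  all_goals fun_prop

theorem strip_mono {m n m' n' : ℕ} (hm : m ≤ m') (hn : n ≤ n') : strip m n ⊆ strip m' n' := by
  rintro p ⟨⟨h1, h2⟩, h⟩
  have e1 : (m : ℝ) ≤ m' := by exact_mod_cast hm
  have e2 : (n : ℝ) ≤ n' := by exact_mod_cast hn
  exact ⟨⟨by linarith, by linarith⟩, h⟩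

theorem ne_zero_of_mem_domF {p : ℂ × ℂ × ℂ} (hp : p ∈ domF) : p.2.1 ≠ 0 ∧ p.2.2 - p.2.1 ≠ 0 := by
  simpa using hp 0

theorem add_one_ne_neg {z : ℂ} (h : ∀ n : ℕ, z ≠ -(n : ℂ)) (n : ℕ) : z + 1 ≠ -(n : ℂ) := by
  intro h1
  refine h (n + 1) ?_
  push_cast
  linear_combination h1

theorem shift_mem_domF {p : ℂ × ℂ × ℂ} (hp : p ∈ domF) :
    (p.1, p.2.1 + 1, p.2.2 + 1) ∈ domF ∧ (p.1, p.2.1, p.2.2 + 1) ∈ domF ∧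
      (p.1 + 1, p.2.1 + 1, p.2.2 + 2) ∈ domF := by
  have h1 := add_one_ne_neg fun n => (hp n).1
  have h2 := add_one_ne_neg fun n => (hp n).2
  have e1 : p.2.2 + 1 - (p.2.1 + 1) = p.2.2 - p.2.1 := by ring
  have e2 : p.2.2 + 1 - p.2.1 = p.2.2 - p.2.1 + 1 := by ring
  have e3 : p.2.2 + 2 - (p.2.1 + 1) = p.2.2 - p.2.1 + 1 := by ring
  refine ⟨fun n => ⟨h1 n, ?_⟩, fun n => ⟨(hp n).1, ?_⟩, fun n => ⟨h1 n, ?_⟩⟩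
  · simpa only [e1] using (hp n).2
  · simpa only [e2] using h2 n
  · simpa only [e3] using h2 n

theorem shift_mem_strip_left {m n : ℕ} {p : ℂ × ℂ × ℂ} (hp : p ∈ strip (m + 1) n) :
    (p.1, p.2.1 + 1, p.2.2 + 1) ∈ strip m n ∧ (p.1 + 1, p.2.1 + 1, p.2.2 + 2) ∈ strip m n := by
  obtain ⟨⟨h1, h2⟩, h⟩ := hp
  have hs := shift_mem_domF h
  push_cast at h1
  simp only [Complex.sub_re] at h2
  refine ⟨⟨⟨?_, ?_⟩, hs.1⟩, ⟨?_, ?_⟩, hs.2.2⟩ <;> simp <;> linarith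

theorem shift_mem_strip_right {m n : ℕ} {p : ℂ × ℂ × ℂ} (hp : p ∈ strip m (n + 1)) :
    (p.1, p.2.1, p.2.2 + 1) ∈ strip m n ∧ (p.1 + 1, p.2.1 + 1, p.2.2 + 2) ∈ strip m n := by
  obtain ⟨⟨h1, h2⟩, h⟩ := hp
  have hs := shift_mem_domF h
  push_cast at h2
  simp only [Complex.sub_re] at h2
  refine ⟨⟨⟨?_, ?_⟩, hs.2.1⟩, ⟨?_, ?_⟩, hs.2.2⟩ <;> simp <;> linarith

theorem stepB_differentiableOn {y : ℂ} {I : ℂ × ℂ × ℂ → ℂ} {m n : ℕ}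
    (hI : DifferentiableOn ℂ I (strip m n)) : DifferentiableOn ℂ (stepB y I) (strip (m + 1) n) := by
  have h1 : DifferentiableOn ℂ (fun p : ℂ × ℂ × ℂ => I (p.1, p.2.1 + 1, p.2.2 + 1))
      (strip (m + 1) n) :=
    hI.comp (by fun_prop) fun p hp => (shift_mem_strip_left hp).1
  have h2 : DifferentiableOn ℂ (fun p : ℂ × ℂ × ℂ => I (p.1 + 1, p.2.1 + 1, p.2.2 + 2))
      (strip (m + 1) n) :=
    hI.comp (by fun_prop) fun p hp => (shift_mem_strip_left hp).2
  unfold stepB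
  simp only [div_eq_mul_inv]
  exact (((show DifferentiableOn ℂ (fun p : ℂ × ℂ × ℂ => p.2.2) _ by fun_prop).mul h1).sub ((show DifferentiableOn ℂ (fun p : ℂ × ℂ × ℂ => p.1 * y) _ by fun_prop).mul h2)).mul (DifferentiableOn.inv
    (show DifferentiableOn ℂ (fun p : ℂ × ℂ × ℂ => p.2.1) _ by fun_prop)
    fun p (hp : p ∈ strip (m + 1) n) => (ne_zero_of_mem_domF hp.2).1)

theorem stepD_differentiableOn {y : ℂ} {I : ℂ × ℂ × ℂ → ℂ} {m n : ℕ}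
    (hI : DifferentiableOn ℂ I (strip m n)) : DifferentiableOn ℂ (stepD y I) (strip m (n + 1)) := by
  have h1 : DifferentiableOn ℂ (fun p : ℂ × ℂ × ℂ => I (p.1, p.2.1, p.2.2 + 1))
      (strip m (n + 1)) :=
    hI.comp (by fun_prop) fun p hp => (shift_mem_strip_right hp).1
  have h2 : DifferentiableOn ℂ (fun p : ℂ × ℂ × ℂ => I (p.1 + 1, p.2.1 + 1, p.2.2 + 2))
      (strip m (n + 1)) :=
    hI.comp (by fun_prop) fun p hp => (shift_mem_strip_right hp).2
  unfold stepD
  simp only [div_eq_mul_inv]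
  exact (((show DifferentiableOn ℂ (fun p : ℂ × ℂ × ℂ => p.2.2) _ by fun_prop).mul h1).add ((show DifferentiableOn ℂ (fun p : ℂ × ℂ × ℂ => p.1 * y) _ by fun_prop).mul h2)).mul (DifferentiableOn.inv
    (show DifferentiableOn ℂ (fun p : ℂ × ℂ × ℂ => p.2.2 - p.2.1) _ by fun_prop)
    fun p (hp : p ∈ strip m (n + 1)) => (ne_zero_of_mem_domF hp.2).2)

theorem stepB_congr {y : ℂ} {I J : ℂ × ℂ × ℂ → ℂ} {m n : ℕ} (h : Set.EqOn I J (strip m n)) :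
    Set.EqOn (stepB y I) (stepB y J) (strip (m + 1) n) := fun p hp => by
  rw [stepB, stepB, h (shift_mem_strip_left hp).1, h (shift_mem_strip_left hp).2]

theorem stepD_congr {y : ℂ} {I J : ℂ × ℂ × ℂ → ℂ} {m n : ℕ} (h : Set.EqOn I J (strip m n)) :
    Set.EqOn (stepD y I) (stepD y J) (strip m (n + 1)) := fun p hp => by
  rw [stepD, stepD, h (shift_mem_strip_right hp).1, h (shift_mem_strip_right hp).2]

theorem extF_differentiableOn {y : ℂ}
    (hS : ∀ t ∈ Set.Icc (0 : ℝ) 1, 1 - y * t ∈ Complex.slitPlane) (n : ℕ) :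
    DifferentiableOn ℂ (extF y n) (strip n n) := by
  induction n with
  | zero => rw [strip_zero]; exact integralF_differentiableOn hS
  | succ n ih => exact stepB_differentiableOn (stepD_differentiableOn ih)

/-- Each step is a contiguity relation solved for its left-hand side, so it leaves the convergent
integral unchanged. This starts the induction showing that successive continuations agree. -/
theorem stepB_stepD_integralF {y : ℂ}
    (hS : ∀ t ∈ Set.Icc (0 : ℝ) 1, 1 - y * t ∈ Complex.slitPlane) :
    Set.EqOn (stepB y (stepD y (integralF y))) (integralF y) (strip 0 0) := by
  have hD : Set.EqOn (stepD y (integralF y)) (integralF y) (strip 0 0) := by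
    rintro ⟨a, b, c⟩ hp
    have h := (integralF_contiguous hS a (b := b) (d := c - b) (by simpa using hp.1.1)
      (by simpa using hp.1.2)).2
    have e1 : b + (c - b + 1) = c + 1 := by ring
    have e2 : b + 1 + (c - b + 1) = c + 2 := by ring
    simp only [e1, e2, add_sub_cancel] at h
    rw [stepD, div_eq_iff (ne_zero_of_mem_domF hp.2).2]
    linear_combination -h
  have hB : Set.EqOn (stepB y (integralF y)) (integralF y) (strip 0 0) := by
    rintro ⟨a, b, c⟩ hp
    have h := (integralF_contiguous hS a (b := b) (d := c - b) (by simpa using hp.1.1)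
      (by simpa using hp.1.2)).1
    have e1 : b + 1 + (c - b) = c + 1 := by ring
    have e2 : b + 1 + (c - b + 1) = c + 2 := by ring
    simp only [e1, e2, add_sub_cancel] at h
    rw [stepB, div_eq_iff (ne_zero_of_mem_domF hp.2).1]
    linear_combination -h
  exact ((stepB_congr hD).mono (strip_mono (Nat.zero_le _) le_rfl)).trans hB

/-- A step depends only on values at shifted points, which lie in the narrower strip. Applying the
same step to two functions that agree therefore preserves the agreement and widens the strip by one.
-/
theorem extF_succ_eqOn {y : ℂ}
    (hS : ∀ t ∈ Set.Icc (0 : ℝ) 1, 1 - y * t ∈ Complex.slitPlane) (n : ℕ) :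
    Set.EqOn (extF y (n + 1)) (extF y n) (strip n n) := by
  induction n with
  | zero => exact stepB_stepD_integralF hS
  | succ n ih => exact stepB_congr (stepD_congr ih)

theorem extF_eqOn {y : ℂ}
    (hS : ∀ t ∈ Set.Icc (0 : ℝ) 1, 1 - y * t ∈ Complex.slitPlane) {m n : ℕ} (h : m ≤ n) :
    Set.EqOn (extF y n) (extF y m) (strip m m) := by
  induction n, h using Nat.le_induction with
  | base => exact Set.eqOn_refl _ _
  | succ n hn ih => exact ((extF_succ_eqOn hS n).mono (strip_mono hn hn)).trans ih

theorem exists_mem_strip {p : ℂ × ℂ × ℂ} (hp : p ∈ domF) : ∃ n : ℕ, p ∈ strip n n := by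
  obtain ⟨m, hm⟩ := exists_nat_gt (-p.2.1.re)
  obtain ⟨n, hn⟩ := exists_nat_gt (-(p.2.2 - p.2.1).re)
  refine ⟨max m n, ⟨?_, ?_⟩, hp⟩
  · have : (m : ℝ) ≤ (max m n : ℕ) := by exact_mod_cast le_max_left _ _
    linarith
  · have : (n : ℝ) ≤ (max m n : ℕ) := by exact_mod_cast le_max_right _ _
    linarith

theorem exists_isContinuation_integralF {y : ℂ}
    (hS : ∀ t ∈ Set.Icc (0 : ℝ) 1, 1 - y * t ∈ Complex.slitPlane) :
    ∃ F, IsContinuation domF regF (integralF y) F := by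
  classical
  -- The local continuations are glued by taking the least `n` whose strip contains the point; their
  -- compatibility makes this choice irrelevant.
  let F : ℂ × ℂ × ℂ → ℂ := fun p => if h : ∃ n : ℕ, p ∈ strip n n then extF y (Nat.find h) p else 0
  have hF : ∀ n, Set.EqOn F (extF y n) (strip n n) := by
    intro n p hp
    have h : ∃ n : ℕ, p ∈ strip n n := ⟨n, hp⟩
    simp only [F, dif_pos h]
    exact (extF_eqOn hS (Nat.find_min' h hp) (Nat.find_spec h)).symm
  refine ⟨F, fun p hp => ?_, ?_⟩
  · obtain ⟨n, hn⟩ := exists_mem_strip hp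
    refine DifferentiableAt.differentiableWithinAt ?_
    refine ((extF_differentiableOn hS n).differentiableAt ((isOpen_strip n n).mem_nhds hn)).congr_of_eventuallyEq ?_
    filter_upwards [(isOpen_strip n n).mem_nhds hn] with q hq using hF n hq
  · have := hF 0
    rwa [strip_zero] at this

/-! ### Uniqueness of the continuation -/

/-- The identity theorem on the complement of countably many complex hyperplanes, along complex
lines: `D` is open, and meets every line through a point of `D` and a fixed direction `v` in the
complement of a countable set. -/
theorem eqOn_of_eqOn_of_lines {D R : Set (ℂ × ℂ × ℂ)} (hD : IsOpen D) (hR : IsOpen R)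
    (v : ℂ × ℂ × ℂ) (hline : ∀ p ∈ D, {t : ℂ | p + t • v ∉ D}.Countable)
    (hmeet : ∀ p ∈ D, ∃ t : ℂ, p + t • v ∈ R) (hRD : R ⊆ D) {F G : ℂ × ℂ × ℂ → ℂ}
    (hF : DifferentiableOn ℂ F D) (hG : DifferentiableOn ℂ G D) (h : Set.EqOn F G R) :
    Set.EqOn F G D := by
  intro p hp
  let ι : ℂ → ℂ × ℂ × ℂ := fun t => p + t • v
  have hι : Differentiable ℂ ι := by fun_prop
  have hopen : IsOpen (ι ⁻¹' D) := hD.preimage hι.continuous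
  -- The complement of a countable set in `ℂ` is connected, since `ℂ` has real dimension two. The
  -- identity theorem in one variable then suffices.
  have hconn : IsPreconnected (ι ⁻¹' D) := by
    have := (hline p hp).isConnected_compl_of_one_lt_rank (E := ℂ) (by simp)
    have h2 : ({t : ℂ | p + t • v ∉ D} : Set ℂ)ᶜ = ι ⁻¹' D := by ext t; simp [ι]
    rw [h2] at this
    exact this.isPreconnected
  obtain ⟨t, ht⟩ := hmeet p hp
  have hF' : AnalyticOnNhd ℂ (F ∘ ι) (ι ⁻¹' D) :=
    (hF.comp hι.differentiableOn fun _ h => h).analyticOnNhd hopen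
  have hG' : AnalyticOnNhd ℂ (G ∘ ι) (ι ⁻¹' D) :=
    (hG.comp hι.differentiableOn fun _ h => h).analyticOnNhd hopen
  have := hF'.eqOn_of_preconnected_of_eventuallyEq hG' hconn (hRD ht : ι t ∈ D) (by
    filter_upwards [(hR.preimage hι.continuous).mem_nhds ht] with u hu using h hu)
  have h0 := this (x := 0) (by simpa [ι] using hp)
  simpa [ι] using h0

theorem regF_subset_domF : regF ⊆ domF := by
  rw [← strip_zero]; exact Set.inter_subset_right

theorem eqOn_domF {F G : ℂ × ℂ × ℂ → ℂ} (hF : DifferentiableOn ℂ F domF)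
    (hG : DifferentiableOn ℂ G domF) (h : Set.EqOn F G regF) : Set.EqOn F G domF := by
  -- Along the direction `(0, 1, 2)` both `b` and `c - b` grow with speed one. Hence a large real
  -- time leads into `regF`, and each excluded hyperplane is met exactly once.
  refine eqOn_of_eqOn_of_lines isOpen_domF isOpen_regF (0, 1, 2) ?_ ?_ regF_subset_domF hF hG h
  · intro p _
    refine ((Set.countable_range fun n : ℕ => -(n : ℂ) - p.2.1).union
      (Set.countable_range fun n : ℕ => -(n : ℂ) - (p.2.2 - p.2.1))).mono ?_
    intro t ht
    simp only [domF, Set.mem_ofPred_eq, not_forall, not_and_or, not_not] at ht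
    obtain ⟨n, h | h⟩ := ht
    · refine Or.inl ⟨n, ?_⟩
      simp at h
      simp only [← h]; ring
    · refine Or.inr ⟨n, ?_⟩
      simp at h
      simp only [← h]; ring
  · intro p _
    obtain ⟨n, hn⟩ := exists_nat_gt (|p.2.1.re| + |(p.2.2 - p.2.1).re|)
    refine ⟨n, ?_⟩
    have h1 := abs_nonneg p.2.1.re
    have h2 := abs_nonneg (p.2.2 - p.2.1).re
    have h3 := neg_abs_le p.2.1.re
    have h4 := neg_abs_le (p.2.2 - p.2.1).re
    rw [Complex.sub_re] at *
    simp only [regF, Set.mem_ofPred_eq]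
    constructor <;> simp <;> linarith

theorem calF_isContinuation {y : ℂ}
    (hS : ∀ t ∈ Set.Icc (0 : ℝ) 1, 1 - y * t ∈ Complex.slitPlane) :
    IsContinuation domF regF (integralF y) (fun p => calF p.1 p.2.1 p.2.2 y) :=
  Classical.epsilon_spec (exists_isContinuation_integralF hS)

/-- Both sides of each relation are holomorphic on `domF` and agree on `regF`, so the identity
theorem extends the relations. -/
theorem calF_contiguous {y : ℂ}
    (hS : ∀ t ∈ Set.Icc (0 : ℝ) 1, 1 - y * t ∈ Complex.slitPlane) {a b d : ℂ}
    (hb : ∀ n : ℕ, b ≠ -(n : ℂ)) (hd : ∀ n : ℕ, d ≠ -(n : ℂ)) :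
    Contiguous y (fun b d a => calF a b (b + d) y) b d a := by
  obtain ⟨hdiff, heq⟩ := calF_isContinuation hS
  set I : ℂ × ℂ × ℂ → ℂ := fun p => calF p.1 p.2.1 p.2.2 y with hI
  have h1 : DifferentiableOn ℂ (fun p : ℂ × ℂ × ℂ => I (p.1, p.2.1 + 1, p.2.2 + 1)) domF :=
    hdiff.comp (by fun_prop) fun p hp => (shift_mem_domF hp).1
  have h2 : DifferentiableOn ℂ (fun p : ℂ × ℂ × ℂ => I (p.1, p.2.1, p.2.2 + 1)) domF :=
    hdiff.comp (by fun_prop) fun p hp => (shift_mem_domF hp).2.1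
  have h3 : DifferentiableOn ℂ (fun p : ℂ × ℂ × ℂ => I (p.1 + 1, p.2.1 + 1, p.2.2 + 2)) domF :=
    hdiff.comp (by fun_prop) fun p hp => (shift_mem_domF hp).2.2
  have hp : (a, b, b + d) ∈ domF := fun n => ⟨hb n, by simpa using hd n⟩
  have hreg : ∀ p ∈ regF, (p.1, p.2.1 + 1, p.2.2 + 1) ∈ regF ∧ (p.1, p.2.1, p.2.2 + 1) ∈ regF ∧
      (p.1 + 1, p.2.1 + 1, p.2.2 + 2) ∈ regF := by
    rintro p ⟨h1, h2⟩
    refine ⟨⟨?_, ?_⟩, ⟨?_, ?_⟩, ⟨?_, ?_⟩⟩ <;> simp <;> linarith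
  have hcont : ∀ p ∈ regF, Contiguous y (fun b d a => integralF y (a, b, b + d)) p.2.1
      (p.2.2 - p.2.1) p.1 := fun p hp => by
    refine integralF_contiguous hS p.1 hp.1 ?_
    simpa using hp.2
  have e1 : ∀ b d : ℂ, b + 1 + d = b + d + 1 := fun b d => by ring
  have e2 : ∀ b d : ℂ, b + (d + 1) = b + d + 1 := fun b d => by ring
  have e3 : ∀ b d : ℂ, b + d + 1 + 1 = b + d + 2 := fun b d => by ring
  constructor
  · have := eqOn_domF (F := fun p => p.2.1 * I p)
      (G := fun p => p.2.2 * I (p.1, p.2.1 + 1, p.2.2 + 1)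
        - p.1 * y * I (p.1 + 1, p.2.1 + 1, p.2.2 + 2))
      ((show DifferentiableOn ℂ (fun p : ℂ × ℂ × ℂ => p.2.1) _ by fun_prop).mul hdiff) (((show DifferentiableOn ℂ (fun p : ℂ × ℂ × ℂ => p.2.2) _ by fun_prop).mul h1).sub ((show DifferentiableOn ℂ (fun p : ℂ × ℂ × ℂ => p.1 * y) _ by fun_prop).mul h3)) (by
        intro p hp
        have h := (hcont p hp).1
        simp only [e1, e2, add_sub_cancel, add_assoc, one_add_one_eq_two] at h
        simp only [heq hp, heq (hreg p hp).1, heq (hreg p hp).2.2]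
        exact h) hp
    simp only [e1, e2, e3]
    exact this
  · have := eqOn_domF (F := fun p => (p.2.2 - p.2.1) * I p)
      (G := fun p => p.2.2 * I (p.1, p.2.1, p.2.2 + 1)
        + p.1 * y * I (p.1 + 1, p.2.1 + 1, p.2.2 + 2))
      ((show DifferentiableOn ℂ (fun p : ℂ × ℂ × ℂ => p.2.2 - p.2.1) _ by fun_prop).mul hdiff) (((show DifferentiableOn ℂ (fun p : ℂ × ℂ × ℂ => p.2.2) _ by fun_prop).mul h2).add ((show DifferentiableOn ℂ (fun p : ℂ × ℂ × ℂ => p.1 * y) _ by fun_prop).mul h3)) (by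
        intro p hp
        have h := (hcont p hp).2
        simp only [e1, e2, add_sub_cancel, add_assoc, one_add_one_eq_two] at h
        simp only [heq hp, heq (hreg p hp).2.1, heq (hreg p hp).2.2]
        exact h) hp
    simp only [e1, e2, e3]
    simpa using this

end ContinuationF

/-! ### The function `𝓖` in terms of `𝓕` -/

section ContinuationG

/-- The involution `(a, b, c) ↦ (1 + b - c, 1 + a - c, 2 - c)` of the parameters induced by
`x ↦ 1 / (y x)`. -/
def swapParams (p : ℂ × ℂ × ℂ) : ℂ × ℂ × ℂ := (1 + p.2.1 - p.2.2, 1 + p.1 - p.2.2, 2 - p.2.2)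

theorem swapParams_swapParams (p : ℂ × ℂ × ℂ) : swapParams (swapParams p) = p := by
  simp only [swapParams]
  refine Prod.ext ?_ (Prod.ext ?_ ?_) <;> simp <;> ring

theorem differentiable_swapParams : Differentiable ℂ swapParams := by
  unfold swapParams
  fun_prop

theorem swapParams_mem_domF {p : ℂ × ℂ × ℂ} : swapParams p ∈ domF ↔ p ∈ domG := by
  simp only [domF, domG, swapParams, Set.mem_ofPred_eq]
  refine forall_congr' fun n => ?_
  rw [and_comm]
  refine and_congr (not_congr ?_) (not_congr ?_)
  · constructor <;> intro h <;> linear_combination -h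
  · constructor <;> intro h <;> linear_combination -h

theorem swapParams_mem_regF {p : ℂ × ℂ × ℂ} : swapParams p ∈ regF ↔ p ∈ regG := by
  simp only [regF, regG, swapParams, Set.mem_ofPred_eq]
  simp
  constructor <;> rintro ⟨h1, h2⟩ <;> constructor <;> linarith

/-- The involution `swapParams` exchanges the domains and regions of `𝓕` and `𝓖`, so uniqueness is
transported from `eqOn_domF`. -/
theorem eqOn_domG {F G : ℂ × ℂ × ℂ → ℂ} (hF : DifferentiableOn ℂ F domG)
    (hG : DifferentiableOn ℂ G domG) (h : Set.EqOn F G regG) : Set.EqOn F G domG := by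
  have hm : Set.MapsTo swapParams domF domG := fun p hp => by
    rwa [← swapParams_mem_domF, swapParams_swapParams]
  have hr : Set.MapsTo swapParams regF regG := fun p hp => by
    rwa [← swapParams_mem_regF, swapParams_swapParams]
  have := eqOn_domF (hF.comp differentiable_swapParams.differentiableOn hm)
    (hG.comp differentiable_swapParams.differentiableOn hm) fun p hp => h (hr hp)
  intro p hp
  have h1 := this (swapParams_mem_domF.2 hp)
  simpa [swapParams_swapParams] using h1

/-- The constant relating the branches along the second path to those along the first one. -/
noncomputable def swapConst (ly lm y : ℂ) (p : ℂ × ℂ × ℂ) : ℂ :=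
  y * Complex.exp (-p.2.2 * ly + (p.2.2 - p.2.1 - p.1) * lm)

/-- With `x = 1 / (y t)` one has `1 - x = -(1 - y t) / (y t)`, `1 - y x = -(1 - t) / t` and `dx / (x
(1 - x)) = y dt / (1 - y t)`. The exponents of `t`, `1 - t`, `1 - y t` become `a - c`, `-a`, `c - b
- 1`, which are those of an `𝓕`-integrand at the swapped parameters. The constants collect into
`swapConst`. -/
theorem branch2_mul_eq {y : ℂ} (hy0 : y ≠ 0) {t : ℝ} (ht : t ∈ Set.Ioo (0 : ℝ) 1)
    (hy : 1 - y * t ≠ 0) (ly lm : ℂ) (p : ℂ × ℂ × ℂ) :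
    branch2 ly lm p.1 p.2.1 p.2.2 y t * (1 / (path2 y t * (1 - path2 y t)))
      * (-(1 / (y * (t : ℂ) ^ 2))) = swapConst ly lm y p * integrandF y (swapParams p) t := by
  have h0 : (t : ℂ) ≠ 0 := by exact_mod_cast ht.1.ne'
  have h1 : (1 : ℂ) - t ≠ 0 := by
    rw [← Complex.ofReal_one, ← Complex.ofReal_sub]
    exact_mod_cast (by linarith [ht.2] : (0:ℝ) < 1 - t).ne'
  have key : branch1 (swapParams p).1 (swapParams p).2.1 (swapParams p).2.2 y t
      * Complex.exp (-p.2.2 * ly + (p.2.2 - p.2.1 - p.1) * lm)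
      = branch2 ly lm p.1 p.2.1 p.2.2 y t * (t * (1 - t) / (1 - y * t)) := by
    have e : (t : ℂ) * (1 - t) / (1 - y * t) = Complex.exp (Complex.log t + Complex.log (1 - t)
        - Complex.log (1 - y * t)) := by
      rw [Complex.exp_sub, Complex.exp_add, Complex.exp_log h0, Complex.exp_log h1,
        Complex.exp_log hy]
    rw [e, branch1, branch2, ← Complex.exp_add, ← Complex.exp_add, swapParams]
    congr 1
    ring
  have hx : y * t - 1 ≠ 0 := fun h => hy (by linear_combination -h)
  have hx2 : (1 / (path2 y t * (1 - path2 y t))) * (-(1 / (y * (t : ℂ) ^ 2))) = y / (1 - y * t) := by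
    rw [path2]
    have : 1 - 1 / (y * t) = (y * t - 1) / (y * t) := by field_simp
    rw [this]
    field_simp
    ring
  rw [mul_assoc, hx2, swapConst, integrandF, path1]
  have : branch1 (swapParams p).1 (swapParams p).2.1 (swapParams p).2.2 y t
      * Complex.exp (-p.2.2 * ly + (p.2.2 - p.2.1 - p.1) * lm) * (1 / (t * (1 - t)))
      = branch2 ly lm p.1 p.2.1 p.2.2 y t / (1 - y * t) := by
    rw [key]; field_simp
  linear_combination (-y) * this

theorem integralG_eq {y : ℂ}
    (hS : ∀ t ∈ Set.Icc (0 : ℝ) 1, 1 - y * t ∈ Complex.slitPlane) (hy0 : y ≠ 0) (ly lm : ℂ)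
    (p : ℂ × ℂ × ℂ) :
    integralG ly lm y p = swapConst ly lm y p * integralF y (swapParams p) := by
  rw [integralG, integralF, ← intervalIntegral.integral_const_mul]
  refine intervalIntegral.integral_congr_Ioo_of_le zero_le_one fun t ht => ?_
  exact branch2_mul_eq hy0 ht
    (Complex.slitPlane_ne_zero (hS t (Set.Ioo_subset_Icc_self ht))) ly lm p

theorem isContinuation_swap {y : ℂ}
    (hS : ∀ t ∈ Set.Icc (0 : ℝ) 1, 1 - y * t ∈ Complex.slitPlane) (hy0 : y ≠ 0) (ly lm : ℂ) :
    IsContinuation domG regG (integralG ly lm y) (fun p => swapConst ly lm y p *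
      calF (swapParams p).1 (swapParams p).2.1 (swapParams p).2.2 y) := by
  obtain ⟨hdiff, heq⟩ := calF_isContinuation hS
  refine ⟨DifferentiableOn.mul ?_ ?_, fun p hp => ?_⟩
  · refine Differentiable.differentiableOn ?_
    unfold swapConst
    fun_prop
  · exact hdiff.comp differentiable_swapParams.differentiableOn fun p hp =>
      swapParams_mem_domF.2 hp
  · simp only [integralG_eq hS hy0]
    rw [← heq (swapParams_mem_regF.2 hp)]

theorem calG_isContinuation {y : ℂ}
    (hS : ∀ t ∈ Set.Icc (0 : ℝ) 1, 1 - y * t ∈ Complex.slitPlane) (hy0 : y ≠ 0) (ly lm : ℂ) :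
    IsContinuation domG regG (integralG ly lm y) (fun p => calG ly lm p.1 p.2.1 p.2.2 y) :=
  Classical.epsilon_spec ⟨_, isContinuation_swap hS hy0 ly lm⟩

theorem calG_eq {y : ℂ}
    (hS : ∀ t ∈ Set.Icc (0 : ℝ) 1, 1 - y * t ∈ Complex.slitPlane) (hy0 : y ≠ 0) (ly lm : ℂ)
    {a b c : ℂ} (h : (a, b, c) ∈ domG) :
    calG ly lm a b c y = swapConst ly lm y (a, b, c) * calF (1 + b - c) (1 + a - c) (2 - c) y := by
  have h1 := calG_isContinuation hS hy0 ly lm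
  have h2 := isContinuation_swap hS hy0 ly lm
  exact eqOn_domG h1.1 h2.1 (h1.2.trans h2.2.symm) h

end ContinuationG

/-! ### Local solutions of `∇ f = g dx` near a puncture with nontrivial monodromy -/

section LocalSolution

open Metric Set

/-- The average `Φ` solves `x Φ' + β Φ = (exp (2 π i β) - 1) k / i`: apply the fundamental theorem
of calculus in `θ` to `exp (i β θ) k (x exp (i θ))`, whose values at `0` and `2 π` differ by the
factor `exp (2 π i β)`. It plays the role of `x^(-β) ∫ u^(β - 1) k(u) du` along the circle through
`x`, with no branch of `x^β` to choose. -/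
theorem hasDerivAt_circle_average {r : ℝ} {k : ℂ → ℂ} (β : ℂ)
    (hk : DifferentiableOn ℂ k (ball 0 r \ {0})) {x : ℂ} (hx : x ∈ ball (0 : ℂ) r \ {0}) :
    HasDerivAt (fun x => ∫ θ in (0 : ℝ)..2 * Real.pi,
        Complex.exp (Complex.I * β * θ) * k (x * Complex.exp (Complex.I * θ)))
      ((((Complex.exp (2 * Real.pi * Complex.I * β) - 1) * k x) / Complex.I
        - β * ∫ θ in (0 : ℝ)..2 * Real.pi,
          Complex.exp (Complex.I * β * θ) * k (x * Complex.exp (Complex.I * θ))) / x) x := by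
  have hopen : IsOpen (ball (0 : ℂ) r \ {0}) := isOpen_ball.sdiff isClosed_singleton
  have hx0 : x ≠ 0 := hx.2
  have hxr : ‖x‖ < r := by simpa using hx.1
  have hn : ∀ θ : ℝ, ‖Complex.exp (Complex.I * θ)‖ = 1 := fun θ => by
    rw [mul_comm]; exact Complex.norm_exp_ofReal_mul_I θ
  have hrot : ∀ z ∈ ball (0 : ℂ) r \ {0}, ∀ θ : ℝ,
      z * Complex.exp (Complex.I * θ) ∈ ball (0 : ℂ) r \ {0} := by
    intro z hz θ
    refine ⟨?_, mul_ne_zero hz.2 (Complex.exp_ne_zero _)⟩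
    have := hz.1
    rw [mem_ball_zero_iff] at this ⊢
    rwa [norm_mul, hn, mul_one]
  have hk' : ContinuousOn (deriv k) (ball 0 r \ {0}) := (hk.deriv hopen).continuousOn
  have hcont : ∀ z ∈ ball (0 : ℂ) r \ {0}, Continuous fun θ : ℝ =>
      Complex.exp (Complex.I * β * θ) * k (z * Complex.exp (Complex.I * θ)) := by
    intro z hz
    refine (by fun_prop : Continuous fun θ : ℝ => Complex.exp (Complex.I * β * θ)).mul ?_
    exact hk.continuousOn.comp_continuous (by fun_prop) (hrot z hz)
  have hcont' : ∀ z ∈ ball (0 : ℂ) r \ {0}, Continuous fun θ : ℝ =>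
      Complex.exp (Complex.I * β * θ) * (deriv k (z * Complex.exp (Complex.I * θ))
        * Complex.exp (Complex.I * θ)) := by
    intro z hz
    refine (by fun_prop : Continuous fun θ : ℝ => Complex.exp (Complex.I * β * θ)).mul ?_
    exact (hk'.comp_continuous (by fun_prop) (hrot z hz)).mul (by fun_prop)
  obtain ⟨ε, hε, hball⟩ := nhds_basis_closedBall.mem_iff.1 (hopen.mem_nhds hx)
  -- Rotating a closed ball around `x` sweeps out a compact subset of the punctured disc, on which
  -- `k'` is bounded. This dominates the derivative uniformly in `z` and `θ`.
  have hcompact : IsCompact ((fun q : ℂ × ℝ => q.1 * Complex.exp (Complex.I * q.2)) ''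
      (closedBall x ε ×ˢ Icc 0 (2 * Real.pi))) :=
    ((isCompact_closedBall x ε).prod isCompact_Icc).image (by fun_prop)
  obtain ⟨B, hB⟩ := hcompact.exists_bound_of_continuousOn (hk'.mono (by
    rintro _ ⟨q, hq, rfl⟩
    exact hrot _ (hball hq.1) _))
  obtain ⟨B', hB'⟩ := (isCompact_Icc (a := (0 : ℝ)) (b := 2 * Real.pi)).exists_bound_of_continuousOn
    (f := fun θ : ℝ => Complex.exp (Complex.I * β * θ)) (by fun_prop)
  have h := intervalIntegral.hasDerivAt_integral_of_dominated_loc_of_deriv_le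
    (F := fun z (θ : ℝ) => Complex.exp (Complex.I * β * θ) * k (z * Complex.exp (Complex.I * θ)))
    (F' := fun z (θ : ℝ) => Complex.exp (Complex.I * β * θ) *
      (deriv k (z * Complex.exp (Complex.I * θ)) * Complex.exp (Complex.I * θ)))
    (μ := MeasureTheory.volume) (a := 0) (b := 2 * Real.pi) (x₀ := x) (bound := fun _ => B' * B)
    (ball_mem_nhds x hε)
    (by
      filter_upwards [hopen.mem_nhds hx] with z hz using (hcont z hz).aestronglyMeasurable)
    ((hcont x hx).intervalIntegrable _ _) (hcont' x hx).aestronglyMeasurable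
    (Filter.Eventually.of_forall fun θ hθ z hz => by
      rw [uIoc_of_le (by positivity)] at hθ
      have hθ' := Ioc_subset_Icc_self hθ
      rw [norm_mul, norm_mul, hn, mul_one]
      have i1 := hB' θ hθ'
      exact mul_le_mul i1 (hB _ ⟨(z, θ), ⟨ball_subset_closedBall hz, hθ'⟩, rfl⟩) (norm_nonneg _)
        ((norm_nonneg _).trans i1))
    (intervalIntegrable_const) (Filter.Eventually.of_forall fun θ _ z hz => by
      have hz' := hball (ball_subset_closedBall hz)
      have d1 : HasDerivAt (fun z : ℂ => z * Complex.exp (Complex.I * θ))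
          (Complex.exp (Complex.I * θ)) z := by
        simpa using (hasDerivAt_id z).mul_const (Complex.exp (Complex.I * θ))
      have d2 := (hk.differentiableAt (hopen.mem_nhds (hrot z hz' θ))).hasDerivAt
      exact (d2.comp z d1).const_mul _)
  refine h.2.congr_deriv ?_
  have hftc : ∫ θ in (0 : ℝ)..2 * Real.pi, (Complex.I * β * (Complex.exp (Complex.I * β * θ)
        * k (x * Complex.exp (Complex.I * θ))) + Complex.I * x * (Complex.exp (Complex.I * β * θ) *
      (deriv k (x * Complex.exp (Complex.I * θ)) * Complex.exp (Complex.I * θ))))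
      = Complex.exp (Complex.I * β * (2 * Real.pi : ℝ))
          * k (x * Complex.exp (Complex.I * (2 * Real.pi : ℝ)))
        - Complex.exp (Complex.I * β * (0 : ℝ)) * k (x * Complex.exp (Complex.I * (0 : ℝ))) := by
    refine intervalIntegral.integral_eq_sub_of_hasDerivAt (f := fun θ : ℝ =>
      Complex.exp (Complex.I * β * θ) * k (x * Complex.exp (Complex.I * θ))) (fun θ _ => ?_)
      ((Continuous.add ((hcont x hx).const_mul _)
        ((hcont' x hx).const_mul _)).intervalIntegrable _ _)
    have e : HasDerivAt (fun θ : ℝ => (θ : ℂ)) 1 θ := Complex.ofRealCLM.hasDerivAt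
    have e1 := (e.const_mul (Complex.I * β)).cexp
    have e2 := ((e.const_mul Complex.I).cexp).const_mul x
    have d2 := (hk.differentiableAt (hopen.mem_nhds (hrot x hx θ))).hasDerivAt
    refine (e1.mul (d2.comp θ e2)).congr_deriv ?_
    simp only [Function.comp_apply]
    ring
  rw [intervalIntegral.integral_add (((hcont x hx).const_mul _).intervalIntegrable _ _)
    (((hcont' x hx).const_mul _).intervalIntegrable _ _), intervalIntegral.integral_const_mul,
    intervalIntegral.integral_const_mul] at hftc
  have e2pi : Complex.exp (Complex.I * (2 * Real.pi : ℝ)) = 1 := by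
    rw [← Complex.exp_two_pi_mul_I]; congr 1; push_cast; ring
  have e2b : Complex.exp (Complex.I * β * (2 * Real.pi : ℝ))
      = Complex.exp (2 * Real.pi * Complex.I * β) := by congr 1; push_cast; ring
  rw [e2pi, e2b] at hftc
  simp only [Complex.ofReal_zero, mul_zero, Complex.exp_zero, mul_one, one_mul] at hftc
  have hI := Complex.I_ne_zero
  rw [eq_div_iff hx0]
  generalize Complex.exp (2 * Real.pi * Complex.I * β) = Z at hftc ⊢
  generalize (∫ θ in (0 : ℝ)..2 * Real.pi, Complex.exp (Complex.I * β * θ) *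
    (deriv k (x * Complex.exp (Complex.I * θ)) * Complex.exp (Complex.I * θ))) = J₁ at hftc ⊢
  generalize (∫ θ in (0 : ℝ)..2 * Real.pi, Complex.exp (Complex.I * β * θ) *
    k (x * Complex.exp (Complex.I * θ))) = J₀ at hftc ⊢
  field_simp
  linear_combination hftc

/-- With `H' = h`, the function `exp H · f` must satisfy `x F' + β F = x exp(H) g`. Dividing the
circle average of the right-hand side by the nonzero number `exp (2 π i β) - 1` gives a
single-valued solution. Its value at `x` uses `g` only on the circle through `x`, which yields the
estimate in terms of `‖x‖` and the maximum of `g` on that circle. -/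
theorem exists_local_solution {r : ℝ} {β : ℂ} {h g : ℂ → ℂ}
    (hh : DifferentiableOn ℂ h (ball 0 r)) (hg : DifferentiableOn ℂ g (ball 0 r \ {0}))
    (hβ : Complex.exp (2 * Real.pi * Complex.I * β) ≠ 1) :
    ∃ f : ℂ → ℂ, (∀ x ∈ ball (0 : ℂ) r \ {0}, HasDerivAt f (g x - f x * (β / x + h x)) x) ∧
      ∀ r' < r, ∃ C : ℝ, ∀ x ≠ 0, ‖x‖ ≤ r' → ∀ B : ℝ, (∀ z, ‖z‖ = ‖x‖ → ‖g z‖ ≤ B) →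
        ‖f x‖ ≤ C * ‖x‖ * B := by
  obtain ⟨H, hH⟩ := hh.isExactOn_ball
  set E := Complex.exp (2 * Real.pi * Complex.I * β) - 1 with hE
  have hE0 : E ≠ 0 := sub_ne_zero.2 hβ
  let k : ℂ → ℂ := fun x => x * Complex.exp (H x) * g x
  have hHd : DifferentiableOn ℂ H (ball 0 r) := fun x hx =>
    (hH x hx).differentiableAt.differentiableWithinAt
  have hk : DifferentiableOn ℂ k (ball 0 r \ {0}) :=
    (differentiableOn_id.mul (hHd.mono sdiff_subset).cexp).mul hg
  let Φ : ℂ → ℂ := fun x => ∫ θ in (0 : ℝ)..2 * Real.pi,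
        Complex.exp (Complex.I * β * θ) * k (x * Complex.exp (Complex.I * θ))
  refine ⟨fun x => Complex.I / E * (Φ x * Complex.exp (-H x)), fun x hx => ?_, fun r' hr' => ?_⟩
  · have d1 := hasDerivAt_circle_average β hk hx
    have d2 := (hH x hx.1).neg.cexp
    refine ((d1.mul d2).const_mul (Complex.I / E)).congr_deriv ?_
    have hx0 : x ≠ 0 := hx.2
    have e1 : Complex.exp (-H x) = (Complex.exp (H x))⁻¹ := Complex.exp_neg _
    have he := Complex.exp_ne_zero (H x)
    simp only [Pi.neg_apply, e1, ← hE]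
    change Complex.I / E * ((E * (x * Complex.exp (H x) * g x) / Complex.I - β * Φ x) / x * (Complex.exp (H x))⁻¹
      + Φ x * ((Complex.exp (H x))⁻¹ * -h x)) = _
    field_simp
    ring
  · obtain ⟨M, hM⟩ := (isCompact_closedBall (0 : ℂ) r').exists_bound_of_continuousOn
      (hHd.continuousOn.mono (closedBall_subset_ball hr'))
    obtain ⟨B', hB'⟩ := (isCompact_Icc (a := (0 : ℝ)) (b := 2 * Real.pi)).exists_bound_of_continuousOn
      (f := fun θ : ℝ => Complex.exp (Complex.I * β * θ)) (by fun_prop)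
    refine ⟨‖Complex.I / E‖ * (B' * Real.exp M * |2 * Real.pi - 0| * Real.exp M),
      fun x hx0 hxr B hB => ?_⟩
    have hexp : ∀ z : ℂ, ‖z‖ ≤ r' → ‖Complex.exp (H z)‖ ≤ Real.exp M ∧
        ‖Complex.exp (-H z)‖ ≤ Real.exp M := by
      intro z hz
      have := hM z (by simpa using hz)
      constructor <;> refine (Complex.norm_exp_le_exp_norm _).trans (Real.exp_le_exp.2 ?_)
      · exact this
      · rwa [norm_neg]
    have hΦ : ‖Φ x‖ ≤ B' * (‖x‖ * Real.exp M * B) * |2 * Real.pi - 0| := by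
      refine intervalIntegral.norm_integral_le_of_norm_le_const fun θ hθ => ?_
      rw [uIoc_of_le (by positivity)] at hθ
      have hn : ‖x * Complex.exp (Complex.I * θ)‖ = ‖x‖ := by
        rw [norm_mul, mul_comm Complex.I, Complex.norm_exp_ofReal_mul_I, mul_one]
      have i1 := hB' θ (Ioc_subset_Icc_self hθ)
      rw [norm_mul]
      refine mul_le_mul i1 ?_ (norm_nonneg _) ((norm_nonneg _).trans i1)
      simp only [k]
      rw [norm_mul, norm_mul, hn]
      have := (hexp _ (hn.le.trans hxr)).1
      have := hB _ hn
      gcongr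
    rw [norm_mul, norm_mul]
    have := (hexp x hxr).2
    calc _ ≤ ‖Complex.I / E‖ * (B' * (‖x‖ * Real.exp M * B) * |2 * Real.pi - 0| * Real.exp M) := by
          refine mul_le_mul_of_nonneg_left ?_ (norm_nonneg _)
          exact mul_le_mul hΦ this (norm_nonneg _) ((norm_nonneg _).trans hΦ)
      _ = _ := by ring

end LocalSolution

/-! ### Solutions of `∇ m = g dx` outside a compact set -/

section GlobalSolution

open Metric Set

theorem exp_two_pi_mul_I_mul_ne_one {β : ℂ} (h : ∀ n : ℤ, β ≠ n) :
    Complex.exp (2 * Real.pi * Complex.I * β) ≠ 1 := by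
  intro h1
  obtain ⟨n, hn⟩ := Complex.exp_eq_one_iff.1 h1
  refine h n (mul_left_cancel₀ Complex.two_pi_I_ne_zero ?_)
  rw [hn]; ring

theorem exists_solution_at {p : ℂ} {r : ℝ} {β : ℂ} {h g κ : ℂ → ℂ} (hr : 0 < r)
    (hh : DifferentiableOn ℂ h (ball 0 r)) (hg : DifferentiableOn ℂ g (ball p r \ {p}))
    (hκ : ∀ w ∈ ball (0 : ℂ) r \ {0}, κ (p + w) = β / w + h w)
    (hβ : ∀ n : ℤ, β ≠ n) :
    ∃ f : ℂ → ℂ, (∀ x ∈ ball p r \ {p}, HasDerivAt f (g x - f x * κ x) x) ∧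
      ∃ C : ℝ, ∀ x ≠ p, ‖x - p‖ ≤ r / 2 → ∀ B : ℝ, (∀ z, ‖z - p‖ = ‖x - p‖ → ‖g z‖ ≤ B) →
        ‖f x‖ ≤ C * ‖x - p‖ * B := by
  have hg' : DifferentiableOn ℂ (fun w => g (p + w)) (ball 0 r \ {0}) := by
    refine hg.comp (by fun_prop) fun w hw => ?_
    simpa using hw
  obtain ⟨f, hf, hC⟩ := exists_local_solution hh hg' (exp_two_pi_mul_I_mul_ne_one hβ)
  obtain ⟨C, hC⟩ := hC (r / 2) (by linarith)
  refine ⟨fun x => f (x - p), fun x hx => ?_, C, fun x hx hxr B hB => ?_⟩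
  · have hx' : x - p ∈ ball (0 : ℂ) r \ {0} := by
      refine ⟨by simpa [dist_eq_norm] using hx.1, ?_⟩
      simpa [sub_eq_zero] using hx.2
    have h1 := hf (x - p) hx'
    rw [← hκ _ hx', add_sub_cancel] at h1
    simpa using h1.comp_sub_const x p
  · refine hC (x - p) (sub_ne_zero.2 hx) hxr B fun z hz => hB _ ?_
    rwa [add_sub_cancel_left]

/-- This is the local statement in the coordinate `w = 1 / x`, where `g dx` becomes `-g(1/w) w⁻²
dw`. -/
theorem exists_solution_at_infinity {r : ℝ} {β : ℂ} {h g κ : ℂ → ℂ} (hr : 0 < r)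
    (hh : DifferentiableOn ℂ h (ball 0 r)) (hg : DifferentiableOn ℂ g {x | r⁻¹ < ‖x‖})
    (hκ : ∀ w ∈ ball (0 : ℂ) r \ {0}, -(κ w⁻¹ / w ^ 2) = β / w + h w) (hβ : ∀ n : ℤ, β ≠ n) :
    ∃ f : ℂ → ℂ, (∀ x, r⁻¹ < ‖x‖ → HasDerivAt f (g x - f x * κ x) x) ∧
      ∃ C : ℝ, ∀ x, 2 * r⁻¹ ≤ ‖x‖ → ∀ B : ℝ, (∀ z, ‖z‖ = ‖x‖ → ‖g z‖ ≤ B) →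
        ‖f x‖ ≤ C * ‖x‖ * B := by
  have hmem : ∀ w ∈ ball (0 : ℂ) r \ {0}, r⁻¹ < ‖w⁻¹‖ := by
    intro w hw
    rw [norm_inv]
    have h1 : ‖w‖ < r := by simpa using hw.1
    exact (inv_lt_inv₀ hr (norm_pos_iff.2 hw.2)).2 h1
  have hg' : DifferentiableOn ℂ (fun w => -(g w⁻¹ / w ^ 2)) (ball 0 r \ {0}) := by
    have h1 : DifferentiableOn ℂ (fun w => g w⁻¹) (ball 0 r \ {0}) :=
      hg.comp (differentiableOn_inv.mono fun w hw => hw.2) hmem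
    exact (h1.div (by fun_prop) fun w hw => pow_ne_zero 2 hw.2).neg
  obtain ⟨f, hf, hC⟩ := exists_local_solution hh hg' (exp_two_pi_mul_I_mul_ne_one hβ)
  obtain ⟨C, hC⟩ := hC (r / 2) (by linarith)
  have hinv : ∀ x : ℂ, r⁻¹ < ‖x‖ → x ≠ 0 ∧ x⁻¹ ∈ ball (0 : ℂ) r \ {0} := by
    intro x hx
    have hx0 : x ≠ 0 := norm_pos_iff.1 ((inv_pos.2 hr).trans hx)
    refine ⟨hx0, ?_, inv_ne_zero hx0⟩
    rw [mem_ball_zero_iff, norm_inv]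
    exact inv_lt_of_inv_lt₀ hr hx
  refine ⟨fun x => f x⁻¹, fun x hx => ?_, C, fun x hx B hB => ?_⟩
  · obtain ⟨hx0, hx'⟩ := hinv x hx
    have h1 := (hf x⁻¹ hx').comp x (hasDerivAt_inv hx0)
    rw [← hκ _ hx', inv_inv] at h1
    refine h1.congr_deriv ?_
    field_simp
    ring_nf
  · have hpos := inv_pos.2 hr
    obtain ⟨hx0, -⟩ := hinv x (by linarith)
    have hn := norm_pos_iff.2 hx0
    -- The factor `‖x‖ ^ 2` comes from `dx = -w⁻² dw`; combined with `‖x⁻¹‖` it leaves the single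
    -- factor `‖x‖`.
    have h1 := hC x⁻¹ (inv_ne_zero hx0) (by
      rw [norm_inv, inv_le_comm₀ hn (by positivity)]
      calc _ = 2 * r⁻¹ := by rw [inv_div]; rfl
        _ ≤ _ := hx) (‖x‖ ^ 2 * B) (by
      intro z hz
      rw [norm_inv] at hz
      have hz' : ‖z⁻¹‖ = ‖x‖ := by rw [norm_inv, hz, inv_inv]
      rw [norm_neg, norm_div, norm_pow, hz, inv_pow, div_inv_eq_mul, mul_comm]
      exact mul_le_mul_of_nonneg_left (hB _ hz') (by positivity))
    refine h1.trans (le_of_eq ?_)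
    rw [norm_inv]
    field_simp

/-- `m` is bounded, near the puncture `p`, by `‖x - p‖` times the maximum of `g` on the circle
around `p` through `x`. -/
def CircleBound (g m : ℂ → ℂ) (p : ℂ) (l : Filter ℂ) : Prop :=
  ∃ C : ℝ, ∀ᶠ x in l, ∀ B : ℝ, (∀ z, ‖z - p‖ = ‖x - p‖ → ‖g z‖ ≤ B) → ‖m x‖ ≤ C * ‖x - p‖ * B

/-- The residues of the connection at `0`, `1`, `y⁻¹`, `∞` are `b`, `c - b`, `-a`, `a - c`, none of
them an integer. The four local solutions live on disjoint neighbourhoods whose complement is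
compact, so `g dx` is cohomologous to a form supported near that complement. -/
theorem exists_solution_outside_compact {a b c y : ℂ} (hy0 : y ≠ 0) (hy1 : y ≠ 1)
    (habc : Generic a b c) {g : ℂ → ℂ} (hg : DifferentiableOn ℂ g (puncturedPlane y)) :
    ∃ (K : Set ℂ) (m : ℂ → ℂ), K ⊆ puncturedPlane y ∧ IsCompact K ∧
      (∀ z ∈ puncturedPlane y, z ∉ K → HasDerivAt m (g z - m z * logDerivBranch a b c y z) z) ∧
      CircleBound g m 0 (nhdsWithin 0 {0}ᶜ) ∧ CircleBound g m 1 (nhdsWithin 1 {1}ᶜ) ∧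
      CircleBound g m y⁻¹ (nhdsWithin y⁻¹ {y⁻¹}ᶜ) ∧ CircleBound g m 0 (Bornology.cobounded ℂ) := by
  have hyi : 0 < ‖y⁻¹‖ := norm_pos_iff.2 (inv_ne_zero hy0)
  have hyi1 : 0 < ‖1 - y⁻¹‖ := norm_pos_iff.2 (sub_ne_zero.2 fun h => hy1 (inv_eq_one.1 h.symm))
  -- A third of the smallest distance between the finite punctures keeps the three discs disjoint;
  -- the radius `R` below is large enough for the ball of that radius around `0` to contain them.
  let r : ℝ := min 1 (min ‖y⁻¹‖ ‖1 - y⁻¹‖) / 3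
  have hr : 0 < r := by positivity
  have r1 : 3 * r ≤ 1 := by simp only [r]; linarith [min_le_left 1 (min ‖y⁻¹‖ ‖1 - y⁻¹‖)]
  have r2 : 3 * r ≤ ‖y⁻¹‖ := by
    simp only [r]
    linarith [min_le_right 1 (min ‖y⁻¹‖ ‖1 - y⁻¹‖), min_le_left ‖y⁻¹‖ ‖1 - y⁻¹‖]
  have r3 : 3 * r ≤ ‖1 - y⁻¹‖ := by
    simp only [r]
    linarith [min_le_right 1 (min ‖y⁻¹‖ ‖1 - y⁻¹‖), min_le_right ‖y⁻¹‖ ‖1 - y⁻¹‖]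
  let R : ℝ := 2 + ‖y⁻¹‖
  have hR : 0 < R := by positivity
  have mem_iff : ∀ z, z ∈ puncturedPlane y ↔ z ≠ 0 ∧ z ≠ 1 ∧ z ≠ y⁻¹ := by
    intro z; simp [puncturedPlane, not_or]
  have d01 : ∀ z : ℂ, 1 ≤ ‖z‖ + ‖z - 1‖ := fun z => by
    have := norm_sub_le z (z - 1); simpa using this
  have d0y : ∀ z : ℂ, ‖y⁻¹‖ ≤ ‖z‖ + ‖z - y⁻¹‖ := fun z => by
    have := norm_sub_le z (z - y⁻¹); simpa using this
  have d1y : ∀ z : ℂ, ‖1 - y⁻¹‖ ≤ ‖z - 1‖ + ‖z - y⁻¹‖ := fun z => by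
    have := norm_sub_le (z - y⁻¹) (z - 1)
    rw [sub_sub_sub_cancel_left] at this
    linarith
  have dR1 : ∀ z : ℂ, ‖z‖ ≤ 1 + ‖z - 1‖ := fun z => by
    have := norm_add_le 1 (z - 1); simpa using this
  have dRy : ∀ z : ℂ, ‖z‖ ≤ ‖y⁻¹‖ + ‖z - y⁻¹‖ := fun z => by
    have := norm_add_le y⁻¹ (z - y⁻¹); simpa using this
  have sub0 : ball (0 : ℂ) r \ {0} ⊆ puncturedPlane y := by
    rintro z ⟨hz, hz0⟩
    rw [mem_ball_zero_iff] at hz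
    refine (mem_iff z).2 ⟨hz0, ?_, ?_⟩
    · rintro rfl; rw [norm_one] at hz; linarith
    · rintro rfl; linarith
  have sub1 : ball (1 : ℂ) r \ {1} ⊆ puncturedPlane y := by
    rintro z ⟨hz, hz0⟩
    rw [mem_ball, dist_eq_norm] at hz
    refine (mem_iff z).2 ⟨?_, hz0, ?_⟩
    · rintro rfl; simp at hz; linarith
    · rintro rfl; have := d1y y⁻¹; simp at this; linarith
  have sub2 : ball y⁻¹ r \ {y⁻¹} ⊆ puncturedPlane y := by
    rintro z ⟨hz, hz0⟩
    rw [mem_ball, dist_eq_norm] at hz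
    refine (mem_iff z).2 ⟨?_, ?_, hz0⟩
    · rintro rfl; rw [zero_sub, norm_neg] at hz; linarith
    · rintro rfl; linarith
  have sub3 : {x : ℂ | (R⁻¹)⁻¹ < ‖x‖} ⊆ puncturedPlane y := by
    intro z hz
    rw [mem_ofPred_eq, inv_inv] at hz
    refine (mem_iff z).2 ⟨?_, ?_, ?_⟩ <;> rintro rfl
    · rw [norm_zero] at hz; linarith
    · rw [norm_one] at hz; simp only [R] at hz; linarith
    · simp only [R] at hz; linarith
  have ne_of_sub : ∀ {z : ℂ} {p : ℂ}, 0 < ‖z - p‖ → z ≠ p := fun h => sub_ne_zero.1 (norm_pos_iff.1 h)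
  obtain ⟨f0, hf0, C0, hC0⟩ := exists_solution_at (p := 0) (r := r) (β := b) (g := g)
    (h := fun w => -((c - b) / (1 - w)) + a * y / (1 - y * w)) (κ := logDerivBranch a b c y) hr
    (by
      intro w hw
      rw [mem_ball_zero_iff] at hw
      have n1 : 1 - w ≠ 0 := fun h => by
        rw [← sub_eq_zero.1 h, norm_one] at hw; linarith
      have n2 : 1 - y * w ≠ 0 := fun h => by
        rw [← eq_inv_of_mul_eq_one_right (sub_eq_zero.1 h).symm] at r2; linarith
      refine DifferentiableAt.differentiableWithinAt ?_
      fun_prop (disch := assumption)) (hg.mono sub0)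
    (by
      intro w _
      rw [zero_add, logDerivBranch]; ring) (fun n => (habc n).2.1)
  obtain ⟨f1, hf1, C1, hC1⟩ := exists_solution_at (p := 1) (r := r) (β := c - b) (g := g)
    (h := fun w => b / (1 + w) + a * y / (1 - y * (1 + w))) (κ := logDerivBranch a b c y) hr
    (by
      intro w hw
      rw [mem_ball_zero_iff] at hw
      have n1 : 1 + w ≠ 0 := fun h => by
        rw [eq_neg_of_add_eq_zero_right h, norm_neg, norm_one] at hw; linarith
      have n2 : 1 - y * (1 + w) ≠ 0 := fun h => by
        have h1 := eq_inv_of_mul_eq_one_right (sub_eq_zero.1 h).symm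
        have h2 : 1 - y⁻¹ = -w := by rw [← h1]; ring
        rw [h2, norm_neg] at r3; linarith
      refine DifferentiableAt.differentiableWithinAt ?_
      fun_prop (disch := assumption)) (hg.mono sub1)
    (by
      intro w hw
      have hw0 : w ≠ 0 := hw.2
      have : (1 : ℂ) - (1 + w) = -w := by ring
      rw [logDerivBranch, this, div_neg]; ring) (fun n => (habc n).2.2.2.2)
  obtain ⟨f2, hf2, C2, hC2⟩ := exists_solution_at (p := y⁻¹) (r := r) (β := -a) (g := g)
    (h := fun w => b / (y⁻¹ + w) - (c - b) / (1 - (y⁻¹ + w))) (κ := logDerivBranch a b c y) hr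
    (by
      intro w hw
      rw [mem_ball_zero_iff] at hw
      have n1 : y⁻¹ + w ≠ 0 := fun h => by
        rw [eq_neg_of_add_eq_zero_left h, norm_neg] at r2; linarith
      have n2 : 1 - (y⁻¹ + w) ≠ 0 := fun h => by
        have h2 : 1 - y⁻¹ = w := by linear_combination h
        rw [h2] at r3; linarith
      refine DifferentiableAt.differentiableWithinAt ?_
      fun_prop (disch := assumption)) (hg.mono sub2)
    (by
      intro w hw
      have hw0 : w ≠ 0 := hw.2
      have : 1 - y * (y⁻¹ + w) = -(y * w) := by rw [mul_add, mul_inv_cancel₀ hy0]; ring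
      rw [logDerivBranch, this, div_neg, mul_comm a y, mul_div_mul_left _ _ hy0]; ring)
    (fun n h => (habc (-n)).1 (by push_cast; linear_combination -h))
  have hfar : ∀ w ∈ ball (0 : ℂ) R⁻¹, w - 1 ≠ 0 ∧ w - y ≠ 0 := by
    intro w hw
    rw [mem_ball_zero_iff] at hw
    refine ⟨fun h => ?_, fun h => ?_⟩
    · rw [sub_eq_zero.1 h, norm_one, lt_inv_comm₀ one_pos hR] at hw
      simp only [R] at hw
      linarith
    · rw [sub_eq_zero.1 h, lt_inv_comm₀ (norm_pos_iff.2 hy0) hR, ← norm_inv] at hw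
      simp only [R] at hw
      linarith
  obtain ⟨f3, hf3, C3, hC3⟩ := exists_solution_at_infinity (r := R⁻¹) (β := a - c) (g := g)
    (h := fun w => (c - b) / (w - 1) - a / (w - y)) (κ := logDerivBranch a b c y) (inv_pos.2 hR)
    (by
      intro w hw
      obtain ⟨n1, n2⟩ := hfar w hw
      refine DifferentiableAt.differentiableWithinAt ?_
      fun_prop (disch := assumption)) (hg.mono sub3)
    (by
      intro w hw
      obtain ⟨n1, n2⟩ := hfar w hw.1
      have hw0 : w ≠ 0 := hw.2
      have e1 : 1 - w⁻¹ = (w - 1) / w := by field_simp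
      have e2 : 1 - y * w⁻¹ = (w - y) / w := by field_simp
      rw [logDerivBranch, e1, e2]
      field_simp
      ring) (fun n h => (habc (-n)).2.2.2.1 (by push_cast; linear_combination -h))
  classical
  -- The regions are disjoint, so the order of the cases is immaterial. On the compact set the value
  -- of `m` is arbitrary.
  let m : ℂ → ℂ := fun x => if ‖x‖ < r then f0 x else if ‖x - 1‖ < r then f1 x else
    if ‖x - y⁻¹‖ < r then f2 x else f3 x
  have m0 : ∀ x, ‖x‖ < r → m x = f0 x := fun x hx => if_pos hx
  have m1 : ∀ x, ‖x - 1‖ < r → m x = f1 x := fun x hx => by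
    simp only [m]; rw [if_neg (by have := d01 x; linarith), if_pos hx]
  have m2 : ∀ x, ‖x - y⁻¹‖ < r → m x = f2 x := fun x hx => by
    simp only [m]
    rw [if_neg (by have := d0y x; linarith), if_neg (by have := d1y x; linarith), if_pos hx]
  have m3 : ∀ x, R < ‖x‖ → m x = f3 x := fun x hx => by
    simp only [R] at hx
    simp only [m]
    rw [if_neg (by linarith), if_neg (by have := dR1 x; linarith),
      if_neg (by have := dRy x; linarith)]
  have o1 : ∀ p : ℂ, IsOpen {x : ℂ | ‖x - p‖ < r} := fun p => isOpen_lt (by fun_prop) continuous_const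
  refine ⟨{x | ‖x‖ ≤ R ∧ r ≤ ‖x - 0‖ ∧ r ≤ ‖x - 1‖ ∧ r ≤ ‖x - y⁻¹‖}, m, ?_, ?_, ?_, ⟨C0, ?_⟩,
    ⟨C1, ?_⟩, ⟨C2, ?_⟩, ⟨C3, ?_⟩⟩
  · rintro x ⟨-, h0, h1, h2⟩
    exact (mem_iff x).2 ⟨ne_of_sub (hr.trans_le h0), ne_of_sub (hr.trans_le h1),
      ne_of_sub (hr.trans_le h2)⟩
  · refine (isCompact_closedBall (0 : ℂ) R).of_isClosed_subset ?_ fun x hx => by simpa using hx.1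
    simp only [ofPred_and]
    refine IsClosed.inter (isClosed_le ?_ ?_) (IsClosed.inter (isClosed_le ?_ ?_)
      (IsClosed.inter (isClosed_le ?_ ?_) (isClosed_le ?_ ?_)))
    all_goals fun_prop
  · intro z hz hzK
    obtain ⟨z0, z1, z2⟩ := (mem_iff z).1 hz
    by_cases c0 : ‖z - 0‖ < r
    · rw [m0 z (by simpa using c0)]
      refine (hf0 z ⟨by simpa using c0, z0⟩).congr_of_eventuallyEq ?_
      filter_upwards [(o1 0).mem_nhds c0] with x hx using m0 x (by simpa using hx)
    by_cases c1 : ‖z - 1‖ < r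
    · rw [m1 z c1]
      refine (hf1 z ⟨by simpa [dist_eq_norm] using c1, z1⟩).congr_of_eventuallyEq ?_
      filter_upwards [(o1 1).mem_nhds c1] with x hx using m1 x hx
    by_cases c2 : ‖z - y⁻¹‖ < r
    · rw [m2 z c2]
      refine (hf2 z ⟨by simpa [dist_eq_norm] using c2, z2⟩).congr_of_eventuallyEq ?_
      filter_upwards [(o1 _).mem_nhds c2] with x hx using m2 x hx
    have c3 : R < ‖z‖ := by
      by_contra h
      exact hzK ⟨not_lt.1 h, not_lt.1 c0, not_lt.1 c1, not_lt.1 c2⟩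
    rw [m3 z c3]
    refine (hf3 z (by rwa [inv_inv])).congr_of_eventuallyEq ?_
    filter_upwards [(isOpen_lt continuous_const continuous_norm).mem_nhds c3] with x hx using m3 x hx
  · filter_upwards [self_mem_nhdsWithin, mem_nhdsWithin_of_mem_nhds (ball_mem_nhds 0 (half_pos hr))]
      with x hx0 hx B hB
    rw [mem_ball_zero_iff] at hx
    rw [m0 x (by linarith)]
    exact hC0 x hx0 (by simpa using hx.le) B hB
  · filter_upwards [self_mem_nhdsWithin, mem_nhdsWithin_of_mem_nhds (ball_mem_nhds 1 (half_pos hr))]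
      with x hx0 hx B hB
    rw [mem_ball, dist_eq_norm] at hx
    rw [m1 x (by linarith)]
    exact hC1 x hx0 hx.le B hB
  · filter_upwards [self_mem_nhdsWithin, mem_nhdsWithin_of_mem_nhds (ball_mem_nhds y⁻¹ (half_pos hr))]
      with x hx0 hx B hB
    rw [mem_ball, dist_eq_norm] at hx
    rw [m2 x (by linarith)]
    exact hC2 x hx0 hx.le B hB
  · filter_upwards [tendsto_norm_cobounded_atTop.eventually_ge_atTop (2 * R)] with x hx B hB
    rw [m3 x (by linarith), sub_zero]
    exact hC3 x (by rwa [inv_inv]) B (by simpa using hB)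

end GlobalSolution

/-! ### The pairing of a twisted cycle with a form through locally finite homology -/

section CompactSupport

variable {a b c y : ℂ}

/-- The integral of `g dx` over a simplex, corrected by the boundary values of `m`. -/
noncomputable def correctedInt (g m : ℂ → ℂ) (τ : SmoothSimplex y 1) (s : Simplex 1 → ℂ) : ℂ :=
  segInt g τ s - (s (stdSimplex.vertex 1) * m (τ.1 (stdSimplex.vertex 1))
    - s (stdSimplex.vertex 0) * m (τ.1 (stdSimplex.vertex 0)))

theorem correctedInt_add {g : ℂ → ℂ} (hg : ContinuousOn g (puncturedPlane y)) (m : ℂ → ℂ)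
    (τ : SmoothSimplex y 1) {s t : Simplex 1 → ℂ} (hs : Continuous s) (ht : Continuous t) :
    correctedInt g m τ (s + t) = correctedInt g m τ s + correctedInt g m τ t := by
  simp only [correctedInt, segInt_add hg τ hs ht, Pi.add_apply]
  ring

theorem correctedInt_smul (g m : ℂ → ℂ) (τ : SmoothSimplex y 1) (s : Simplex 1 → ℂ)
    (r : QB a b c) : correctedInt g m τ (r • s) = (r : ℂ) * correctedInt g m τ s := by
  have h : ∀ p, (r • s) p = (r : ℂ) * s p := fun p => rfl
  simp only [correctedInt, segInt_smul, h]
  ring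

theorem correctedInt_zero (g m : ℂ → ℂ) (τ : SmoothSimplex y 1) : correctedInt g m τ 0 = 0 := by
  simp [correctedInt, segInt_zero]

/-- The corrected integral vanishes on simplices along which `∇ m = g dx`. -/
theorem correctedInt_eq_zero {g m : ℂ → ℂ} (hg : ContinuousOn g (puncturedPlane y))
    {τ : SmoothSimplex y 1} {s : Simplex 1 → ℂ} (hs : s ∈ sections a b c τ)
    (hm : ∀ p, HasDerivAt m (g (τ.1 p) - m (τ.1 p) * logDerivBranch a b c y (τ.1 p)) (τ.1 p)) :
    correctedInt g m τ s = 0 := by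
  obtain ⟨⟨G, hG, hτ⟩, hU⟩ := id τ.2
  have hF : IsPrim g τ s G (fun q => extendZero s q * m (G q)) := by
    intro p
    have hGp : HasFDerivAt G (fderiv ℝ G p.1) p.1 :=
      ((hG.differentiable (by simp)) p.1).hasFDerivAt
    have h1 := hm p
    rw [hτ] at h1
    have hmG := h1.comp_hasFDerivAt p.1 hGp
    refine ((section_hasFDerivWithinAt hs hG hτ p).mul hmG.hasFDerivWithinAt).congr_fderiv ?_
    ext w
    rw [hτ, extendZero_apply]
    simp only [add_apply, smul_apply, smul_eq_mul, Function.comp_apply]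
    ring
  rw [correctedInt, segInt_eq_sub hg (section_continuous hs) hG hτ hF]
  have hG0 : G (Pi.single 0 1) = τ.1 (stdSimplex.vertex 0) := (hτ (stdSimplex.vertex 0)).symm
  have hG1 : G (Pi.single 1 1) = τ.1 (stdSimplex.vertex 1) := (hτ (stdSimplex.vertex 1)).symm
  have hs0 : extendZero s (Pi.single 0 1) = s (stdSimplex.vertex 0) :=
    extendZero_apply _ (stdSimplex.vertex 0)
  have hs1 : extendZero s (Pi.single 1 1) = s (stdSimplex.vertex 1) :=
    extendZero_apply _ (stdSimplex.vertex 1)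
  simp only [hG0, hG1, hs0, hs1]
  ring

/-- On a `2`-simplex the pulled back form has a primitive `F`. The corrected integral over an edge
is the difference of `F - s m` at its two ends, and these differences cancel around the triangle. No
condition on `m` is needed. -/
theorem correctedInt_faces {g : ℂ → ℂ} (hg : DifferentiableOn ℂ g (puncturedPlane y)) (m : ℂ → ℂ)
    {σ : SmoothSimplex y 2} {s : Simplex 2 → ℂ} (hs : s ∈ sections a b c σ) :
    ∑ i : Fin 3, (-1 : ℂ) ^ (i : ℕ) * correctedInt g m (face i σ) (s ∘ faceMap i) = 0 := by
  obtain ⟨⟨G, hG, hσ⟩, hU⟩ := id σ.2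
  obtain ⟨F, hF⟩ := exists_isPrim hg hs hG hσ
  have hv : ∀ (i : Fin 3) (j : Fin 2), faceMap i (stdSimplex.vertex j : Simplex 1)
      = stdSimplex.vertex (i.succAbove j) := fun i j => stdSimplex.map_vertex _ _
  have key : ∀ i : Fin 3, correctedInt g m (face i σ) (s ∘ faceMap i)
      = (F (Pi.single (i.succAbove 1) 1) - s (stdSimplex.vertex (i.succAbove 1))
          * m (σ.1 (stdSimplex.vertex (i.succAbove 1))))
        - (F (Pi.single (i.succAbove 0) 1) - s (stdSimplex.vertex (i.succAbove 0))
          * m (σ.1 (stdSimplex.vertex (i.succAbove 0)))) := by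
    intro i
    have hl : ∀ j : Fin 2, faceLin i (Pi.single j 1) = Pi.single (i.succAbove j) 1 := fun j =>
      congrArg Subtype.val (hv i j)
    rw [correctedInt, segInt_eq_sub hg.continuousOn (section_continuous (section_face hs i))
      (hG.comp (faceLin i).contDiff) (fun p => hσ (faceMap i p)) (hF.face hG i)]
    simp only [Function.comp_apply, hl, face, hv]
    ring
  rw [Fin.sum_univ_three, key, key, key]
  have e0 : (0 : Fin 3).succAbove 0 = 1 := rfl
  have e1 : (0 : Fin 3).succAbove 1 = 2 := rfl
  have e2 : (1 : Fin 3).succAbove 0 = 0 := rfl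
  have e3 : (1 : Fin 3).succAbove 1 = 2 := rfl
  have e4 : (2 : Fin 3).succAbove 0 = 0 := rfl
  have e5 : (2 : Fin 3).succAbove 1 = 1 := rfl
  rw [e0, e1, e2, e3, e4, e5]
  simp

theorem bdryTerm_mem_sections {n : ℕ} {C : RawChain y (n + 1)}
    (hC : ∀ σ, C σ ∈ sections a b c σ) (τ : SmoothSimplex y n) (σ : SmoothSimplex y (n + 1)) :
    bdryTerm C τ σ ∈ sections a b c τ := by
  refine Submodule.sum_mem _ fun i _ => ?_
  split_ifs with h
  · rw [← h, sign_smul_section (a := a) (b := b) (c := c)]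
    exact Submodule.smul_mem _ _ (section_face (hC σ) i)
  · exact zero_mem _

theorem bdry_mem_sections {n : ℕ} {C : RawChain y (n + 1)}
    (hC : ∀ σ, C σ ∈ sections a b c σ) (τ : SmoothSimplex y n) :
    bdry C τ ∈ sections a b c τ :=
  finsum_induction (fun s => s ∈ sections a b c τ) (zero_mem _) (fun _ _ => add_mem)
    fun σ => bdryTerm_mem_sections hC τ σ

/-- The corrected integral over a finite cycle is its integral. -/
theorem finsum_correctedInt_of_cycle {g : ℂ → ℂ} (m : ℂ → ℂ)
    {C : RawChain y 1} (hC : C ∈ finChains a b c y 1) (hz : bdry C = 0) :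
    ∑ᶠ τ, correctedInt g m τ (C τ) = chainInt g C := by
  let v : Simplex 0 := stdSimplex.vertex 0
  have h := finsum_bdry hC (fun τ s => s v * m (τ.1 v))
    (fun τ s _ t _ => by simp [add_mul]) (fun τ s _ r => by
      rw [← mul_assoc]; rfl)
  rw [hz] at h
  simp only [Pi.zero_apply, zero_mul, finsum_zero] at h
  have hv0 : faceMap (0 : Fin 2) v = stdSimplex.vertex 1 := stdSimplex.map_vertex _ _
  have hv1 : faceMap (1 : Fin 2) v = stdSimplex.vertex 0 := stdSimplex.map_vertex _ _
  have h' : 0 = ∑ᶠ τ : SmoothSimplex y 1,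
      ((-1 : ℂ) ^ ((0 : Fin 2) : ℕ) * (C τ (stdSimplex.vertex 1) * m (τ.1 (stdSimplex.vertex 1)))
        + (-1 : ℂ) ^ ((1 : Fin 2) : ℕ)
          * (C τ (stdSimplex.vertex 0) * m (τ.1 (stdSimplex.vertex 0)))) := by
    refine h.trans (finsum_congr fun τ => (Fin.sum_univ_two _).trans ?_)
    rw [← hv0, ← hv1]
    rfl
  have e : ∀ τ, correctedInt g m τ (C τ) = segInt g τ (C τ)
      - ((-1 : ℂ) ^ ((0 : Fin 2) : ℕ) * (C τ (stdSimplex.vertex 1) * m (τ.1 (stdSimplex.vertex 1)))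
        + (-1 : ℂ) ^ ((1 : Fin 2) : ℕ)
          * (C τ (stdSimplex.vertex 0) * m (τ.1 (stdSimplex.vertex 0)))) := by
    intro τ
    simp [correctedInt]
    ring
  rw [finsum_congr e, finsum_sub_distrib (segInt_support_finite g hC), ← h', sub_zero, chainInt]
  refine hC.2.subset fun τ hτ h0 => hτ ?_
  simp [h0]

/-- Stokes for locally finite chains reduces to the finite part `D'` of simplices meeting `K`. An
edge that meets `K` is a face only of simplices meeting `K`, so it has the same coefficient in both
boundaries. On an edge that misses `K` the corrected integral vanishes for either coefficient. -/
theorem finsum_correctedInt_bdry {g m : ℂ → ℂ} (hg : DifferentiableOn ℂ g (puncturedPlane y))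
    {K : Set ℂ} (hKU : K ⊆ puncturedPlane y) (hK : IsCompact K)
    (hm : ∀ z ∈ puncturedPlane y, z ∉ K → HasDerivAt m (g z - m z * logDerivBranch a b c y z) z)
    {D : RawChain y 2} (hD : D ∈ lfChains a b c y 2) :
    ∑ᶠ τ, correctedInt g m τ (bdry D τ) = 0 := by
  classical
  let D' : RawChain y 2 := fun σ => if ∃ p, σ.1 p ∈ K then D σ else 0
  have hD's : ∀ σ, D' σ ∈ sections a b c σ := fun σ => by
    simp only [D']
    split_ifs
    · exact hD.1 σ
    · exact zero_mem _
  have hD' : D' ∈ finChains a b c y 2 := by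
    refine ⟨hD's, (hD.2 K hKU hK).subset fun σ hσ => ?_⟩
    by_cases h : ∃ p, σ.1 p ∈ K
    · exact ⟨fun h0 => hσ (by simp [D', h0]), h⟩
    · exact absurd (if_neg h) hσ
  have key : ∀ τ, correctedInt g m τ (bdry D τ) = correctedInt g m τ (bdry D' τ) := by
    intro τ
    by_cases hτ : ∃ p, τ.1 p ∈ K
    · have : bdry D τ = bdry D' τ := by
        refine finsum_congr fun σ => ?_
        refine Finset.sum_congr rfl fun i _ => ?_
        split_ifs with h
        · obtain ⟨p, hp⟩ := hτ
          have : ∃ p, σ.1 p ∈ K := ⟨faceMap i p, by rw [← h] at hp; exact hp⟩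
          simp only [D', if_pos this]
        · rfl
      rw [this]
    · push Not at hτ
      have hm' := fun p => hm _ (τ.2.2 p) (hτ p)
      rw [correctedInt_eq_zero hg.continuousOn (bdry_mem_sections hD.1 τ) hm',
        correctedInt_eq_zero hg.continuousOn (bdry_mem_sections hD's τ) hm']
  rw [finsum_congr key, finsum_bdry hD' (fun τ s => correctedInt g m τ s)
    (fun τ s hs t ht => correctedInt_add hg.continuousOn m τ (section_continuous hs)
      (section_continuous ht)) (fun τ s _ r => correctedInt_smul g m τ s r)]
  exact finsum_eq_zero_of_forall_eq_zero fun σ => correctedInt_faces hg m (hD's σ)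

theorem correctedInt_support_finite {g m : ℂ → ℂ} (hg : ContinuousOn g (puncturedPlane y))
    {K : Set ℂ} (hKU : K ⊆ puncturedPlane y) (hK : IsCompact K)
    (hm : ∀ z ∈ puncturedPlane y, z ∉ K → HasDerivAt m (g z - m z * logDerivBranch a b c y z) z)
    {P : RawChain y 1} (hP : P ∈ lfChains a b c y 1) :
    (Function.support fun τ => correctedInt g m τ (P τ)).Finite := by
  refine (hP.2 K hKU hK).subset fun τ hτ => ?_
  refine ⟨fun h0 => hτ ?_, ?_⟩
  · change correctedInt g m τ (P τ) = 0
    rw [h0, correctedInt_zero]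
  · by_contra! h
    exact hτ (correctedInt_eq_zero hg (hP.1 τ) fun p => hm _ (τ.2.2 p) (h p))

/-- If the finite cycle `C` is homologous to the locally finite chain `P`, the integral of `g dx`
over `C` is the corrected integral over `P`. -/
theorem chainInt_eq_finsum_correctedInt {g m : ℂ → ℂ}
    (hg : DifferentiableOn ℂ g (puncturedPlane y))
    {K : Set ℂ} (hKU : K ⊆ puncturedPlane y) (hK : IsCompact K)
    (hm : ∀ z ∈ puncturedPlane y, z ∉ K → HasDerivAt m (g z - m z * logDerivBranch a b c y z) z)
    {C P : RawChain y 1} (hC : C ∈ finChains a b c y 1) (hz : bdry C = 0)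
    (hP : P ∈ lfChains a b c y 1) {D : RawChain y 2} (hD : D ∈ lfChains a b c y 2)
    (hCP : bdry D = C - P) :
    chainInt g C = ∑ᶠ τ, correctedInt g m τ (P τ) := by
  have hClf := finChains_le_lfChains a b c y 1 hC
  have hBlf : bdry D ∈ lfChains a b c y 1 := by rw [hCP]; exact sub_mem hClf hP
  rw [← finsum_correctedInt_of_cycle m hC hz]
  have h : ∀ τ, correctedInt g m τ (C τ)
      = correctedInt g m τ (P τ) + correctedInt g m τ (bdry D τ) := by
    intro τ
    rw [← correctedInt_add hg.continuousOn m τ (section_continuous (hP.1 τ))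
      (section_continuous (hBlf.1 τ)), hCP]
    simp
  rw [finsum_congr h, finsum_add_distrib
    (correctedInt_support_finite hg.continuousOn hKU hK hm hP)
    (correctedInt_support_finite hg.continuousOn hKU hK hm hBlf),
    finsum_correctedInt_bdry hg hKU hK hm hD, add_zero]

end CompactSupport

/-! ### Families of simplices with coefficients -/

section Families

variable {a b c y : ℂ} {ι : Type*} {n : ℕ}

/-- A family of simplices of which only finitely many members meet any given compact set. -/
def LocFin (σ : ι → SmoothSimplex y n) : Prop :=
  ∀ L : Set ℂ, L ⊆ puncturedPlane y → IsCompact L → {i | ∃ p, (σ i).1 p ∈ L}.Finite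

open Classical in
/-- The formal sum `∑ᵢ σᵢ ⊗ sᵢ`. -/
noncomputable def famChain (σ : ι → SmoothSimplex y n) (s : ι → Simplex n → ℂ) : RawChain y n :=
  fun τ => ∑ᶠ i, if σ i = τ then s i else 0

theorem LocFin.finite_fiber {σ : ι → SmoothSimplex y n} (hσ : LocFin σ) (τ : SmoothSimplex y n) :
    {i | σ i = τ}.Finite := by
  have p : Simplex n := Classical.arbitrary _
  refine (hσ {τ.1 p} (by simpa using τ.2.2 p) isCompact_singleton).subset ?_
  rintro i rfl
  exact ⟨p, rfl⟩

theorem LocFin.face {σ : ι → SmoothSimplex y (n + 1)} (hσ : LocFin σ) (k : Fin (n + 2)) :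
    LocFin fun i => face k (σ i) := fun L hL hK =>
  (hσ L hL hK).subset fun _ ⟨p, hp⟩ => ⟨faceMap k p, hp⟩

theorem famChain_support_finite {σ : ι → SmoothSimplex y n} (hσ : LocFin σ)
    (s : ι → Simplex n → ℂ) (τ : SmoothSimplex y n) [DecidablePred fun i => σ i = τ] :
    (Function.support fun i => if σ i = τ then s i else 0).Finite :=
  (hσ.finite_fiber τ).subset fun i hi => by
    by_contra h
    exact hi (if_neg h)

theorem famChain_mem_sections {σ : ι → SmoothSimplex y n} {s : ι → Simplex n → ℂ}
    (hs : ∀ i, s i ∈ sections a b c (σ i)) (τ : SmoothSimplex y n) :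
    famChain σ s τ ∈ sections a b c τ :=
  finsum_induction (fun s => s ∈ sections a b c τ) (zero_mem _) (fun _ _ => add_mem) fun i => by
    split_ifs with h
    · rw [← h]; exact hs i
    · exact zero_mem _

theorem exists_of_famChain_ne_zero {σ : ι → SmoothSimplex y n} {s : ι → Simplex n → ℂ}
    {τ : SmoothSimplex y n} (h : famChain σ s τ ≠ 0) : ∃ i, σ i = τ := by
  by_contra! h0
  exact h (finsum_eq_zero_of_forall_eq_zero fun i => if_neg (h0 i))

theorem famChain_mem_lfChains {σ : ι → SmoothSimplex y n} {s : ι → Simplex n → ℂ}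
    (hσ : LocFin σ) (hs : ∀ i, s i ∈ sections a b c (σ i)) : famChain σ s ∈ lfChains a b c y n := by
  refine ⟨famChain_mem_sections hs, fun L hL hK => ((hσ L hL hK).image σ).subset ?_⟩
  rintro τ ⟨h, hp⟩
  obtain ⟨i, rfl⟩ := exists_of_famChain_ne_zero h
  exact ⟨i, hp, rfl⟩

theorem famChain_mem_finChains [Finite ι] {σ : ι → SmoothSimplex y n} {s : ι → Simplex n → ℂ}
    (hs : ∀ i, s i ∈ sections a b c (σ i)) : famChain σ s ∈ finChains a b c y n := by
  refine ⟨famChain_mem_sections hs, (Set.finite_range σ).subset ?_⟩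
  intro τ h
  exact exists_of_famChain_ne_zero h

/-- Different indices may give the same simplex, so its coefficient is a sum over a fibre. The
boundary can nevertheless be computed member by member, keeping the indexing. -/
theorem bdry_famChain {σ : ι → SmoothSimplex y (n + 1)} {s : ι → Simplex (n + 1) → ℂ}
    (hσ : LocFin σ) :
    bdry (famChain σ s) = ∑ k : Fin (n + 2),
      (-1 : ℂ) ^ (k : ℕ) • famChain (fun i => face k (σ i)) (fun i => s i ∘ faceMap k) := by
  classical
  funext τ
  have p : Simplex n := Classical.arbitrary _
  -- A single point of `τ` suffices: every member having `τ` as a face passes through it, and local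
  -- finiteness leaves finitely many such members.
  set S : Finset ι := (hσ {τ.1 p} (by simpa using τ.2.2 p) isCompact_singleton).toFinset with hS
  have hmem : ∀ i (k : Fin (n + 2)), face k (σ i) = τ → i ∈ S := by
    rintro i k rfl
    rw [hS, Set.Finite.mem_toFinset]
    exact ⟨faceMap k p, rfl⟩
  have hfam : ∀ ρ (k : Fin (n + 2)), face k ρ = τ →
      famChain σ s ρ = ∑ i ∈ S, if σ i = ρ then s i else 0 := by
    intro ρ k hk
    rw [famChain]
    convert finsum_eq_sum_of_support_subset _ ?_
    intro i hi
    have h : σ i = ρ := by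
      by_contra h
      exact hi (if_neg h)
    exact hmem i k (h ▸ hk)
  have hR : ∀ k : Fin (n + 2), famChain (fun i => face k (σ i)) (fun i => s i ∘ faceMap k) τ
      = ∑ i ∈ S, if face k (σ i) = τ then s i ∘ faceMap k else 0 := by
    intro k
    rw [famChain]
    convert finsum_eq_sum_of_support_subset _ ?_
    intro i hi
    refine hmem i k ?_
    by_contra h
    exact hi (if_neg h)
  have hL : bdry (famChain σ s) τ = ∑ ρ ∈ S.image σ, bdryTerm (famChain σ s) τ ρ := by
    refine finsum_eq_sum_of_support_subset _ fun ρ hρ => ?_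
    obtain ⟨k, -, hk⟩ := Finset.exists_ne_zero_of_sum_ne_zero hρ
    by_cases h : face k ρ = τ
    · rw [if_pos h] at hk
      have h0 : famChain σ s ρ ≠ 0 := fun h0 => hk (by rw [h0]; funext q; simp)
      obtain ⟨i, rfl⟩ := exists_of_famChain_ne_zero h0
      simp only [Finset.coe_image, Set.mem_image, Finset.mem_coe]
      exact ⟨i, hmem i k h, rfl⟩
    · exact absurd (if_neg h) hk
  rw [hL, Finset.sum_apply]
  simp only [bdryTerm, Pi.smul_apply, hR]
  rw [Finset.sum_comm]
  refine Finset.sum_congr rfl fun k _ => ?_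
  rw [Finset.smul_sum]
  have e : ∀ ρ ∈ S.image σ, (if face k ρ = τ then (-1 : ℂ) ^ (k : ℕ) • (famChain σ s ρ ∘ faceMap k)
      else 0) = ∑ i ∈ S, if σ i = ρ then (-1 : ℂ) ^ (k : ℕ) •
        (if face k ρ = τ then s i ∘ faceMap k else 0) else 0 := by
    intro ρ _
    split_ifs with h
    · rw [hfam ρ k h]
      funext q
      simp only [Pi.smul_apply, Function.comp_apply, Finset.sum_apply, Finset.smul_sum]
      refine Finset.sum_congr rfl fun i _ => ?_
      split_ifs <;> simp
    · simp
  rw [Finset.sum_congr rfl e, Finset.sum_comm]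
  refine Finset.sum_congr rfl fun i hi => ?_
  rw [Finset.sum_ite_eq, if_pos (Finset.mem_image_of_mem σ hi)]

theorem famChain_apply_of_injective {σ : ι → SmoothSimplex y n} (hσ : Function.Injective σ)
    (s : ι → Simplex n → ℂ) (i : ι) : famChain σ s (σ i) = s i := by
  rw [famChain, finsum_eq_single _ i fun j hj => if_neg fun h => hj (hσ h), if_pos rfl]

/-- Injectivity ensures that each simplex carries the coefficient of one index, so `φ` need not be
additive. -/
theorem finsum_famChain {σ : ι → SmoothSimplex y n} (hσ : Function.Injective σ)
    (s : ι → Simplex n → ℂ) (φ : SmoothSimplex y n → (Simplex n → ℂ) → ℂ) (h0 : ∀ τ, φ τ 0 = 0) :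
    ∑ᶠ τ, φ τ (famChain σ s τ) = ∑ᶠ i, φ (σ i) (s i) := by
  rw [← finsum_congr fun i => congrArg (φ (σ i)) (famChain_apply_of_injective hσ s i),
    ← finsum_mem_range (f := fun τ => φ τ (famChain σ s τ)) hσ]
  classical
  refine finsum_congr fun τ => ?_
  by_cases h : τ ∈ Set.range σ
  · rw [finsum_eq_if, if_pos h]
  · rw [finsum_eq_if, if_neg h]
    have : famChain σ s τ = 0 := by
      by_contra h1
      exact h (exists_of_famChain_ne_zero h1)
    rw [this, h0]

end Families

/-! ### Parametrized pieces of the punctured plane with determinations of the logarithms -/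

section Charts

variable {a b c y : ℂ} {E : Type*} [NormedAddCommGroup E] [NormedSpace ℝ E]

/-- A smooth map from a convex set `Ω` to the punctured plane with continuous determinations of
`log x`, `log (1 - x)` and `log (1 - y x)` along it. -/
structure LogChart (y : ℂ) (E : Type*) [NormedAddCommGroup E] [NormedSpace ℝ E] where
  /-- the domain -/
  Ω : Set E
  convex : Convex ℝ Ω
  /-- the map -/
  X : E → ℂ
  smooth : ContDiff ℝ ∞ X
  mem : ∀ v ∈ Ω, X v ∈ puncturedPlane y
  /-- the logarithm of `x` -/
  l₀ : E → ℂ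
  /-- the logarithm of `1 - x` -/
  l₁ : E → ℂ
  /-- the logarithm of `1 - y x` -/
  l₂ : E → ℂ
  cont₀ : ContinuousOn l₀ Ω
  cont₁ : ContinuousOn l₁ Ω
  cont₂ : ContinuousOn l₂ Ω
  exp₀ : ∀ v ∈ Ω, Complex.exp (l₀ v) = X v
  exp₁ : ∀ v ∈ Ω, Complex.exp (l₁ v) = 1 - X v
  exp₂ : ∀ v ∈ Ω, Complex.exp (l₂ v) = 1 - y * X v

namespace LogChart

variable (κ : LogChart y E) {n : ℕ}

/-- The point of a simplex with given barycentric coordinates. -/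
def bary (V : Fin (n + 1) → κ.Ω) (q : Fin (n + 1) → ℝ) : E := ∑ i, q i • (V i : E)

theorem bary_mem (V : Fin (n + 1) → κ.Ω) (p : Simplex n) : κ.bary V p.1 ∈ κ.Ω :=
  κ.convex.sum_mem (fun i _ => p.2.1 i) p.2.2 fun i _ => (V i).2

/-- The image of the affine simplex with vertices `V`. -/
noncomputable def simplex (V : Fin (n + 1) → κ.Ω) : SmoothSimplex y n :=
  ⟨fun p => κ.X (κ.bary V p.1), ⟨fun q => κ.X (κ.bary V q), κ.smooth.comp (by
    unfold bary; fun_prop), fun _ => rfl⟩, fun p => κ.mem _ (κ.bary_mem V p)⟩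

/-- The branch of `x^b (1 - x)^(c - b) (1 - y x)^(-a)`. -/
noncomputable def branch (a b c : ℂ) (v : E) : ℂ :=
  Complex.exp (b * κ.l₀ v + (c - b) * κ.l₁ v - a * κ.l₂ v)

/-- The branch along an affine simplex. -/
noncomputable def simplexBranch (a b c : ℂ) (V : Fin (n + 1) → κ.Ω) (p : Simplex n) : ℂ :=
  κ.branch a b c (κ.bary V p.1)

theorem simplexBranch_mem (V : Fin (n + 1) → κ.Ω) :
    κ.simplexBranch a b c V ∈ sections a b c (κ.simplex V) := by
  have hb : Continuous fun p : Simplex n => κ.bary V p.1 := by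
    unfold bary
    exact (by fun_prop : Continuous fun q : Fin (n + 1) → ℝ => ∑ i, q i • (V i : E)).comp
      continuous_subtype_val
  exact Submodule.subset_span
    ⟨⟨_, κ.cont₀.comp_continuous hb (κ.bary_mem V)⟩, ⟨_, κ.cont₁.comp_continuous hb (κ.bary_mem V)⟩,
      ⟨_, κ.cont₂.comp_continuous hb (κ.bary_mem V)⟩, fun p => κ.exp₀ _ (κ.bary_mem V p),
      fun p => κ.exp₁ _ (κ.bary_mem V p), fun p => κ.exp₂ _ (κ.bary_mem V p), fun _ => rfl⟩

theorem bary_faceMap (V : Fin (n + 2) → κ.Ω) (i : Fin (n + 2)) (p : Simplex n) :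
    κ.bary V (faceMap i p).1 = κ.bary (V ∘ i.succAbove) p.1 := by
  have h : ∀ j, (faceMap i p).1 j = ∑ k with i.succAbove k = j, p.1 k := fun j =>
    FunOnFinite.linearMap_apply_apply _ _ _ _ _
  simp only [bary, h, Finset.sum_smul, Function.comp_apply]
  rw [← Finset.sum_fiberwise (s := Finset.univ) (g := i.succAbove)
    (f := fun k => p.1 k • (V (i.succAbove k) : E))]
  refine Finset.sum_congr rfl fun j _ => Finset.sum_congr rfl fun k hk => ?_
  rw [(Finset.mem_filter.1 hk).2]

theorem face_simplex (V : Fin (n + 2) → κ.Ω) (i : Fin (n + 2)) :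
    face i (κ.simplex V) = κ.simplex (V ∘ i.succAbove) :=
  Subtype.ext (funext fun p => congrArg κ.X (κ.bary_faceMap V i p))

theorem simplexBranch_faceMap (V : Fin (n + 2) → κ.Ω) (i : Fin (n + 2)) :
    κ.simplexBranch a b c V ∘ faceMap i = κ.simplexBranch a b c (V ∘ i.succAbove) :=
  funext fun p => congrArg (κ.branch a b c) (κ.bary_faceMap V i p)

end LogChart

end Charts

/-! ### Integration along the locally finite chain of a path -/

section Paths

open Filter Topology

variable {a b c y : ℂ}

theorem bary_edge {E : Type*} [NormedAddCommGroup E] [NormedSpace ℝ E] (κ : LogChart y E)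
    (u v : κ.Ω) {p : Simplex 1} : κ.bary ![u, v] p.1 = p.1 0 • (u : E) + p.1 1 • (v : E) := by
  simp only [LogChart.bary]
  rw [Fin.sum_univ_two]
  rfl

/-- A chart along a whole path. -/
structure PathChart (y : ℂ) (γ : ℝ → ℂ) extends LogChart y ℝ where
  full : ∀ v, v ∈ Ω
  path : ∀ v, X v = γ (Real.sigmoid v)

namespace PathChart

variable {γ : ℝ → ℂ} (κ : PathChart y γ)

/-- The pieces of the path. -/
def verts (n : ℤ) : Fin 2 → κ.Ω := ![⟨(n : ℝ), κ.full _⟩, ⟨(n : ℝ) + 1, κ.full _⟩]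

theorem bary_verts (n : ℤ) (p : Simplex 1) : κ.bary (κ.verts n) p.1 = n + p.1 1 := by
  have h : p.1 0 + p.1 1 = 1 := by
    have := p.2.2
    rwa [Fin.sum_univ_two] at this
  rw [verts, bary_edge]
  simp only [smul_eq_mul]
  linear_combination (n : ℝ) * h

theorem pathChain_eq {s : ℝ → ℂ} (hs : ∀ v, κ.branch a b c v = s (Real.sigmoid v))
    (hσ : LocFin fun n => κ.simplex (κ.verts n)) :
    pathChain y γ s = famChain (fun n => κ.simplex (κ.verts n))
      (fun n => κ.simplexBranch a b c (κ.verts n)) := by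
  classical
  funext τ p
  have h1 : famChain (fun n => κ.simplex (κ.verts n))
      (fun n => κ.simplexBranch a b c (κ.verts n)) τ p
      = ∑ᶠ n : ℤ, (if κ.simplex (κ.verts n) = τ then κ.simplexBranch a b c (κ.verts n) else 0) p := by
    rw [famChain]
    convert (Pi.evalAddMonoidHom (fun _ : Simplex 1 => ℂ) p).map_finsum
      (famChain_support_finite hσ (fun n => κ.simplexBranch a b c (κ.verts n)) τ) <;> rfl
  rw [h1, pathChain]
  refine finsum_congr fun n => ?_
  have h2 : κ.simplex (κ.verts n) = τ ↔ ∀ q : Simplex 1, τ.1 q = γ (Real.sigmoid (n + q.1 1)) := by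
    rw [Subtype.ext_iff, funext_iff]
    refine forall_congr' fun q => ?_
    rw [← κ.bary_verts n q, ← κ.path, eq_comm]
    rfl
  by_cases h : κ.simplex (κ.verts n) = τ
  · rw [if_pos h, if_pos (h2.1 h), LogChart.simplexBranch, hs, κ.bary_verts]
  · rw [if_neg h, if_neg fun h' => h (h2.2 h')]; rfl

/-- The starting points `γ (sigmoid n)` of the pieces are already distinct. -/
theorem simplex_injective (hγ : Set.InjOn γ (Set.Ioo 0 1)) :
    Function.Injective fun n => κ.simplex (κ.verts n) := by
  intro m n h
  have h0 := congrFun (congrArg Subtype.val h) (stdSimplex.vertex 0)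
  change κ.X _ = κ.X _ at h0
  have hv : (stdSimplex.vertex 0 : Simplex 1).1 1 = 0 := by
    change (Pi.single 0 1 : Fin 2 → ℝ) 1 = 0
    simp
  rw [κ.bary_verts, κ.bary_verts, κ.path, κ.path, hv] at h0
  have h1 := hγ ⟨Real.sigmoid_pos _, Real.sigmoid_lt_one _⟩
    ⟨Real.sigmoid_pos _, Real.sigmoid_lt_one _⟩ h0
  simpa using Real.sigmoid_injective h1

theorem branch_continuous : Continuous (κ.branch a b c) := by
  have hΩ : κ.Ω = Set.univ := Set.eq_univ_of_forall κ.full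
  have h0 := continuousOn_univ.1 (hΩ ▸ κ.cont₀)
  have h1 := continuousOn_univ.1 (hΩ ▸ κ.cont₁)
  have h2 := continuousOn_univ.1 (hΩ ▸ κ.cont₂)
  unfold LogChart.branch
  fun_prop

/-- The pulled back form. -/
noncomputable def pullback (a b c : ℂ) (g : ℂ → ℂ) (u : ℝ) : ℂ :=
  κ.branch a b c u * g (κ.X u) * deriv κ.X u

theorem pullback_continuous {g : ℂ → ℂ} (hg : ContinuousOn g (puncturedPlane y)) :
    Continuous (κ.pullback a b c g) := by
  refine (κ.branch_continuous.mul ?_).mul (κ.smooth.continuous_deriv (by simp))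
  exact hg.comp_continuous κ.smooth.continuous fun v => κ.mem v (κ.full v)

theorem segInt_verts (g : ℂ → ℂ) (n : ℤ) :
    segInt g (κ.simplex (κ.verts n)) (κ.simplexBranch a b c (κ.verts n))
      = ∫ u in (n : ℝ)..(n : ℝ) + 1, κ.pullback a b c g u := by
  have h : ∫ u in (n : ℝ)..(n : ℝ) + 1, κ.pullback a b c g u
      = ∫ t in (0 : ℝ)..1, κ.pullback a b c g (n + t) := by
    rw [intervalIntegral.integral_comp_add_left]; simp
  rw [h, segInt]
  refine intervalIntegral.integral_congr fun t ht => ?_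
  rw [Set.uIcc_of_le zero_le_one] at ht
  have hb : ∀ u ∈ Set.Icc (0 : ℝ) 1, κ.bary (κ.verts n) (edgePt u).1 = n + u := fun u hu => by
    rw [κ.bary_verts, edgePt_coe hu]; rfl
  have hd : derivWithin (fun u => (κ.simplex (κ.verts n)).1 (edgePt u)) (Set.Icc 0 1) t
      = deriv κ.X (n + t) := by
    have h1 : HasDerivAt (fun u : ℝ => κ.X (n + u)) (deriv κ.X (n + t)) t :=
      ((κ.smooth.differentiable (by simp)) (n + t)).hasDerivAt.comp_const_add (n : ℝ) t
    refine HasDerivWithinAt.derivWithin (h1.hasDerivWithinAt.congr (fun u hu => ?_) ?_)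
      (uniqueDiffOn_Icc_zero_one t ht)
    · exact congrArg κ.X (hb u hu)
    · exact congrArg κ.X (hb t ht)
  simp only [hd, LogChart.simplexBranch, hb t ht]
  have : (κ.simplex (κ.verts n)).1 (edgePt t) = κ.X (n + t) := congrArg κ.X (hb t ht)
  rw [this, pullback]

/-- The primitive of the pulled back form, corrected by `m`. -/
noncomputable def potential (a b c : ℂ) (g m : ℂ → ℂ) (v : ℝ) : ℂ :=
  (∫ u in (0 : ℝ)..v, κ.pullback a b c g u) - κ.branch a b c v * m (κ.X v)

theorem correctedInt_verts {g : ℂ → ℂ} (hg : ContinuousOn g (puncturedPlane y)) (m : ℂ → ℂ)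
    (n : ℤ) :
    correctedInt g m (κ.simplex (κ.verts n)) (κ.simplexBranch a b c (κ.verts n))
      = κ.potential a b c g m ((n + 1 : ℤ) : ℝ) - κ.potential a b c g m n := by
  have hc := κ.pullback_continuous (a := a) (b := b) (c := c) hg
  have h0 : κ.bary (κ.verts n) (stdSimplex.vertex 0 : Simplex 1).1 = n := by
    rw [κ.bary_verts]
    change (n : ℝ) + (Pi.single 0 1 : Fin 2 → ℝ) 1 = n
    simp
  have h1 : κ.bary (κ.verts n) (stdSimplex.vertex 1 : Simplex 1).1 = n + 1 := by
    rw [κ.bary_verts]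
    change (n : ℝ) + (Pi.single 1 1 : Fin 2 → ℝ) 1 = n + 1
    simp
  have e0 : (κ.simplex (κ.verts n)).1 (stdSimplex.vertex 0) = κ.X n := congrArg κ.X h0
  have e1 : (κ.simplex (κ.verts n)).1 (stdSimplex.vertex 1) = κ.X (n + 1) := congrArg κ.X h1
  rw [correctedInt, κ.segInt_verts, LogChart.simplexBranch, LogChart.simplexBranch, h0, h1, e0, e1,
    potential, potential, ← intervalIntegral.integral_add_adjacent_intervals
      (hc.intervalIntegrable 0 (n : ℝ)) (hc.intervalIntegrable (n : ℝ) ((n + 1 : ℤ) : ℝ))]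
  push_cast
  ring

/-- Since only finitely many differences are nonzero, the sum equals that over every large symmetric
window, namely `Q N - Q (-N)`. An eventually constant sequence is thus compared with its limit. -/
theorem finsum_int_telescope {Q : ℤ → ℂ} {A B : ℂ}
    (hfin : (Function.support fun n => Q (n + 1) - Q n).Finite)
    (hA : Tendsto (fun n : ℕ => Q n) atTop (𝓝 A))
    (hB : Tendsto (fun n : ℕ => Q (-n)) atTop (𝓝 B)) :
    ∑ᶠ n : ℤ, (Q (n + 1) - Q n) = A - B := by
  have hlim : Tendsto (fun N : ℕ => Q N - Q (-N)) atTop (𝓝 (A - B)) := hA.sub hB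
  have hsum : ∀ N : ℕ, ∑ n ∈ Finset.Ico (-(N : ℤ)) N, (Q (n + 1) - Q n) = Q N - Q (-N) := by
    intro N
    induction N with
    | zero => simp
    | succ N ih =>
      have : Finset.Ico (-((N + 1 : ℕ) : ℤ)) ((N + 1 : ℕ) : ℤ)
          = insert (-((N : ℤ) + 1)) (insert (N : ℤ) (Finset.Ico (-(N : ℤ)) N)) := by
        ext x; simp only [Finset.mem_Ico, Finset.mem_insert]; push_cast; omega
      rw [this, Finset.sum_insert, Finset.sum_insert, ih]
      · push_cast; ring_nf
      · simp
      · simp only [Finset.mem_insert, Finset.mem_Ico]; omega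
  refine tendsto_nhds_unique (tendsto_const_nhds (f := (atTop : Filter ℕ))) (hlim.congr' ?_)
  obtain ⟨M, hM⟩ : ∃ M : ℕ, ∀ n ∈ hfin.toFinset, n.natAbs < M := by
    obtain ⟨M, hM⟩ := (hfin.toFinset.image Int.natAbs).bddAbove
    exact ⟨M + 1, fun n hn => Nat.lt_succ_of_le (hM (Finset.mem_coe.2 (Finset.mem_image_of_mem _ hn)))⟩
  filter_upwards [eventually_ge_atTop M] with N hN
  rw [← hsum]
  symm
  refine finsum_eq_sum_of_support_subset _ fun n hn => ?_
  have := hM n (hfin.mem_toFinset.2 hn)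
  simp only [Finset.coe_Ico, Set.mem_Ico]
  omega

/-- This is the substitution `t = sigmoid u`, which identifies the integrals over the pieces with
integrals over parts of `(0, 1)`. -/
theorem integral_pullback {γ' : ℝ → ℂ} {s : ℝ → ℂ} (hs : ∀ v, κ.branch a b c v = s (Real.sigmoid v))
    (hγ : ∀ t ∈ Set.Ioo (0 : ℝ) 1, HasDerivAt γ (γ' t) t) (g : ℂ → ℂ) (v : ℝ) :
    ∫ u in (0 : ℝ)..v, κ.pullback a b c g u
      = ∫ t in Real.sigmoid 0..Real.sigmoid v, s t * g (γ t) * γ' t := by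
  rw [← intervalIntegral.integral_deriv_smul_comp_of_deriv_nonneg
    (f' := fun u => Real.sigmoid u * (1 - Real.sigmoid u))]
  · refine intervalIntegral.integral_congr fun u _ => ?_
    have h1 : HasDerivAt κ.X ((Real.sigmoid u * (1 - Real.sigmoid u)) • γ' (Real.sigmoid u)) u := by
      have := (hγ _ ⟨Real.sigmoid_pos u, Real.sigmoid_lt_one u⟩).scomp u (Real.hasDerivAt_sigmoid u)
      exact this.congr_of_eventuallyEq (Eventually.of_forall fun v => κ.path v)
    simp only [pullback, h1.deriv, hs, κ.path, Function.comp_apply, Complex.real_smul]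
    ring
  · exact continuous_sigmoid.continuousOn
  · exact fun u _ => Real.hasDerivAt_sigmoid u
  · intro u _
    exact mul_nonneg (Real.sigmoid_nonneg u) (by linarith [Real.sigmoid_le_one u])

theorem tendsto_sigmoid_nhdsLT : Tendsto Real.sigmoid atTop (𝓝[<] 1) :=
  tendsto_nhdsWithin_iff.2 ⟨Real.tendsto_sigmoid_atTop, Eventually.of_forall Real.sigmoid_lt_one⟩

theorem tendsto_sigmoid_nhdsGT : Tendsto Real.sigmoid atBot (𝓝[>] 0) :=
  tendsto_nhdsWithin_iff.2 ⟨Real.tendsto_sigmoid_atBot, Eventually.of_forall Real.sigmoid_pos⟩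

/-- The integral over a finite cycle which is homologous to the locally finite chain of a path is
the integral along the path, if the latter converges. -/
theorem chainInt_eq_integral {γ' : ℝ → ℂ} {s : ℝ → ℂ}
    (hs : ∀ v, κ.branch a b c v = s (Real.sigmoid v))
    (hγ : ∀ t ∈ Set.Ioo (0 : ℝ) 1, HasDerivAt γ (γ' t) t)
    (hinj : Set.InjOn γ (Set.Ioo 0 1)) (hσ : LocFin fun n => κ.simplex (κ.verts n))
    {g m : ℂ → ℂ} (hg : DifferentiableOn ℂ g (puncturedPlane y))
    (hint : IntervalIntegrable (fun t => s t * g (γ t) * γ' t) MeasureTheory.volume 0 1)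
    {K : Set ℂ} (hKU : K ⊆ puncturedPlane y) (hK : IsCompact K)
    (hm : ∀ z ∈ puncturedPlane y, z ∉ K → HasDerivAt m (g z - m z * logDerivBranch a b c y z) z)
    (h0 : Tendsto (fun t => s t * m (γ t)) (𝓝[>] 0) (𝓝 0))
    (h1 : Tendsto (fun t => s t * m (γ t)) (𝓝[<] 1) (𝓝 0))
    {C : RawChain y 1} (hC : C ∈ finChains a b c y 1) (hz : bdry C = 0)
    {D : RawChain y 2} (hD : D ∈ lfChains a b c y 2) (hCP : bdry D = C - pathChain y γ s) :
    chainInt g C = ∫ t in (0 : ℝ)..1, s t * g (γ t) * γ' t := by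
  have hP : pathChain y γ s ∈ lfChains a b c y 1 := by
    rw [κ.pathChain_eq hs hσ]
    exact famChain_mem_lfChains hσ fun n => κ.simplexBranch_mem _
  rw [chainInt_eq_finsum_correctedInt hg hKU hK hm hC hz hP hD hCP]
  have hfin := correctedInt_support_finite hg.continuousOn hKU hK hm hP
  have hinj' := κ.simplex_injective hinj
  rw [κ.pathChain_eq hs hσ] at hfin ⊢
  rw [finsum_famChain hinj' _ (fun τ s => correctedInt g m τ s) (correctedInt_zero g m)]
  have hterm := fun n => κ.correctedInt_verts (a := a) (b := b) (c := c) hg.continuousOn m n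
  rw [finsum_congr hterm]
  have hfin' : (Function.support fun n : ℤ => κ.potential a b c g m ((n + 1 : ℤ) : ℝ)
      - κ.potential a b c g m n).Finite := by
    refine (hfin.preimage hinj'.injOn).subset fun n hn => ?_
    change correctedInt g m _ (famChain _ _ _) ≠ 0
    have e := famChain_apply_of_injective hinj'
      (fun n => κ.simplexBranch a b c (κ.verts n)) n
    beta_reduce at e
    rw [e, hterm]
    exact hn
  -- Integrability on all of `[0, 1]` makes the primitive continuous up to both endpoints, so the
  -- potential has limits at `±∞`.
  have hprim : ContinuousOn (fun x => ∫ t in Real.sigmoid 0..x, s t * g (γ t) * γ' t)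
      (Set.uIcc 0 1) := by
    refine intervalIntegral.continuousOn_primitive_interval' hint ?_
    rw [Set.uIcc_of_le zero_le_one]
    exact ⟨Real.sigmoid_nonneg _, Real.sigmoid_le_one _⟩
  rw [Set.uIcc_of_le zero_le_one] at hprim
  have hmaps : ∀ v, Real.sigmoid v ∈ Set.Icc (0 : ℝ) 1 := fun v =>
    ⟨Real.sigmoid_nonneg _, Real.sigmoid_le_one _⟩
  have hpot : ∀ v, κ.potential a b c g m v = (∫ t in Real.sigmoid 0..Real.sigmoid v,
      s t * g (γ t) * γ' t) - s (Real.sigmoid v) * m (γ (Real.sigmoid v)) := fun v => by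
    rw [potential, κ.integral_pullback hs hγ, hs, κ.path]
  have hA : Tendsto (κ.potential a b c g m) atTop
      (𝓝 ((∫ t in Real.sigmoid 0..1, s t * g (γ t) * γ' t) - 0)) := by
    rw [funext hpot]
    refine Tendsto.sub ?_ (h1.comp tendsto_sigmoid_nhdsLT)
    exact (hprim 1 (by simp)).tendsto.comp (tendsto_nhdsWithin_iff.2
      ⟨Real.tendsto_sigmoid_atTop, Eventually.of_forall hmaps⟩)
  have hB : Tendsto (κ.potential a b c g m) atBot
      (𝓝 ((∫ t in Real.sigmoid 0..0, s t * g (γ t) * γ' t) - 0)) := by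
    rw [funext hpot]
    refine Tendsto.sub ?_ (h0.comp tendsto_sigmoid_nhdsGT)
    exact (hprim 0 (by simp)).tendsto.comp (tendsto_nhdsWithin_iff.2
      ⟨Real.tendsto_sigmoid_atBot, Eventually.of_forall hmaps⟩)
  have := finsum_int_telescope (Q := fun n => κ.potential a b c g m n) hfin'
    ((hA.comp tendsto_natCast_atTop_atTop).congr fun n => by simp)
    ((hB.comp (tendsto_neg_atTop_atBot.comp tendsto_natCast_atTop_atTop)).congr fun n => by simp)
  rw [this]
  rw [sub_zero, sub_zero, intervalIntegral.integral_symm 0, sub_neg_eq_add, add_comm]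
  have i0 : Real.sigmoid 0 ∈ Set.uIcc (0 : ℝ) 1 := by
    rw [Set.uIcc_of_le zero_le_one]; exact hmaps 0
  exact intervalIntegral.integral_add_adjacent_intervals
    (hint.mono_set (Set.uIcc_subset_uIcc_left i0)) (hint.mono_set (Set.uIcc_subset_uIcc_right i0))

end PathChart

end Paths

/-! ### Closing up the ends of a locally finite path -/

section Ends

open Filter Topology

variable {a b c y : ℂ} {n : ℕ}

theorem famChain_split {ι α β : Type*} {σ : ι → SmoothSimplex y n} (hσ : LocFin σ)
    (s : ι → Simplex n → ℂ) {f : α → ι} {g : β → ι} (hf : Function.Injective f)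
    (hg : Function.Injective g) (hfg : IsCompl (Set.range f) (Set.range g)) :
    famChain σ s = famChain (fun i => σ (f i)) (fun i => s (f i))
      + famChain (fun i => σ (g i)) (fun i => s (g i)) := by
  classical
  funext τ
  have hfin := famChain_support_finite hσ s τ
  have h : famChain σ s τ = ∑ᶠ i ∈ Set.range f ∪ Set.range g, if σ i = τ then s i else 0 := by
    have hu : Set.range f ∪ Set.range g = Set.univ := hfg.sup_eq_top
    rw [hu, finsum_mem_univ, famChain]
  rw [h, finsum_mem_union' hfg.disjoint (hfin.inter_of_right _) (hfin.inter_of_right _),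
    finsum_mem_range hf, finsum_mem_range hg, Pi.add_apply, famChain, famChain]

theorem famChain_reindex {ι α : Type*} (σ : ι → SmoothSimplex y n) (s : ι → Simplex n → ℂ)
    (e : α ≃ ι) : famChain (fun i => σ (e i)) (fun i => s (e i)) = famChain σ s := by
  classical
  funext τ
  exact finsum_comp_equiv e (f := fun i => if σ i = τ then s i else 0)

theorem famChain_smul {ι : Type*} (σ : ι → SmoothSimplex y n) (s : ι → Simplex n → ℂ) (r : ℂ) :
    famChain σ (fun i => r • s i) = r • famChain σ s := by
  classical
  funext τ
  rw [Pi.smul_apply, famChain, famChain, smul_finsum]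
  refine finsum_congr fun i => ?_
  split_ifs
  · rfl
  · rw [smul_zero]

theorem famChain_nat {σ : ℕ → SmoothSimplex y n} (hσ : LocFin σ) (s : ℕ → Simplex n → ℂ) :
    famChain σ s = famChain (fun _ : Unit => σ 0) (fun _ => s 0)
      + famChain (fun k => σ (k + 1)) (fun k => s (k + 1)) := by
  refine famChain_split hσ s (f := fun _ : Unit => 0) (g := fun k => k + 1)
    (fun _ _ _ => rfl) (fun _ _ h => Nat.succ_injective h) ⟨?_, ?_⟩
  · rw [Set.disjoint_iff_forall_ne]
    rintro _ ⟨_, rfl⟩ _ ⟨k, rfl⟩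
    exact (Nat.succ_ne_zero k).symm
  · rw [codisjoint_iff_le_sup]
    intro k _
    rcases k with - | k
    · exact Or.inl ⟨(), rfl⟩
    · exact Or.inr ⟨k, rfl⟩

theorem LocFin.comp {ι α : Type*} {σ : ι → SmoothSimplex y n} (hσ : LocFin σ) {f : α → ι}
    (hf : Function.Injective f) : LocFin fun i => σ (f i) := fun L hL hK =>
  Set.Finite.preimage (f := f) hf.injOn (hσ L hL hK)

theorem bdry_mem_lfChains {C : RawChain y (n + 1)} (hC : C ∈ lfChains a b c y (n + 1)) :
    bdry C ∈ lfChains a b c y n := by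
  refine ⟨fun τ => bdry_mem_sections hC.1 τ, fun L hL hK => ?_⟩
  refine ((hC.2 L hL hK).biUnion fun σ _ => Set.finite_range fun i => face i σ).subset ?_
  rintro τ ⟨h, p, hp⟩
  have hσ : ∃ σ, bdryTerm C τ σ ≠ 0 := by
    by_contra! h0
    exact h (finsum_eq_zero_of_forall_eq_zero h0)
  obtain ⟨σ, hσ⟩ := hσ
  obtain ⟨i, -, hi⟩ := Finset.exists_ne_zero_of_sum_ne_zero hσ
  by_cases hτ : face i σ = τ
  · rw [if_pos hτ] at hi
    refine Set.mem_biUnion (x := σ) ⟨fun h0 => hi (by rw [h0]; funext q; simp),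
      faceMap i p, ?_⟩ ⟨i, hτ⟩
    rw [← hτ] at hp
    exact hp
  · exact absurd (if_neg hτ) hi

theorem bdry_sub {C D : RawChain y (n + 1)} (hC : C ∈ lfChains a b c y (n + 1))
    (hD : D ∈ lfChains a b c y (n + 1)) : bdry (C - D) = bdry C - bdry D := by
  have := bdry_add (sub_mem hC hD) hD
  rw [sub_add_cancel] at this
  rw [this, add_sub_cancel_right]

/-- The boundary of a locally finite family of edges. -/
theorem bdry_famChain_one {ι : Type*} {σ : ι → SmoothSimplex y 1} {s : ι → Simplex 1 → ℂ}
    (hσ : LocFin σ) :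
    bdry (famChain σ s) = famChain (fun i => face 0 (σ i)) (fun i => s i ∘ faceMap 0)
      - famChain (fun i => face 1 (σ i)) (fun i => s i ∘ faceMap 1) := by
  refine (bdry_famChain hσ).trans ((Fin.sum_univ_two _).trans ?_)
  simp [sub_eq_add_neg]

theorem bdry_famChain_two {ι : Type*} {σ : ι → SmoothSimplex y 2} {s : ι → Simplex 2 → ℂ}
    (hσ : LocFin σ) :
    bdry (famChain σ s) = famChain (fun i => face 0 (σ i)) (fun i => s i ∘ faceMap 0)
      - famChain (fun i => face 1 (σ i)) (fun i => s i ∘ faceMap 1)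
      + famChain (fun i => face 2 (σ i)) (fun i => s i ∘ faceMap 2) := by
  refine (bdry_famChain hσ).trans ((Fin.sum_univ_three _).trans ?_)
  simp [sub_eq_add_neg]

/-! ### Chains of affine simplices in a single chart, and their boundaries. -/

namespace LogChart

variable {E : Type*} [NormedAddCommGroup E] [NormedSpace ℝ E] (κ : LogChart y E)

/-- The chain of a family of affine simplices with the branch of the chart. -/
noncomputable def chain {ι : Type*} (a b c : ℂ) (V : ι → Fin (n + 1) → κ.Ω) : RawChain y n :=
  famChain (fun i => κ.simplex (V i)) (fun i => κ.simplexBranch a b c (V i))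

theorem chain_mem_lf {ι : Type*} {V : ι → Fin (n + 1) → κ.Ω}
    (h : LocFin fun i => κ.simplex (V i)) : κ.chain a b c V ∈ lfChains a b c y n :=
  famChain_mem_lfChains h fun _ => κ.simplexBranch_mem _

theorem chain_mem_fin {ι : Type*} [Finite ι] (V : ι → Fin (n + 1) → κ.Ω) :
    κ.chain a b c V ∈ finChains a b c y n :=
  famChain_mem_finChains fun _ => κ.simplexBranch_mem _

theorem bdry_chain_one {ι : Type*} {V W : ι → κ.Ω} (h : LocFin fun i => κ.simplex ![V i, W i]) :
    bdry (κ.chain a b c fun i => ![V i, W i])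
      = κ.chain a b c (fun i => ![W i]) - κ.chain a b c (fun i => ![V i]) := by
  have f0 : ∀ V W : κ.Ω, (![V, W] : Fin 2 → κ.Ω) ∘ (0 : Fin 2).succAbove = ![W] := fun V W => by
    funext i; fin_cases i; rfl
  have f1 : ∀ V W : κ.Ω, (![V, W] : Fin 2 → κ.Ω) ∘ (1 : Fin 2).succAbove = ![V] := fun V W => by
    funext i; fin_cases i; rfl
  rw [chain, bdry_famChain_one h]
  simp only [face_simplex, simplexBranch_faceMap, f0, f1, chain]

theorem bdry_chain_two {ι : Type*} {U V W : ι → κ.Ω}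
    (h : LocFin fun i => κ.simplex ![U i, V i, W i]) :
    bdry (κ.chain a b c fun i => ![U i, V i, W i])
      = κ.chain a b c (fun i => ![V i, W i]) - κ.chain a b c (fun i => ![U i, W i])
        + κ.chain a b c (fun i => ![U i, V i]) := by
  have f0 : ∀ U V W : κ.Ω, (![U, V, W] : Fin 3 → κ.Ω) ∘ (0 : Fin 3).succAbove = ![V, W] :=
    fun U V W => by funext i; fin_cases i <;> rfl
  have f1 : ∀ U V W : κ.Ω, (![U, V, W] : Fin 3 → κ.Ω) ∘ (1 : Fin 3).succAbove = ![U, W] :=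
    fun U V W => by funext i; fin_cases i <;> rfl
  have f2 : ∀ U V W : κ.Ω, (![U, V, W] : Fin 3 → κ.Ω) ∘ (2 : Fin 3).succAbove = ![U, V] :=
    fun U V W => by funext i; fin_cases i <;> rfl
  rw [chain, bdry_famChain_two h]
  simp only [face_simplex, simplexBranch_faceMap, f0, f1, f2, chain]

/-- The identity `∂∂ = 0` is needed only for families of triangles in one chart, where the vertex
chains cancel in pairs. -/
theorem bdry_bdry_chain {ι : Type*} {U V W : ι → κ.Ω}
    (h : LocFin fun i => κ.simplex ![U i, V i, W i]) :
    bdry (bdry (κ.chain a b c fun i => ![U i, V i, W i])) = 0 := by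
  have f0 : ∀ U V W : κ.Ω, (![U, V, W] : Fin 3 → κ.Ω) ∘ (0 : Fin 3).succAbove = ![V, W] :=
    fun U V W => by funext i; fin_cases i <;> rfl
  have f1 : ∀ U V W : κ.Ω, (![U, V, W] : Fin 3 → κ.Ω) ∘ (1 : Fin 3).succAbove = ![U, W] :=
    fun U V W => by funext i; fin_cases i <;> rfl
  have f2 : ∀ U V W : κ.Ω, (![U, V, W] : Fin 3 → κ.Ω) ∘ (2 : Fin 3).succAbove = ![U, V] :=
    fun U V W => by funext i; fin_cases i <;> rfl
  have h0 : LocFin fun i => κ.simplex ![V i, W i] := by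
    simpa only [face_simplex, f0] using h.face 0
  have h1 : LocFin fun i => κ.simplex ![U i, W i] := by
    simpa only [face_simplex, f1] using h.face 1
  have h2 : LocFin fun i => κ.simplex ![U i, V i] := by
    simpa only [face_simplex, f2] using h.face 2
  have m0 := κ.chain_mem_lf (a := a) (b := b) (c := c) h0
  have m1 := κ.chain_mem_lf (a := a) (b := b) (c := c) h1
  have m2 := κ.chain_mem_lf (a := a) (b := b) (c := c) h2
  rw [κ.bdry_chain_two h, bdry_add (sub_mem m0 m1) m2, bdry_sub m0 m1, κ.bdry_chain_one h0,
    κ.bdry_chain_one h1, κ.bdry_chain_one h2]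
  abel

end LogChart

/-- A half cylinder around an end of a path (the end `t → 1` for `ε = 1`, the end `t → 0` for
`ε = -1`), swept out by turning the path around a puncture: on the half plane `T ≤ u`, the variable
`u` is a coordinate along the path, the second variable is the angle. -/
structure EndChart {γ : ℝ → ℂ} (κ : PathChart y γ) (ε : ℝ) extends LogChart y (ℝ × ℝ) where
  /-- the cylinder contains the half plane `T ≤ u` -/
  T : ℝ
  dom : ∀ v : ℝ × ℝ, T ≤ v.1 → v ∈ Ω
  /-- the winding numbers -/
  e₀ : ℤ
  /-- the winding numbers -/
  e₁ : ℤ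
  /-- the winding numbers -/
  e₂ : ℤ
  start₀ : ∀ u, T ≤ u → l₀ (u, 0) = κ.l₀ (ε * u)
  start₁ : ∀ u, T ≤ u → l₁ (u, 0) = κ.l₁ (ε * u)
  start₂ : ∀ u, T ≤ u → l₂ (u, 0) = κ.l₂ (ε * u)
  turn₀ : ∀ u, T ≤ u → l₀ (u, 2 * Real.pi) = l₀ (u, 0) + 2 * Real.pi * Complex.I * e₀
  turn₁ : ∀ u, T ≤ u → l₁ (u, 2 * Real.pi) = l₁ (u, 0) + 2 * Real.pi * Complex.I * e₁
  turn₂ : ∀ u, T ≤ u → l₂ (u, 2 * Real.pi) = l₂ (u, 0) + 2 * Real.pi * Complex.I * e₂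
  proper : ∀ L ⊆ puncturedPlane y, IsCompact L → ∃ M : ℝ, ∀ v : ℝ × ℝ, M ≤ v.1 → X v ∉ L

/-! ### Half cylinders around an end: seams, loops and boundary. -/

namespace EndChart

variable {γ : ℝ → ℂ} {κ : PathChart y γ} {ε : ℝ} (η : EndChart κ ε)

/-- The monodromy around the end. -/
noncomputable def monodromy (a b c : ℂ) : ℂ :=
  Complex.exp (2 * Real.pi * Complex.I * (b * η.e₀ + (c - b) * η.e₁ - a * η.e₂))

theorem X_zero {u : ℝ} (hu : η.T ≤ u) : η.X (u, 0) = κ.X (ε * u) := by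
  rw [← η.exp₀ _ (η.dom _ hu), η.start₀ u hu, κ.exp₀ _ (κ.full _)]

theorem X_turn {u : ℝ} (hu : η.T ≤ u) : η.X (u, 2 * Real.pi) = κ.X (ε * u) := by
  rw [← η.X_zero hu, ← η.exp₀ _ (η.dom _ hu), ← η.exp₀ _ (η.dom _ hu), η.turn₀ u hu,
    Complex.exp_add, mul_comm _ (η.e₀ : ℂ), Complex.exp_int_mul_two_pi_mul_I, mul_one]

theorem branch_zero {u : ℝ} (hu : η.T ≤ u) : η.branch a b c (u, 0) = κ.branch a b c (ε * u) := by
  rw [LogChart.branch, LogChart.branch, η.start₀ u hu, η.start₁ u hu, η.start₂ u hu]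

theorem branch_turn {u : ℝ} (hu : η.T ≤ u) :
    η.branch a b c (u, 2 * Real.pi) = η.monodromy a b c * κ.branch a b c (ε * u) := by
  rw [← η.branch_zero hu, LogChart.branch, LogChart.branch, η.turn₀ u hu, η.turn₁ u hu,
    η.turn₂ u hu, monodromy, ← Complex.exp_add]
  congr 1
  ring

/-- The point of the cylinder with given coordinates. -/
def pt (u : {u : ℝ // η.T ≤ u}) (θ : ℝ) : η.Ω := ⟨(u.1, θ), η.dom _ u.2⟩

/-- The coordinate along the end is affine, so a simplex whose vertices lie beyond `M` lies entirely
beyond `M`, hence outside any given compact set for large index. -/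
theorem locFin {m : ℕ} {V : ℕ → Fin (m + 1) → η.Ω}
    (h : ∀ M : ℝ, ∀ᶠ k in atTop, ∀ i, M ≤ (V k i).1.1) : LocFin fun k => η.simplex (V k) := by
  intro L hL hK
  obtain ⟨M, hM⟩ := η.proper L hL hK
  obtain ⟨k₀, hk₀⟩ := eventually_atTop.1 (h M)
  refine (Set.finite_lt_nat k₀).subset ?_
  rintro k ⟨p, hp⟩
  by_contra hk
  refine hM (η.bary (V k) p.1) ?_ hp
  have h1 : (η.bary (V k) p.1).1 = ∑ i, p.1 i * (V k i).1.1 := by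
    simp only [LogChart.bary, Prod.fst_sum, Prod.smul_fst, smul_eq_mul]
  rw [h1]
  calc M = ∑ i, p.1 i * M := by rw [← Finset.sum_mul, p.2.2, one_mul]
    _ ≤ _ := Finset.sum_le_sum fun i _ =>
      mul_le_mul_of_nonneg_left (hk₀ k (not_lt.1 hk) i) (p.2.1 i)

/-- The edge of the path between two points of the end. -/
noncomputable def edge (u v : {u : ℝ // η.T ≤ u}) : Fin 2 → κ.Ω :=
  ![⟨ε * u.1, κ.full _⟩, ⟨ε * v.1, κ.full _⟩]

theorem bary_pt (u v : {u : ℝ // η.T ≤ u}) (θ : ℝ) (p : Simplex 1) :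
    ∃ w, η.T ≤ w ∧ η.bary ![η.pt u θ, η.pt v θ] p.1 = (w, θ) ∧
      κ.bary (η.edge u v) p.1 = ε * w := by
  have h : p.1 0 + p.1 1 = 1 := by
    have := p.2.2
    rwa [Fin.sum_univ_two] at this
  have h0 := p.2.1 0
  have h1 := p.2.1 1
  refine ⟨p.1 0 * u.1 + p.1 1 * v.1, ?_, ?_, ?_⟩
  · calc η.T = p.1 0 * η.T + p.1 1 * η.T := by rw [← add_mul, h, one_mul]
      _ ≤ _ := add_le_add (mul_le_mul_of_nonneg_left u.2 h0) (mul_le_mul_of_nonneg_left v.2 h1)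
  · rw [bary_edge]
    refine Prod.ext ?_ ?_
    · simp [pt]
    · simp only [pt, Prod.snd_add, Prod.smul_snd, smul_eq_mul]
      rw [← add_mul, h, one_mul]
  · rw [edge, bary_edge]
    simp only [smul_eq_mul]
    ring

theorem chain_edge_zero {ι : Type*} (A B : ι → {u : ℝ // η.T ≤ u}) :
    η.chain a b c (fun i => ![η.pt (A i) 0, η.pt (B i) 0])
      = κ.chain a b c (fun i => η.edge (A i) (B i)) := by
  have h1 : ∀ u v, η.simplex ![η.pt u 0, η.pt v 0] = κ.simplex (η.edge u v) := fun u v => by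
    refine Subtype.ext (funext fun p => ?_)
    obtain ⟨w, hw, e1, e2⟩ := η.bary_pt u v 0 p
    change η.X _ = κ.X _
    rw [e1, e2, η.X_zero hw]
  have h2 : ∀ u v, η.simplexBranch a b c ![η.pt u 0, η.pt v 0]
      = κ.simplexBranch a b c (η.edge u v) := fun u v => by
    funext p
    obtain ⟨w, hw, e1, e2⟩ := η.bary_pt u v 0 p
    rw [LogChart.simplexBranch, LogChart.simplexBranch, e1, e2, η.branch_zero hw]
  simp only [LogChart.chain, h1, h2]

/-- The lines `θ = 0` and `θ = 2 π` have the same image. After one turn only the branch has changed,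
by the monodromy. -/
theorem chain_edge_turn {ι : Type*} (A B : ι → {u : ℝ // η.T ≤ u}) :
    η.chain a b c (fun i => ![η.pt (A i) (2 * Real.pi), η.pt (B i) (2 * Real.pi)])
      = η.monodromy a b c • κ.chain a b c (fun i => η.edge (A i) (B i)) := by
  have h1 : ∀ u v, η.simplex ![η.pt u (2 * Real.pi), η.pt v (2 * Real.pi)]
      = κ.simplex (η.edge u v) := fun u v => by
    refine Subtype.ext (funext fun p => ?_)
    obtain ⟨w, hw, e1, e2⟩ := η.bary_pt u v (2 * Real.pi) p
    change η.X _ = κ.X _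
    rw [e1, e2, η.X_turn hw]
  have h2 : ∀ u v, η.simplexBranch a b c ![η.pt u (2 * Real.pi), η.pt v (2 * Real.pi)]
      = η.monodromy a b c • κ.simplexBranch a b c (η.edge u v) := fun u v => by
    funext p
    obtain ⟨w, hw, e1, e2⟩ := η.bary_pt u v (2 * Real.pi) p
    rw [Pi.smul_apply, LogChart.simplexBranch, LogChart.simplexBranch, e1, e2, η.branch_turn hw,
      smul_eq_mul]
  simp only [LogChart.chain, h1, h2, famChain_smul]

/-- The loops around the end. -/
noncomputable def loop {ι : Type*} (a b c : ℂ) (A : ι → {u : ℝ // η.T ≤ u}) : RawChain y 1 :=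
  η.chain a b c fun i => ![η.pt (A i) 0, η.pt (A i) (2 * Real.pi)]

/-- Each rectangle `[A k, B k] × [0, 2 π]` is cut along a diagonal, which cancels in the difference
of the two triangles. The sides `θ = 0` and `θ = 2 π` are the same path segment with opposite signs
and branches differing by the monodromy; the two remaining sides are loops. -/
theorem exists_cylinder {A B : ℕ → {u : ℝ // η.T ≤ u}}
    (hA : Tendsto (fun k => (A k).1) atTop atTop) (hB : Tendsto (fun k => (B k).1) atTop atTop) :
    ∃ D ∈ lfChains a b c y 2, bdry (bdry D) = 0 ∧ bdry D = η.loop a b c B - η.loop a b c A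
      - (η.monodromy a b c - 1) • κ.chain a b c (fun k => η.edge (A k) (B k)) := by
  have hl1 : LocFin fun k => η.simplex ![η.pt (A k) 0, η.pt (B k) 0, η.pt (B k) (2 * Real.pi)] := by
    refine η.locFin fun M => ?_
    filter_upwards [hA.eventually_ge_atTop M, hB.eventually_ge_atTop M] with k h1 h2 i
    fin_cases i <;> assumption
  have hl2 : LocFin fun k =>
      η.simplex ![η.pt (A k) 0, η.pt (A k) (2 * Real.pi), η.pt (B k) (2 * Real.pi)] := by
    refine η.locFin fun M => ?_
    filter_upwards [hA.eventually_ge_atTop M, hB.eventually_ge_atTop M] with k h1 h2 i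
    fin_cases i <;> assumption
  have m1 := η.chain_mem_lf (a := a) (b := b) (c := c) hl1
  have m2 := η.chain_mem_lf (a := a) (b := b) (c := c) hl2
  refine ⟨_, sub_mem m1 m2, ?_, ?_⟩
  · rw [bdry_sub m1 m2, bdry_sub, η.bdry_bdry_chain hl1, η.bdry_bdry_chain hl2, sub_zero]
    · exact bdry_mem_lfChains m1
    · exact bdry_mem_lfChains m2
  · rw [bdry_sub m1 m2, η.bdry_chain_two hl1, η.bdry_chain_two hl2,
      η.chain_edge_zero, η.chain_edge_turn, loop, loop, sub_smul, one_smul]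
    abel

theorem locFin_loop {A : ℕ → {u : ℝ // η.T ≤ u}} (hA : Tendsto (fun k => (A k).1) atTop atTop) :
    LocFin fun k => η.simplex ![η.pt (A k) 0, η.pt (A k) (2 * Real.pi)] := by
  refine η.locFin fun M => ?_
  filter_upwards [hA.eventually_ge_atTop M] with k h1 i
  fin_cases i <;> assumption

/-- Peeling off the first loop makes the infinite sums of loops in `exists_cylinder` telescope, so
that a whole tail is compared with one loop. -/
theorem loop_nat {A : ℕ → {u : ℝ // η.T ≤ u}} (hA : Tendsto (fun k => (A k).1) atTop atTop) :
    η.loop a b c A = η.loop a b c (fun _ : Unit => A 0) + η.loop a b c (fun k => A (k + 1)) :=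
  famChain_nat (η.locFin_loop hA) _

end EndChart

end Ends

/-! ### Lifting a locally finite path to a finite cycle -/

section Lift

open Filter Topology

variable {a b c y : ℂ} {γ : ℝ → ℂ}

/-- Because the winding numbers are integers, the monodromy is a Laurent monomial in the generators
of `QB`. Its difference from one can then be inverted inside the coefficient field. -/
theorem EndChart.monodromy_mem {κ : PathChart y γ} {ε : ℝ} (η : EndChart κ ε) (a b c : ℂ) :
    η.monodromy a b c ∈ QB a b c := by
  have h : η.monodromy a b c = Complex.exp (2 * Real.pi * Complex.I * b) ^ (η.e₀ - η.e₁)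
      * Complex.exp (2 * Real.pi * Complex.I * c) ^ η.e₁
      * Complex.exp (2 * Real.pi * Complex.I * a) ^ (-η.e₂) := by
    rw [EndChart.monodromy, ← Complex.exp_int_mul, ← Complex.exp_int_mul, ← Complex.exp_int_mul,
      ← Complex.exp_add, ← Complex.exp_add]
    congr 1
    push_cast
    ring
  rw [h]
  refine mul_mem (mul_mem ?_ ?_) ?_ <;>
  exact zpow_mem (IntermediateField.subset_adjoin _ _ (by simp)) _

namespace PathChart

variable (κ : PathChart y γ)

theorem locFin_verts (ηp : EndChart κ 1) (ηm : EndChart κ (-1)) :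
    LocFin fun n => κ.simplex (κ.verts n) := by
  intro L hL hK
  obtain ⟨Mp, hMp⟩ := ηp.proper L hL hK
  obtain ⟨Mm, hMm⟩ := ηm.proper L hL hK
  obtain ⟨N, hN⟩ := exists_nat_ge (max (max Mp ηp.T) (max Mm ηm.T))
  simp only [max_le_iff] at hN
  refine (Set.finite_Ioo (-(N : ℤ) - 1) N).subset ?_
  rintro n ⟨p, hp⟩
  change κ.X _ ∈ L at hp
  rw [κ.bary_verts] at hp
  have hp0 := p.2.1 1
  have hp1 : p.1 1 ≤ 1 := by
    have h := p.2.2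
    rw [Fin.sum_univ_two] at h
    linarith [p.2.1 0]
  constructor
  · by_contra h
    have hn : (n : ℝ) ≤ -N - 1 := by exact_mod_cast not_lt.1 h
    have hX := ηm.X_zero (u := -(n + p.1 1)) (by linarith [hN.2.2])
    rw [neg_one_mul, neg_neg] at hX
    rw [← hX] at hp
    exact hMm (_, 0) (by simp only; linarith [hN.2.1]) hp
  · by_contra h
    have hn : (N : ℝ) ≤ n := by exact_mod_cast not_lt.1 h
    have hX := ηp.X_zero (u := n + p.1 1) (by linarith [hN.1.2])
    rw [one_mul] at hX
    rw [← hX] at hp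
    exact hMp (_, 0) (by simp only; linarith [hN.1.1]) hp

/-- The end of the piece `n` is the start of the piece `n + 1`, so the two vertex chains agree after
reindexing `ℤ` by a shift. -/
theorem bdry_path (hσ : LocFin fun n => κ.simplex (κ.verts n)) :
    bdry (κ.chain a b c κ.verts) = 0 := by
  have h := κ.bdry_chain_one (a := a) (b := b) (c := c) (V := fun n : ℤ => ⟨(n : ℝ), κ.full _⟩)
    (W := fun n : ℤ => ⟨(n : ℝ) + 1, κ.full _⟩) hσ
  refine h.trans (sub_eq_zero.2 ?_)
  have h1 := famChain_reindex (fun n : ℤ => κ.simplex (n := 0) ![⟨(n : ℝ), κ.full _⟩])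
    (fun n => κ.simplexBranch a b c ![⟨(n : ℝ), κ.full _⟩]) (Equiv.addRight 1)
  rw [LogChart.chain, LogChart.chain, ← h1]
  simp only [Equiv.coe_addRight, Int.cast_add, Int.cast_one]

theorem exists_split (hσ : LocFin fun n => κ.simplex (κ.verts n)) (N : ℕ) :
    ∃ M ∈ finChains a b c y 1, κ.chain a b c κ.verts = M
      + κ.chain a b c (fun k : ℕ => κ.verts (N + k))
      + κ.chain a b c (fun k : ℕ => κ.verts (-N - 1 - k)) := by
  have h1 := famChain_split hσ (fun n => κ.simplexBranch a b c (κ.verts n))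
    (f := fun k : ℕ => (N : ℤ) + k) (g := (Subtype.val : {n : ℤ // n < N} → ℤ))
    (fun k l h => by simpa using h) Subtype.val_injective (by
      rw [isCompl_iff, Set.disjoint_iff_forall_ne, codisjoint_iff_le_sup]
      constructor
      · rintro _ ⟨k, rfl⟩ _ ⟨⟨n, hn⟩, rfl⟩
        simp only; omega
      · intro n _
        rcases lt_or_ge n N with h | h
        · exact Or.inr ⟨⟨n, h⟩, rfl⟩
        · exact Or.inl ⟨(n - N).toNat, by simp only; omega⟩)
  have h2 := famChain_split (hσ.comp (f := (Subtype.val : {n : ℤ // n < N} → ℤ))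
      Subtype.val_injective) (fun n => κ.simplexBranch a b c (κ.verts n))
    (f := fun k : ℕ => ⟨-(N : ℤ) - 1 - k, by omega⟩)
    (g := fun n : Set.Ico (-N : ℤ) N => ⟨n, n.2.2⟩)
    (fun k l h => by simpa using h) (fun m n h => by simpa [Subtype.ext_iff] using h) (by
      rw [isCompl_iff, Set.disjoint_iff_forall_ne, codisjoint_iff_le_sup]
      constructor
      · rintro _ ⟨k, rfl⟩ _ ⟨⟨n, hn⟩, rfl⟩ h
        have := hn.1
        simp only [Subtype.mk.injEq] at h
        omega
      · rintro ⟨n, hn⟩ _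
        rcases lt_or_ge n (-N) with h | h
        · exact Or.inl ⟨(-N - 1 - n).toNat, Subtype.ext (by simp only; omega)⟩
        · exact Or.inr ⟨⟨n, h, hn⟩, rfl⟩)
  -- The finite part consists of the pieces with `-N ≤ n < N`; the tails start at `N` and at `-N -
  -- 1`.
  refine ⟨_, κ.chain_mem_fin fun n : Set.Ico (-N : ℤ) N => κ.verts n, ?_⟩
  simp only [LogChart.chain]
  rw [h1, h2]
  abel

/-- The path lifts to ordinary homology if the monodromies at its ends are nontrivial. -/
theorem exists_correspondsTo (ηp : EndChart κ 1) (ηm : EndChart κ (-1)) {s : ℝ → ℂ}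
    (hs : ∀ v, κ.branch a b c v = s (Real.sigmoid v)) (hp : ηp.monodromy a b c ≠ 1)
    (hm : ηm.monodromy a b c ≠ 1) :
    ∃ φ : MBdual a b c y, CorrespondsTo φ γ s := by
  have hσ := κ.locFin_verts ηp ηm
  have hP : κ.chain a b c κ.verts ∈ lfChains a b c y 1 := κ.chain_mem_lf hσ
  obtain ⟨N, hN⟩ := exists_nat_ge (max ηp.T ηm.T)
  rw [max_le_iff] at hN
  obtain ⟨M, hM, hsplit⟩ := κ.exists_split (a := a) (b := b) (c := c) hσ N
  let Ap : ℕ → {u : ℝ // ηp.T ≤ u} := fun k => ⟨N + k, le_add_of_le_of_nonneg hN.1 k.cast_nonneg⟩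
  let Am : ℕ → {u : ℝ // ηm.T ≤ u} := fun k => ⟨N + k, le_add_of_le_of_nonneg hN.2 k.cast_nonneg⟩
  have hAp : Tendsto (fun k => (Ap k).1) atTop atTop :=
    tendsto_atTop_add_const_left _ _ tendsto_natCast_atTop_atTop
  have hAm : Tendsto (fun k => (Am k).1) atTop atTop :=
    tendsto_atTop_add_const_left _ _ tendsto_natCast_atTop_atTop
  obtain ⟨Dp, hDp, hDp0, hDpb⟩ := ηp.exists_cylinder (a := a) (b := b) (c := c) hAp
    (hAp.comp (tendsto_add_atTop_nat 1))
  -- At the end `t → 0` the cylinder coordinate is minus the path coordinate, so the edges must run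
  -- from `Am (k + 1)` to `Am k` to follow the orientation of the path.
  obtain ⟨Dm, hDm, hDm0, hDmb⟩ := ηm.exists_cylinder (a := a) (b := b) (c := c)
    (hAm.comp (tendsto_add_atTop_nat 1)) hAm
  have ep : κ.chain a b c (fun k => ηp.edge (Ap k) (Ap (k + 1)))
      = κ.chain a b c (fun k : ℕ => κ.verts (N + k)) := by
    congr 1; funext k i
    fin_cases i <;> refine Subtype.ext ?_ <;> simp [EndChart.edge, verts, Ap]; ring
  have em : κ.chain a b c (fun k => ηm.edge (Am (k + 1)) (Am k))
      = κ.chain a b c (fun k : ℕ => κ.verts (-N - 1 - k)) := by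
    congr 1; funext k i
    fin_cases i <;> refine Subtype.ext ?_ <;> simp [EndChart.edge, verts, Am] <;> ring
  have hlp := ηp.loop_nat (a := a) (b := b) (c := c) hAp
  have hlm := ηm.loop_nat (a := a) (b := b) (c := c) hAm
  change bdry Dp = ηp.loop a b c (fun k => Ap (k + 1)) - _ - _ • κ.chain a b c
    (fun k => ηp.edge (Ap k) (Ap (k + 1))) at hDpb
  change bdry Dm = _ - ηm.loop a b c (fun k => Am (k + 1)) - _ • κ.chain a b c
    (fun k => ηm.edge (Am (k + 1)) (Am k)) at hDmb
  rw [ep, hlp] at hDpb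
  rw [em, hlm] at hDmb
  -- After telescoping, the boundary of each cylinder is a multiple of its first loop minus
  -- `(monodromy - 1)` times the tail. These factors normalize the coefficient of the tail to `-1`.
  let rp : QB a b c := (⟨_, ηp.monodromy_mem a b c⟩ - 1)⁻¹
  let rm : QB a b c := (⟨_, ηm.monodromy_mem a b c⟩ - 1)⁻¹
  have hrp : (rp : ℂ) * (ηp.monodromy a b c - 1) = 1 := inv_mul_cancel₀ (sub_ne_zero.2 hp)
  have hrm : (rm : ℂ) * (ηm.monodromy a b c - 1) = 1 := inv_mul_cancel₀ (sub_ne_zero.2 hm)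
  have hsm : ∀ {n : ℕ} (r : QB a b c) (C : RawChain y n), r • C = (r : ℂ) • C := fun _ _ => rfl
  have hD : rp • Dp + rm • Dm ∈ lfChains a b c y 2 :=
    add_mem (Submodule.smul_mem _ _ hDp) (Submodule.smul_mem _ _ hDm)
  have hb : bdry (rp • Dp + rm • Dm) = rp • bdry Dp + rm • bdry Dm := by
    rw [bdry_add (Submodule.smul_mem _ _ hDp) (Submodule.smul_mem _ _ hDm), bdry_smul hDp,
      bdry_smul hDm]
  have hbb : bdry (bdry (rp • Dp + rm • Dm)) = 0 := by
    have m1 := bdry_mem_lfChains hDp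
    have m2 := bdry_mem_lfChains hDm
    rw [hb, bdry_add (Submodule.smul_mem _ _ m1) (Submodule.smul_mem _ _ m2), bdry_smul m1,
      bdry_smul m2, hDp0, hDm0, smul_zero, smul_zero, add_zero]
  -- The tails are replaced by multiples of loops. The two signs differ because the cylinders are
  -- swept in opposite directions relative to their first loops.
  let C : RawChain y 1 := M - rp • ηp.loop a b c (fun _ : Unit => Ap 0)
    + rm • ηm.loop a b c (fun _ : Unit => Am 0)
  have hC : C ∈ finChains a b c y 1 :=
    add_mem (sub_mem hM (Submodule.smul_mem _ _ (ηp.chain_mem_fin _)))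
      (Submodule.smul_mem _ _ (ηm.chain_mem_fin _))
  have hDC : bdry (rp • Dp + rm • Dm) = C - κ.chain a b c κ.verts := by
    rw [hb, hDpb, hDmb, hsplit]
    simp only [C, smul_sub, smul_add, hsm, smul_smul, hrp, hrm, one_smul]
    abel
  -- The cycle condition needs no computation with loops: `C` differs from the closed path by a
  -- boundary whose own boundary vanishes.
  have hC0 : bdry C = 0 := by
    rw [hDC, bdry_sub (finChains_le_lfChains _ _ _ _ _ hC) hP, κ.bdry_path hσ, sub_zero] at hbb
    exact hbb
  have hPc : pathChain y γ s = κ.chain a b c κ.verts := κ.pathChain_eq hs hσ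
  refine ⟨Submodule.Quotient.mk ⟨C, hC, hC0⟩, by rw [hPc]; exact ⟨hP, κ.bdry_path hσ⟩, ?_⟩
  refine (Submodule.Quotient.eq _).2 ⟨_, hD, ?_⟩
  exact hDC.trans (congrArg (fun P => C - P) hPc.symm)

end PathChart

end Lift

/-! ### The cycles attached to the two paths -/

section Cycles

open Filter Topology

variable {a b c y : ℂ}

theorem mem_puncturedPlane_of_ne {x : ℂ} (h0 : x ≠ 0) (h1 : 1 - x ≠ 0) (h2 : 1 - y * x ≠ 0) :
    x ∈ puncturedPlane y := by
  simp only [puncturedPlane, Set.mem_compl_iff, Set.mem_insert_iff, Set.mem_singleton_iff, not_or]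
  refine ⟨h0, fun h => h1 (by rw [h, sub_self]), fun h => ?_⟩
  -- For `y = 0` the convention `0⁻¹ = 0` merges the third puncture with the first.
  rcases eq_or_ne y 0 with rfl | hy
  · exact h0 (by rw [h, inv_zero])
  · exact h2 (by rw [h, mul_inv_cancel₀ hy, sub_self])

/-- Polar coordinates on a punctured disc. -/
noncomputable def cyl (v : ℝ × ℝ) : ℂ := Real.sigmoid (-v.1) * Complex.exp (v.2 * Complex.I)

theorem norm_cyl (v : ℝ × ℝ) : ‖cyl v‖ = Real.sigmoid (-v.1) := by
  rw [cyl, norm_mul, Complex.norm_exp_ofReal_mul_I, mul_one, Complex.norm_real, Real.norm_eq_abs,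
    abs_of_pos (Real.sigmoid_pos _)]

theorem cyl_ne_zero (v : ℝ × ℝ) : cyl v ≠ 0 :=
  norm_pos_iff.1 (by rw [norm_cyl]; exact Real.sigmoid_pos _)

theorem one_sub_cyl_ne_zero (v : ℝ × ℝ) : 1 - cyl v ≠ 0 := by
  intro h
  have := norm_cyl v
  rw [← sub_eq_zero.1 h, norm_one] at this
  exact (Real.sigmoid_lt_one _).ne' this

theorem contDiff_ofReal_sigmoid : ContDiff ℝ ∞ fun v : ℝ => (Real.sigmoid v : ℂ) :=
  Complex.ofRealCLM.contDiff.comp (contDiff_sigmoid.of_le le_top)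

theorem contDiff_cyl : ContDiff ℝ ∞ cyl := by
  refine ContDiff.mul ?_ ?_
  · exact contDiff_ofReal_sigmoid.comp contDiff_fst.neg
  · exact Complex.contDiff_exp.comp
      ((Complex.ofRealCLM.contDiff.comp contDiff_snd).mul contDiff_const)

theorem cyl_zero (u : ℝ) : cyl (u, 0) = Real.sigmoid (-u) := by simp [cyl]

theorem cyl_turn (u : ℝ) : cyl (u, 2 * Real.pi) = Real.sigmoid (-u) := by simp [cyl]

/-- In polar coordinates `z = cyl v` the logarithm of `z` is the single-valued function `log |z| + i
θ`. If `x`, `1 - x`, `1 - y x` have the form `z^e exp (H z)` near `z = 0`, their logarithms are `e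
log z + H z`, and the exponents `e` are the winding numbers. Data near `z = 0` suffice, since the
cylinder may start at a large `T`. -/
theorem exists_endChart {γ : ℝ → ℂ} (κ : PathChart y γ) {ε : ℝ} (e₀ e₁ e₂ : ℤ)
    {φ H₀ H₁ H₂ : ℂ → ℂ} (hφ : ContDiff ℝ ∞ fun v => φ (cyl v))
    (c₀ : ∀ᶠ z in 𝓝 0, ContinuousAt H₀ z) (c₁ : ∀ᶠ z in 𝓝 0, ContinuousAt H₁ z)
    (c₂ : ∀ᶠ z in 𝓝 0, ContinuousAt H₂ z)
    (x₀ : ∀ᶠ z in 𝓝[≠] 0, z ^ e₀ * Complex.exp (H₀ z) = φ z)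
    (x₁ : ∀ᶠ z in 𝓝[≠] 0, z ^ e₁ * Complex.exp (H₁ z) = 1 - φ z)
    (x₂ : ∀ᶠ z in 𝓝[≠] 0, z ^ e₂ * Complex.exp (H₂ z) = 1 - y * φ z)
    (s₀ : ∀ u : ℝ, e₀ * Complex.log (Real.sigmoid (-u)) + H₀ (Real.sigmoid (-u)) = κ.l₀ (ε * u))
    (s₁ : ∀ u : ℝ, e₁ * Complex.log (Real.sigmoid (-u)) + H₁ (Real.sigmoid (-u)) = κ.l₁ (ε * u))
    (s₂ : ∀ u : ℝ, e₂ * Complex.log (Real.sigmoid (-u)) + H₂ (Real.sigmoid (-u)) = κ.l₂ (ε * u))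
    (proper : ∀ L ⊆ puncturedPlane y, IsCompact L → ∀ᶠ z in 𝓝[≠] 0, φ z ∉ L) :
    ∃ η : EndChart κ ε, η.e₀ = e₀ ∧ η.e₁ = e₁ ∧ η.e₂ = e₂ := by
  have hlim : Tendsto (fun u : ℝ => Real.sigmoid (-u)) atTop (𝓝 0) :=
    Real.tendsto_sigmoid_atBot.comp tendsto_neg_atTop_atBot
  -- `‖cyl v‖` depends only on the first coordinate and tends to zero with it, so a property valid
  -- near the puncture holds on a half plane `T ≤ u`.
  have hcyl : ∀ {p : ℂ → Prop}, (∀ᶠ z in 𝓝[≠] 0, p z) → ∃ T : ℝ, ∀ v : ℝ × ℝ, T ≤ v.1 →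
      p (cyl v) := by
    intro p hp
    rw [eventually_nhdsWithin_iff, Metric.eventually_nhds_iff] at hp
    obtain ⟨δ, hδ, h⟩ := hp
    obtain ⟨T, hT⟩ := eventually_atTop.1 (hlim.eventually_lt_const hδ)
    exact ⟨T, fun v hv => h (by rw [dist_zero_right, norm_cyl]; exact hT _ hv) (cyl_ne_zero v)⟩
  obtain ⟨T, hT⟩ := hcyl (((x₀.and x₁).and x₂).and
    ((c₀.and (c₁.and c₂)).filter_mono nhdsWithin_le_nhds))
  let l : ℤ → (ℂ → ℂ) → ℝ × ℝ → ℂ := fun e H v =>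
    e * (Complex.log (Real.sigmoid (-v.1)) + v.2 * Complex.I) + H (cyl v)
  have hpos : ∀ u : ℝ, (Real.sigmoid u : ℂ) ≠ 0 := fun u =>
    Complex.ofReal_ne_zero.2 (Real.sigmoid_pos u).ne'
  have hexp : ∀ e H v, Complex.exp (l e H v) = cyl v ^ e * Complex.exp (H (cyl v)) := by
    intro e H v
    rw [Complex.exp_add, Complex.exp_int_mul, Complex.exp_add, Complex.exp_log (hpos _), cyl]
  have hcont : ∀ e {H : ℂ → ℂ} {v : ℝ × ℝ}, ContinuousAt H (cyl v) → ContinuousAt (l e H) v := by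
    intro e H v hH
    refine ContinuousAt.add (continuousAt_const.mul (ContinuousAt.add ?_ (by fun_prop)))
      (hH.comp contDiff_cyl.continuous.continuousAt)
    refine ContinuousAt.clog (by fun_prop) ?_
    exact Complex.ofReal_mem_slitPlane.2 (Real.sigmoid_pos _)
  have e0 : ∀ v : ℝ × ℝ, T ≤ v.1 → Complex.exp (l e₀ H₀ v) = φ (cyl v) := fun v hv =>
    (hexp _ _ _).trans (hT v hv).1.1.1
  have e1 : ∀ v : ℝ × ℝ, T ≤ v.1 → Complex.exp (l e₁ H₁ v) = 1 - φ (cyl v) := fun v hv =>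
    (hexp _ _ _).trans (hT v hv).1.1.2
  have e2 : ∀ v : ℝ × ℝ, T ≤ v.1 → Complex.exp (l e₂ H₂ v) = 1 - y * φ (cyl v) := fun v hv =>
    (hexp _ _ _).trans (hT v hv).1.2
  have hstart : ∀ (e : ℤ) H (u : ℝ), l e H (u, 0)
      = e * Complex.log (Real.sigmoid (-u)) + H (Real.sigmoid (-u)) := by
    intro e H u
    simp only [l, cyl_zero, Complex.ofReal_zero, zero_mul, add_zero]
  have hturn : ∀ (e : ℤ) H (u : ℝ),
      l e H (u, 2 * Real.pi) = l e H (u, 0) + 2 * Real.pi * Complex.I * e := by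
    intro e H u
    simp only [l, cyl_zero, cyl_turn, Complex.ofReal_zero, Complex.ofReal_mul, Complex.ofReal_ofNat]
    ring
  exact ⟨{
    Ω := {v | T ≤ v.1}
    convex := (convex_Ici T).linear_preimage (LinearMap.fst ℝ ℝ ℝ)
    X := fun v => φ (cyl v)
    smooth := hφ
    mem := fun v hv => mem_puncturedPlane_of_ne (e0 v hv ▸ Complex.exp_ne_zero _)
      (e1 v hv ▸ Complex.exp_ne_zero _) (e2 v hv ▸ Complex.exp_ne_zero _)
    l₀ := l e₀ H₀
    l₁ := l e₁ H₁
    l₂ := l e₂ H₂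
    cont₀ := fun v hv => (hcont _ (hT v hv).2.1).continuousWithinAt
    cont₁ := fun v hv => (hcont _ (hT v hv).2.2.1).continuousWithinAt
    cont₂ := fun v hv => (hcont _ (hT v hv).2.2.2).continuousWithinAt
    exp₀ := e0
    exp₁ := e1
    exp₂ := e2
    T := T
    dom := fun v hv => hv
    e₀ := e₀
    e₁ := e₁
    e₂ := e₂
    start₀ := fun u _ => (hstart _ _ u).trans (s₀ u)
    start₁ := fun u _ => (hstart _ _ u).trans (s₁ u)
    start₂ := fun u _ => (hstart _ _ u).trans (s₂ u)
    turn₀ := fun u _ => hturn _ _ u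
    turn₁ := fun u _ => hturn _ _ u
    turn₂ := fun u _ => hturn _ _ u
    proper := fun L hL hK => hcyl (proper L hL hK) }, rfl, rfl, rfl⟩

theorem eventually_notMem_of_tendsto {φ : ℂ → ℂ} {p : ℂ} (hφ : Tendsto φ (𝓝[≠] 0) (𝓝 p))
    (hp : p ∉ puncturedPlane y) {L : Set ℂ} (hL : L ⊆ puncturedPlane y) (hK : IsCompact L) :
    ∀ᶠ z in 𝓝[≠] 0, φ z ∉ L :=
  hφ.eventually (hK.isClosed.isOpen_compl.mem_nhds fun h => hp (hL h))

theorem eventually_continuousAt_log {f : ℂ → ℂ} (hf : Continuous f)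
    (h0 : f 0 ∈ Complex.slitPlane) : ∀ᶠ z in 𝓝 0, ContinuousAt (fun z => Complex.log (f z)) z := by
  filter_upwards [hf.continuousAt.eventually (Complex.isOpen_slitPlane.mem_nhds h0)] with z hz
  exact hf.continuousAt.clog hz

theorem eventually_exp_log {f : ℂ → ℂ} (hf : Continuous f) (h0 : f 0 ∈ Complex.slitPlane) :
    ∀ᶠ z in 𝓝[≠] 0, Complex.exp (Complex.log (f z)) = f z ∧ f z ≠ 0 := by
  refine Filter.Eventually.filter_mono nhdsWithin_le_nhds ?_
  filter_upwards [hf.continuousAt.eventually (Complex.isOpen_slitPlane.mem_nhds h0)] with z hz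
  exact ⟨Complex.exp_log (Complex.slitPlane_ne_zero hz), Complex.slitPlane_ne_zero hz⟩

theorem sigmoid_mem_Icc (v : ℝ) : Real.sigmoid v ∈ Set.Icc (0 : ℝ) 1 :=
  ⟨Real.sigmoid_nonneg v, Real.sigmoid_le_one v⟩

theorem ofReal_sigmoid_mem_slitPlane (v : ℝ) : (Real.sigmoid v : ℂ) ∈ Complex.slitPlane :=
  Complex.ofReal_mem_slitPlane.2 (Real.sigmoid_pos v)

theorem one_sub_sigmoid_mem_slitPlane (v : ℝ) :
    1 - (Real.sigmoid v : ℂ) ∈ Complex.slitPlane := by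
  rw [← Complex.ofReal_one, ← Complex.ofReal_sub]
  exact Complex.ofReal_mem_slitPlane.2 (sub_pos.2 (Real.sigmoid_lt_one v))

/-- The chart of the path `p₁`. -/
noncomputable def pathChart1 (hS : ∀ t ∈ Set.Icc (0 : ℝ) 1, 1 - y * t ∈ Complex.slitPlane) :
    PathChart y path1 where
  Ω := Set.univ
  convex := convex_univ
  X v := Real.sigmoid v
  smooth := contDiff_ofReal_sigmoid
  mem v _ := mem_puncturedPlane_of_ne (Complex.slitPlane_ne_zero (ofReal_sigmoid_mem_slitPlane v))
    (Complex.slitPlane_ne_zero (one_sub_sigmoid_mem_slitPlane v))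
    (Complex.slitPlane_ne_zero (hS _ (sigmoid_mem_Icc v)))
  l₀ v := Complex.log (Real.sigmoid v)
  l₁ v := Complex.log (1 - Real.sigmoid v)
  l₂ v := Complex.log (1 - y * Real.sigmoid v)
  cont₀ v _ := (ContinuousAt.clog (f := fun v : ℝ => (Real.sigmoid v : ℂ)) (by fun_prop)
    (ofReal_sigmoid_mem_slitPlane v)).continuousWithinAt
  cont₁ v _ := (ContinuousAt.clog (f := fun v : ℝ => 1 - (Real.sigmoid v : ℂ)) (by fun_prop)
    (one_sub_sigmoid_mem_slitPlane v)).continuousWithinAt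
  cont₂ v _ := (ContinuousAt.clog (f := fun v : ℝ => 1 - y * (Real.sigmoid v : ℂ)) (by fun_prop)
    (hS _ (sigmoid_mem_Icc v))).continuousWithinAt
  exp₀ v _ := Complex.exp_log (Complex.slitPlane_ne_zero (ofReal_sigmoid_mem_slitPlane v))
  exp₁ v _ := Complex.exp_log (Complex.slitPlane_ne_zero (one_sub_sigmoid_mem_slitPlane v))
  exp₂ v _ := Complex.exp_log (Complex.slitPlane_ne_zero (hS _ (sigmoid_mem_Icc v)))
  full _ := trivial
  path _ := rfl

theorem path2_mul {y : ℂ} (hy0 : y ≠ 0) {t : ℝ} (ht : t ≠ 0) : path2 y t * (y * t) = 1 :=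
  one_div_mul_cancel (mul_ne_zero hy0 (Complex.ofReal_ne_zero.2 ht))

/-- The chart of the path `p₂`. -/
noncomputable def pathChart2 (hS : ∀ t ∈ Set.Icc (0 : ℝ) 1, 1 - y * t ∈ Complex.slitPlane)
    {ly lm : ℂ} (hly : Complex.exp ly = y) (hlm : Complex.exp lm = -1) :
    PathChart y (path2 y) where
  Ω := Set.univ
  convex := convex_univ
  X v := path2 y (Real.sigmoid v)
  smooth := by
    simp only [path2, one_div]
    refine (contDiff_const.mul contDiff_ofReal_sigmoid).inv fun v => ?_
    exact mul_ne_zero (hly ▸ Complex.exp_ne_zero _)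
      (Complex.slitPlane_ne_zero (ofReal_sigmoid_mem_slitPlane v))
  mem v _ := by
    have hy0 : y ≠ 0 := hly ▸ Complex.exp_ne_zero _
    have ht := Complex.slitPlane_ne_zero (ofReal_sigmoid_mem_slitPlane v)
    have h1 := Complex.slitPlane_ne_zero (one_sub_sigmoid_mem_slitPlane v)
    have h2 := Complex.slitPlane_ne_zero (hS _ (sigmoid_mem_Icc v))
    have hx := path2_mul hy0 (Real.sigmoid_pos v).ne'
    refine mem_puncturedPlane_of_ne (left_ne_zero_of_mul_eq_one hx) (fun h => h2 ?_) fun h => h1 ?_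
    · linear_combination (-y * Real.sigmoid v) * h - hx
    · linear_combination (-(Real.sigmoid v : ℂ)) * h - hx
  l₀ v := -ly - Complex.log (Real.sigmoid v)
  l₁ v := lm + Complex.log (1 - y * Real.sigmoid v) - ly - Complex.log (Real.sigmoid v)
  l₂ v := lm + Complex.log (1 - Real.sigmoid v) - Complex.log (Real.sigmoid v)
  cont₀ v _ := by
    have h0 : ContinuousAt (fun v : ℝ => Complex.log (Real.sigmoid v)) v :=
      ContinuousAt.clog (by fun_prop) (ofReal_sigmoid_mem_slitPlane v)
    exact ContinuousAt.continuousWithinAt (by fun_prop)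
  cont₁ v _ := by
    have h0 : ContinuousAt (fun v : ℝ => Complex.log (Real.sigmoid v)) v :=
      ContinuousAt.clog (by fun_prop) (ofReal_sigmoid_mem_slitPlane v)
    have h1 : ContinuousAt (fun v : ℝ => Complex.log (1 - y * Real.sigmoid v)) v :=
      ContinuousAt.clog (by fun_prop) (hS _ (sigmoid_mem_Icc v))
    exact ContinuousAt.continuousWithinAt (by fun_prop)
  cont₂ v _ := by
    have h0 : ContinuousAt (fun v : ℝ => Complex.log (Real.sigmoid v)) v :=
      ContinuousAt.clog (by fun_prop) (ofReal_sigmoid_mem_slitPlane v)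
    have h1 : ContinuousAt (fun v : ℝ => Complex.log (1 - Real.sigmoid v)) v :=
      ContinuousAt.clog (by fun_prop) (one_sub_sigmoid_mem_slitPlane v)
    exact ContinuousAt.continuousWithinAt (by fun_prop)
  exp₀ v _ := by
    have ht := Complex.slitPlane_ne_zero (ofReal_sigmoid_mem_slitPlane v)
    have hy0 : y ≠ 0 := hly ▸ Complex.exp_ne_zero _
    rw [Complex.exp_sub, Complex.exp_neg, Complex.exp_log ht, hly, path2]
    field_simp
  exp₁ v _ := by
    have ht := Complex.slitPlane_ne_zero (ofReal_sigmoid_mem_slitPlane v)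
    have hy0 : y ≠ 0 := hly ▸ Complex.exp_ne_zero _
    rw [Complex.exp_sub, Complex.exp_sub, Complex.exp_add, Complex.exp_log ht, hly, hlm,
      Complex.exp_log (Complex.slitPlane_ne_zero (hS _ (sigmoid_mem_Icc v))), path2]
    field_simp
    ring
  exp₂ v _ := by
    have ht := Complex.slitPlane_ne_zero (ofReal_sigmoid_mem_slitPlane v)
    have hy0 : y ≠ 0 := hly ▸ Complex.exp_ne_zero _
    rw [Complex.exp_sub, Complex.exp_add, Complex.exp_log ht, hlm,
      Complex.exp_log (Complex.slitPlane_ne_zero (one_sub_sigmoid_mem_slitPlane v)), path2]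
    field_simp
    ring
  full _ := trivial
  path _ := rfl

theorem zero_notMem_puncturedPlane : (0 : ℂ) ∉ puncturedPlane y := by simp [puncturedPlane]

theorem one_notMem_puncturedPlane : (1 : ℂ) ∉ puncturedPlane y := by simp [puncturedPlane]

theorem inv_notMem_puncturedPlane : y⁻¹ ∉ puncturedPlane y := by simp [puncturedPlane]

theorem one_sub_mem_slitPlane_of
    (hS : ∀ t ∈ Set.Icc (0 : ℝ) 1, 1 - y * t ∈ Complex.slitPlane) :
    1 - y ∈ Complex.slitPlane := by
  simpa using hS 1 (by simp)

/-! ### The four ends `0`, `1`, `∞`, `y⁻¹` and their winding numbers. -/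

theorem exists_endChart1_zero
    (hS : ∀ t ∈ Set.Icc (0 : ℝ) 1, 1 - y * t ∈ Complex.slitPlane) :
    ∃ η : EndChart (pathChart1 hS) (-1),
    η.e₀ = 1 ∧ η.e₁ = 0 ∧ η.e₂ = 0 := by
  refine exists_endChart (pathChart1 hS) 1 0 0 (φ := fun z => z) (H₀ := fun _ => 0)
    (H₁ := fun z => Complex.log (1 - z)) (H₂ := fun z => Complex.log (1 - y * z)) contDiff_cyl
    (Eventually.of_forall fun _ => continuousAt_const)
    (eventually_continuousAt_log (by fun_prop) (by simp))
    (eventually_continuousAt_log (by fun_prop) (by simp)) ?_ ?_ ?_ ?_ ?_ ?_ ?_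
  · exact Eventually.of_forall fun z => by simp
  · filter_upwards [eventually_exp_log (f := fun z => 1 - z) (by fun_prop) (by simp)] with z hz
    rw [hz.1, zpow_zero, one_mul]
  · filter_upwards [eventually_exp_log (f := fun z => 1 - y * z) (by fun_prop) (by simp)] with z hz
    rw [hz.1, zpow_zero, one_mul]
  · intro u; simp [pathChart1]
  · intro u; simp [pathChart1]
  · intro u; simp [pathChart1]
  · exact fun L hL hK => eventually_notMem_of_tendsto
      (tendsto_nhdsWithin_of_tendsto_nhds tendsto_id) zero_notMem_puncturedPlane hL hK

theorem exists_endChart1_one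
    (hS : ∀ t ∈ Set.Icc (0 : ℝ) 1, 1 - y * t ∈ Complex.slitPlane) :
    ∃ η : EndChart (pathChart1 hS) 1,
    η.e₀ = 0 ∧ η.e₁ = 1 ∧ η.e₂ = 0 := by
  have hS1 := one_sub_mem_slitPlane_of hS
  have hr : ∀ u : ℝ, (Real.sigmoid u : ℂ) = 1 - Real.sigmoid (-u) := fun u => by
    rw [Real.sigmoid_neg]; push_cast; ring
  refine exists_endChart (pathChart1 hS) 0 1 0 (φ := fun z => 1 - z)
    (H₀ := fun z => Complex.log (1 - z)) (H₁ := fun _ => 0)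
    (H₂ := fun z => Complex.log (1 - y * (1 - z))) (contDiff_const.sub contDiff_cyl)
    (eventually_continuousAt_log (by fun_prop) (by simp))
    (Eventually.of_forall fun _ => continuousAt_const)
    (eventually_continuousAt_log (by fun_prop) (by simpa using hS1)) ?_ ?_ ?_ ?_ ?_ ?_ ?_
  · filter_upwards [eventually_exp_log (f := fun z => 1 - z) (by fun_prop) (by simp)] with z hz
    rw [hz.1, zpow_zero, one_mul]
  · exact Eventually.of_forall fun z => by simp
  · filter_upwards [eventually_exp_log (f := fun z => 1 - y * (1 - z)) (by fun_prop)
      (by simpa using hS1)] with z hz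
    rw [hz.1, zpow_zero, one_mul]
  · intro u; simp [pathChart1, hr u]
  · intro u; simp [pathChart1, hr u]
  · intro u; simp [pathChart1, hr u]
  · refine fun L hL hK => eventually_notMem_of_tendsto
      (tendsto_nhdsWithin_of_tendsto_nhds ?_) one_notMem_puncturedPlane hL hK
    exact (by fun_prop : Continuous fun z : ℂ => 1 - z).tendsto' _ _ (by simp)

theorem tendsto_inv_mul_cobounded (hy0 : y ≠ 0) :
    Tendsto (fun z : ℂ => (y * z)⁻¹) (𝓝[≠] 0) (Bornology.cobounded ℂ) := by
  refine Filter.tendsto_inv₀_nhdsNE_zero.comp (tendsto_nhdsWithin_iff.2 ⟨?_, ?_⟩)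
  · exact tendsto_nhdsWithin_of_tendsto_nhds
      ((by fun_prop : Continuous fun z : ℂ => y * z).tendsto' _ _ (by simp))
  · filter_upwards [self_mem_nhdsWithin] with z (hz : z ≠ 0)
    exact mul_ne_zero hy0 hz

/-- In the coordinate `x = 1 / (y z)` all three of `x`, `1 - x`, `1 - y x` have a simple pole at `z
= 0`, so every winding number is `-1` and the exponent of the monodromy is `a - c`. -/
theorem exists_endChart2_infty
    (hS : ∀ t ∈ Set.Icc (0 : ℝ) 1, 1 - y * t ∈ Complex.slitPlane)
    {ly lm : ℂ} (hly : Complex.exp ly = y) (hlm : Complex.exp lm = -1) :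
    ∃ η : EndChart (pathChart2 hS hly hlm) (-1),
    η.e₀ = -1 ∧ η.e₁ = -1 ∧ η.e₂ = -1 := by
  have hy0 : y ≠ 0 := hly ▸ Complex.exp_ne_zero _
  refine exists_endChart (pathChart2 hS hly hlm) (-1) (-1) (-1) (φ := fun z => (y * z)⁻¹)
    (H₀ := fun z => -ly) (H₁ := fun z => lm - ly + Complex.log (1 - y * z))
    (H₂ := fun z => lm + Complex.log (1 - z))
    ((contDiff_const.mul contDiff_cyl).inv fun v => mul_ne_zero hy0 (cyl_ne_zero v))
    (Eventually.of_forall fun _ => continuousAt_const)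
    ((eventually_continuousAt_log (f := fun z => 1 - y * z) (by fun_prop) (by simp)).mono
      fun z hz => continuousAt_const.add hz)
    ((eventually_continuousAt_log (f := fun z => 1 - z) (by fun_prop) (by simp)).mono
      fun z hz => continuousAt_const.add hz) ?_ ?_ ?_ ?_ ?_ ?_ ?_
  · filter_upwards [self_mem_nhdsWithin] with z (hz : z ≠ 0)
    rw [Complex.exp_neg, hly, zpow_neg_one]
    field_simp
  · filter_upwards [self_mem_nhdsWithin,
      eventually_exp_log (f := fun z => 1 - y * z) (by fun_prop) (by simp)] with z (h0 : z ≠ 0) hz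
    rw [Complex.exp_add, hz.1, Complex.exp_sub, hlm, hly, zpow_neg_one]
    field_simp
    ring
  · filter_upwards [self_mem_nhdsWithin,
      eventually_exp_log (f := fun z => 1 - z) (by fun_prop) (by simp)] with z (h0 : z ≠ 0) hz
    rw [Complex.exp_add, hz.1, hlm, zpow_neg_one]
    field_simp
    ring
  · intro u; simp [pathChart2]; ring
  · intro u; simp [pathChart2]; ring
  · intro u; simp [pathChart2]; ring
  · intro L hL hK
    exact (tendsto_inv_mul_cobounded hy0).eventually (Bornology.isBounded_def.1 hK.isBounded)

/-- In the coordinate `x = 1 / (y (1 - z))` one has `1 - y x = -z / (1 - z)`, so only the third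
logarithm winds. -/
theorem exists_endChart2_inv
    (hS : ∀ t ∈ Set.Icc (0 : ℝ) 1, 1 - y * t ∈ Complex.slitPlane)
    {ly lm : ℂ} (hly : Complex.exp ly = y) (hlm : Complex.exp lm = -1) :
    ∃ η : EndChart (pathChart2 hS hly hlm) 1,
    η.e₀ = 0 ∧ η.e₁ = 0 ∧ η.e₂ = 1 := by
  have hy0 : y ≠ 0 := hly ▸ Complex.exp_ne_zero _
  have hS1 := one_sub_mem_slitPlane_of hS
  have hr : ∀ u : ℝ, (Real.sigmoid u : ℂ) = 1 - Real.sigmoid (-u) := fun u => by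
    rw [Real.sigmoid_neg]; push_cast; ring
  have l0 := eventually_continuousAt_log (f := fun z => 1 - z) (by fun_prop) (by simp)
  have l1 := eventually_continuousAt_log (f := fun z => 1 - y * (1 - z)) (by fun_prop)
    (by simpa using hS1)
  have x0 := eventually_exp_log (f := fun z => 1 - z) (by fun_prop) (by simp)
  have x1 := eventually_exp_log (f := fun z => 1 - y * (1 - z)) (by fun_prop) (by simpa using hS1)
  refine exists_endChart (pathChart2 hS hly hlm) 0 0 1 (φ := fun z => (y * (1 - z))⁻¹)
    (H₀ := fun z => -ly - Complex.log (1 - z))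
    (H₁ := fun z => lm + Complex.log (1 - y * (1 - z)) - ly - Complex.log (1 - z))
    (H₂ := fun z => lm - Complex.log (1 - z))
    ((contDiff_const.mul (contDiff_const.sub contDiff_cyl)).inv
      fun v => mul_ne_zero hy0 (one_sub_cyl_ne_zero v))
    (l0.mono fun z hz => continuousAt_const.sub hz) ?_
    (l0.mono fun z hz => continuousAt_const.sub hz) ?_ ?_ ?_ ?_ ?_ ?_ ?_
  · filter_upwards [l0, l1] with z h0 h1
    exact ((continuousAt_const.add h1).sub continuousAt_const).sub h0
  · filter_upwards [x0] with z h0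
    have := h0.2
    rw [Complex.exp_sub, Complex.exp_neg, hly, h0.1, zpow_zero]
    field_simp
  · filter_upwards [x0, x1] with z h0 h1
    have := h0.2
    rw [Complex.exp_sub, Complex.exp_sub, Complex.exp_add, hly, hlm, h0.1, h1.1, zpow_zero]
    field_simp
    ring
  · filter_upwards [x0] with z h0
    have := h0.2
    rw [Complex.exp_sub, hlm, h0.1, zpow_one]
    field_simp
    ring
  · intro u; simp [pathChart2, hr u]
  · intro u; simp [pathChart2, hr u]
  · intro u; simp [pathChart2, hr u]; ring
  · refine fun L hL hK => eventually_notMem_of_tendsto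
      (tendsto_nhdsWithin_of_tendsto_nhds ?_) inv_notMem_puncturedPlane hL hK
    have : ContinuousAt (fun z : ℂ => (y * (1 - z))⁻¹) 0 := by
      refine ContinuousAt.inv₀ (by fun_prop) (by simpa using hy0)
    simpa [ContinuousAt] using this

theorem exists_betti1
    (hS : ∀ t ∈ Set.Icc (0 : ℝ) 1, 1 - y * t ∈ Complex.slitPlane) (hg : Generic a b c) :
    ∃ φ : MBdual a b c y, CorrespondsTo φ path1 (branch1 a b c y) := by
  obtain ⟨ηm, m0, m1, m2⟩ := exists_endChart1_zero hS
  obtain ⟨ηp, p0, p1, p2⟩ := exists_endChart1_one hS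
  refine (pathChart1 hS).exists_correspondsTo ηp ηm (fun v => rfl) ?_ ?_
  · rw [EndChart.monodromy, p0, p1, p2]
    have := exp_two_pi_mul_I_mul_ne_one (β := c - b) fun n => (hg n).2.2.2.2
    simpa using this
  · rw [EndChart.monodromy, m0, m1, m2]
    have := exp_two_pi_mul_I_mul_ne_one (β := b) fun n => (hg n).2.1
    simpa using this

theorem exists_betti2
    (hS : ∀ t ∈ Set.Icc (0 : ℝ) 1, 1 - y * t ∈ Complex.slitPlane)
    {ly lm : ℂ} (hly : Complex.exp ly = y) (hlm : Complex.exp lm = -1) (hg : Generic a b c) :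
    ∃ φ : MBdual a b c y, CorrespondsTo φ (path2 y) (branch2 ly lm a b c y) := by
  obtain ⟨ηm, m0, m1, m2⟩ := exists_endChart2_infty hS hly hlm
  obtain ⟨ηp, p0, p1, p2⟩ := exists_endChart2_inv hS hly hlm
  refine (pathChart2 hS hly hlm).exists_correspondsTo ηp ηm (fun v => rfl) ?_ ?_
  · rw [EndChart.monodromy, p0, p1, p2]
    have := exp_two_pi_mul_I_mul_ne_one (β := -a) fun n h => (hg (-n)).1 (by
      push_cast; rw [← h, neg_neg])
    simpa using this
  · rw [EndChart.monodromy, m0, m1, m2]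
    have := exp_two_pi_mul_I_mul_ne_one (β := a - c) fun n h => (hg (-n)).2.2.2.1 (by
      push_cast; rw [← h, neg_sub])
    convert this using 3
    push_cast
    ring

end Cycles

/-! ### Contiguity relations between the periods of a cycle -/

section Relations

variable {a b c y : ℂ}

/-- The function `x^i (1 - x)^j (1 - y x)^k`. -/
noncomputable def monoForm (y : ℂ) (i j k : ℤ) (z : ℂ) : ℂ := z ^ i * (1 - z) ^ j * (1 - y * z) ^ k

theorem monoForm_add_one₀ {z : ℂ} (hz : z ∈ puncturedPlane y) (i j k : ℤ) :
    monoForm y (i + 1) j k z = z * monoForm y i j k z := by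
  rw [monoForm, monoForm, zpow_add_one₀ (ne_zero_of_mem hz)]
  ring

theorem monoForm_add_one₁ {z : ℂ} (hz : z ∈ puncturedPlane y) (i j k : ℤ) :
    monoForm y i (j + 1) k z = (1 - z) * monoForm y i j k z := by
  rw [monoForm, monoForm, zpow_add_one₀ (one_sub_ne_zero hz)]
  ring

theorem monoForm_add_one₂ {z : ℂ} (hz : z ∈ puncturedPlane y) (i j k : ℤ) :
    monoForm y i j (k + 1) z = (1 - y * z) * monoForm y i j k z := by
  rw [monoForm, monoForm, zpow_add_one₀ (one_sub_mul_ne_zero hz)]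
  ring

theorem hasDerivAt_monoForm {z : ℂ} (hz : z ∈ puncturedPlane y) (i j k : ℤ) :
    HasDerivAt (monoForm y i j k)
      (monoForm y i j k z * (i / z - j / (1 - z) - k * y / (1 - y * z))) z := by
  have h0 := ne_zero_of_mem hz
  have h1 := one_sub_ne_zero hz
  have h2 := one_sub_mul_ne_zero hz
  have d0 := hasDerivAt_zpow i z (Or.inl h0)
  have d1 := (hasDerivAt_zpow j (1 - z) (Or.inl h1)).comp z ((hasDerivAt_id z).const_sub 1)
  have d2 := (hasDerivAt_zpow k (1 - y * z) (Or.inl h2)).comp z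
    (((hasDerivAt_id z).const_mul y).const_sub 1)
  refine ((d0.mul d1).mul d2).congr_deriv ?_
  simp only [Function.comp_apply, id, monoForm, zpow_sub_one₀ h0, zpow_sub_one₀ h1,
    zpow_sub_one₀ h2, Pi.mul_apply]
  field_simp
  ring

theorem monoForm_differentiableOn (i j k : ℤ) :
    DifferentiableOn ℂ (monoForm y i j k) (puncturedPlane y) := fun _ hz =>
  (hasDerivAt_monoForm hz i j k).differentiableAt.differentiableWithinAt

theorem chainInt_congr {g h : ℂ → ℂ} (hgh : Set.EqOn g h (puncturedPlane y)) (C : RawChain y 1) :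
    chainInt g C = chainInt h C := by
  refine finsum_congr fun σ => ?_
  rw [segInt, segInt]
  refine intervalIntegral.integral_congr fun t _ => ?_
  simp only [hgh (σ.2.2 _)]

/-- The coefficients of the contiguity relations are arbitrary complex numbers, not elements of
`QB`, so they act on the forms and not on the chain. -/
theorem chainInt_linear {g₁ g₂ g₃ : ℂ → ℂ} (h₁ : ContinuousOn g₁ (puncturedPlane y))
    (h₂ : ContinuousOn g₂ (puncturedPlane y)) (h₃ : ContinuousOn g₃ (puncturedPlane y))
    (r₁ r₂ r₃ : ℂ) {C : RawChain y 1} (hC : C ∈ finChains a b c y 1) :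
    chainInt (fun z => r₁ * g₁ z + r₂ * g₂ z + r₃ * g₃ z) C
      = r₁ * chainInt g₁ C + r₂ * chainInt g₂ C + r₃ * chainInt g₃ C := by
  have f₁ := segInt_support_finite g₁ hC
  have f₂ := segInt_support_finite g₂ hC
  have f₃ := segInt_support_finite g₃ hC
  have m : ∀ (r : ℂ) {f : SmoothSimplex y 1 → ℂ}, (Function.support f).Finite →
      (Function.support fun σ => r * f σ).Finite := fun r f h =>
    h.subset fun σ hσ h0 => hσ (by simp [h0])
  rw [chainInt, chainInt, chainInt, chainInt, mul_finsum' _ _ f₁, mul_finsum' _ _ f₂,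
    mul_finsum' _ _ f₃, ← finsum_add_distrib (m r₁ f₁) (m r₂ f₂), ← finsum_add_distrib _ (m r₃ f₃)]
  · refine finsum_congr fun σ => ?_
    have hs := section_continuous (hC.1 σ)
    have i₁ := (segInt_intervalIntegrable h₁ σ hs).const_mul r₁
    have i₂ := (segInt_intervalIntegrable h₂ σ hs).const_mul r₂
    have i₃ := (segInt_intervalIntegrable h₃ σ hs).const_mul r₃
    rw [segInt, segInt, segInt, segInt, ← intervalIntegral.integral_const_mul,
      ← intervalIntegral.integral_const_mul, ← intervalIntegral.integral_const_mul,
      ← intervalIntegral.integral_add i₁ i₂, ← intervalIntegral.integral_add (i₁.add i₂) i₃]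
    refine intervalIntegral.integral_congr fun u _ => ?_
    ring
  · refine ((m r₁ f₁).union (m r₂ f₂)).subset (Function.support_add _ _)

theorem chainInt_relation {f g₁ g₂ g₃ : ℂ → ℂ} (hf : DifferentiableOn ℂ f (puncturedPlane y))
    (h₁ : ContinuousOn g₁ (puncturedPlane y)) (h₂ : ContinuousOn g₂ (puncturedPlane y))
    (h₃ : ContinuousOn g₃ (puncturedPlane y)) {r₁ r₂ r₃ : ℂ}
    (h : ∀ z ∈ puncturedPlane y, r₁ * g₁ z + r₂ * g₂ z + r₃ * g₃ z
      = deriv f z + f z * logDerivBranch a b c y z)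
    {C : RawChain y 1} (hC : C ∈ finChains a b c y 1) (hz : bdry C = 0) :
    r₁ * chainInt g₁ C + r₂ * chainInt g₂ C + r₃ * chainInt g₃ C = 0 := by
  rw [← chainInt_linear h₁ h₂ h₃ r₁ r₂ r₃ hC]
  exact chainInt_exact hf h (by fun_prop) hC hz

/-- Applying `∇` to `x^(i+1) (1 - x)^(j+1) (1 - y x)^(k+1)` gives `x^i (1 - x)^j (1 - y x)^k` times
the quadratic `β (1 - x)(1 - y x) - δ x (1 - y x) + α y x (1 - x)`. The three relations write this
quadratic in three ways as a combination of products of the linear factors. The first two serve the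
first path, the last two the second path. -/
theorem chainInt_monoForm {C : RawChain y 1} (hC : C ∈ finChains a b c y 1) (hz : bdry C = 0)
    (i j k : ℤ) {β δ α : ℂ} (hβ : β = b + i + 1) (hδ : δ = c - b + j + 1) (hα : α = a - k - 1) :
    (β * chainInt (monoForm y i j (k + 1)) C - (β + δ) * chainInt (monoForm y (i + 1) j (k + 1)) C
      + α * y * chainInt (monoForm y (i + 1) (j + 1) k) C = 0) ∧
    (-δ * chainInt (monoForm y i j (k + 1)) C + (β + δ) * chainInt (monoForm y i (j + 1) (k + 1)) C
      + α * y * chainInt (monoForm y (i + 1) (j + 1) k) C = 0) ∧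
    (-δ * chainInt (monoForm y i j (k + 1)) C + (β + δ) * chainInt (monoForm y i (j + 1) k) C
      + y * (α - β - δ) * chainInt (monoForm y (i + 1) (j + 1) k) C = 0) := by
  have hc := fun i j k => (monoForm_differentiableOn (y := y) i j k).continuousOn
  have hd := monoForm_differentiableOn (y := y) (i + 1) (j + 1) (k + 1)
  rw [sub_eq_add_neg, ← neg_mul]
  refine ⟨chainInt_relation hd (hc _ _ _) (hc _ _ _) (hc _ _ _) (fun z h => ?_) hC hz,
    chainInt_relation hd (hc _ _ _) (hc _ _ _) (hc _ _ _) (fun z h => ?_) hC hz,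
    chainInt_relation hd (hc _ _ _) (hc _ _ _) (hc _ _ _) (fun z h => ?_) hC hz⟩ <;>
  · have h0 := ne_zero_of_mem h
    have h1 := one_sub_ne_zero h
    have h2 := one_sub_mul_ne_zero h
    rw [(hasDerivAt_monoForm h _ _ _).deriv, logDerivBranch, hβ, hδ, hα]
    simp only [monoForm_add_one₀ h, monoForm_add_one₁ h, monoForm_add_one₂ h]
    generalize monoForm y i j k z = m
    push_cast
    field_simp
    ring

/-- The contiguity relations determine a family of numbers from those with large indices. -/
theorem eq_zero_of_contiguous {E : ℤ → ℤ → ℤ → ℂ} {β δ α : ℂ} (hβ : ∀ i : ℤ, β + i ≠ 0)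
    (hδ : ∀ j : ℤ, δ + j ≠ 0)
    (h1 : ∀ i j k : ℤ, (β + i) * E i j k
      = (β + i + (δ + j)) * E (i + 1) j k - (α + k) * y * E (i + 1) (j + 1) (k + 1))
    (h2 : ∀ i j k : ℤ, (δ + j) * E i j k
      = (β + i + (δ + j)) * E i (j + 1) k + (α + k) * y * E (i + 1) (j + 1) (k + 1))
    {N : ℤ} (h0 : ∀ i j k, N ≤ i → N ≤ j → E i j k = 0) (i j k : ℤ) : E i j k = 0 := by
  -- The first relation lowers `i` while `j` stays large; the second then lowers `j` for all `i` at
  -- once. The index `k` needs no bound, because the vanishing for large `i`, `j` is uniform in it.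
  have key1 : ∀ (n : ℕ) (i j k : ℤ), N - n ≤ i → N ≤ j → E i j k = 0 := by
    intro n
    induction n with
    | zero => intro i j k hi hj; exact h0 i j k (by simpa using hi) hj
    | succ n ih =>
      intro i j k hi hj
      have := h1 i j k
      rw [ih (i + 1) j k (by push_cast at hi; omega) hj,
        ih (i + 1) (j + 1) (k + 1) (by push_cast at hi; omega) (by omega), mul_zero, mul_zero,
        sub_zero] at this
      exact (mul_eq_zero.1 this).resolve_left (hβ i)
  have key2 : ∀ (n : ℕ) (i j k : ℤ), N - n ≤ j → E i j k = 0 := by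
    intro n
    induction n with
    | zero =>
      intro i j k hj
      exact key1 (N - i).toNat i j k (by omega) (by simpa using hj)
    | succ n ih =>
      intro i j k hj
      have := h2 i j k
      rw [ih i (j + 1) k (by push_cast at hj; omega),
        ih (i + 1) (j + 1) (k + 1) (by push_cast at hj; omega), mul_zero, mul_zero,
        add_zero] at this
      exact (mul_eq_zero.1 this).resolve_left (hδ j)
  exact key2 (N - j).toNat i j k (by omega)

/-- The difference of `J` and `𝓕` obeys the same linear relations and vanishes where the integral
converges. No generic leading coefficient vanishes, so the difference is zero throughout. -/
theorem eq_calF_of_contiguous (hS : ∀ t ∈ Set.Icc (0 : ℝ) 1, 1 - y * t ∈ Complex.slitPlane)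
    {J : ℤ → ℤ → ℤ → ℂ} {β δ α : ℂ} (hβ : ∀ i : ℤ, β ≠ i) (hδ : ∀ j : ℤ, δ ≠ j)
    (h1 : ∀ i j k : ℤ, (β + i) * J i j k
      = (β + i + (δ + j)) * J (i + 1) j k - (α + k) * y * J (i + 1) (j + 1) (k + 1))
    (h2 : ∀ i j k : ℤ, (δ + j) * J i j k
      = (β + i + (δ + j)) * J i (j + 1) k + (α + k) * y * J (i + 1) (j + 1) (k + 1))
    (h0 : ∀ i j k : ℤ, 0 < (β + i).re → 0 < (δ + j).re →
      J i j k = integralF y (α + k, β + i, β + i + (δ + j))) (i j k : ℤ) :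
    J i j k = calF (α + k) (β + i) (β + i + (δ + j)) y := by
  have hβ' : ∀ i n : ℤ, β + i ≠ n := fun i n h => hβ (n - i) (by
    push_cast; linear_combination h)
  have hδ' : ∀ i n : ℤ, δ + i ≠ n := fun i n h => hδ (n - i) (by
    push_cast; linear_combination h)
  have hI := fun i j k : ℤ => calF_contiguous hS (a := α + k) (b := β + i) (d := δ + j)
    (fun n => by exact_mod_cast hβ' i (-n)) (fun n => by exact_mod_cast hδ' j (-n))
  have cast : ∀ (x : ℂ) (n : ℤ), x + ((n + 1 : ℤ) : ℂ) = x + n + 1 := fun x n => by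
    push_cast; ring
  obtain ⟨N, hN⟩ := exists_nat_gt (max (-β.re) (-δ.re))
  rw [max_lt_iff] at hN
  refine sub_eq_zero.1 (eq_zero_of_contiguous (y := y) (β := β) (δ := δ) (α := α) (N := N)
    (E := fun i j k => J i j k - calF (α + k) (β + i) (β + i + (δ + j)) y)
    (fun i => by exact_mod_cast hβ' i 0) (fun i => by exact_mod_cast hδ' i 0) (fun i j k => ?_)
    (fun i j k => ?_) (fun i j k hi hj => ?_) i j k)
  · simp only [cast]
    linear_combination h1 i j k - (hI i j k).1
  · simp only [cast]
    linear_combination h2 i j k - (hI i j k).2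
  · have hi' : (N : ℝ) ≤ i := by exact_mod_cast hi
    have hj' : (N : ℝ) ≤ j := by exact_mod_cast hj
    have r1 : 0 < (β + i).re := by
      rw [Complex.add_re, Complex.intCast_re]; linarith [hN.1]
    have r2 : 0 < (δ + j).re := by
      rw [Complex.add_re, Complex.intCast_re]; linarith [hN.2]
    have := (calF_isContinuation hS).2 (x := (α + k, β + i, β + i + (δ + j))) ⟨r1, by
      rw [Complex.add_re (β + i)]; simp only; linarith⟩
    rw [h0 i j k r1 r2, ← this, sub_self]

end Relations

/-! ### The periods along the two paths -/

section Periods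

open Filter Topology

variable {a b c y : ℂ}

/-! ### Vanishing of the corrections at the ends, and the periods in the convergent range. -/

theorem radial_nhdsNE (p : ℂ) {Q : ℂ → Prop} (h : ∀ᶠ z in 𝓝[≠] p, Q z) :
    ∀ᶠ x in 𝓝[≠] p, ∀ z, ‖z - p‖ = ‖x - p‖ → Q z := by
  rw [eventually_nhdsWithin_iff, Metric.eventually_nhds_iff] at h ⊢
  obtain ⟨δ, hδ, h⟩ := h
  refine ⟨δ, hδ, fun x hx hxp z hz => h ?_ ?_⟩
  · rwa [dist_eq_norm, hz, ← dist_eq_norm]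
  · exact sub_ne_zero.1 (norm_pos_iff.1 (hz ▸ norm_pos_iff.2 (sub_ne_zero.2 hxp)))

theorem radial_cobounded {Q : ℂ → Prop} (h : ∀ᶠ z in Bornology.cobounded ℂ, Q z) :
    ∀ᶠ x in Bornology.cobounded ℂ, ∀ z, ‖z - 0‖ = ‖x - 0‖ → Q z := by
  obtain ⟨R, -, hR⟩ := (hasBasis_cobounded_norm (E := ℂ)).eventually_iff.1 h
  filter_upwards [eventually_cobounded_le_norm R] with x hx z hz
  rw [sub_zero, sub_zero] at hz
  exact hR (by simpa [hz] using hx)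

/-- If `g` is of order `(z - p)^n`, the circle bound makes `m` of order `(z - p)^(n + 1)`. It
remains to control `s (γ - p)^(n + 1)`, which for the two paths is governed by a branch with shifted
exponents. For `p = 0` at infinity the same argument applies with `n` the growth order. -/
theorem CircleBound.tendsto_zero {g m : ℂ → ℂ} {p : ℂ} {l : Filter ℂ} (hC : CircleBound g m p l)
    (radial : ∀ {Q : ℂ → Prop}, (∀ᶠ z in l, Q z) → ∀ᶠ x in l, ∀ z, ‖z - p‖ = ‖x - p‖ → Q z)
    (hne : ∀ᶠ x in l, x ≠ p) {n : ℤ} {A : ℂ} (hg : Tendsto (fun z => g z / (z - p) ^ n) l (𝓝 A))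
    {l' : Filter ℝ} {s : ℝ → ℂ} {γ : ℝ → ℂ} (hγ : Tendsto γ l' l)
    (hs : Tendsto (fun t => s t * (γ t - p) ^ (n + 1)) l' (𝓝 0)) :
    Tendsto (fun t => s t * m (γ t)) l' (𝓝 0) := by
  obtain ⟨C, hC⟩ := hC
  have hbd : ∀ᶠ z in l, ‖g z‖ ≤ (‖A‖ + 1) * ‖z - p‖ ^ n := by
    filter_upwards [hg.norm.eventually_le_const (lt_add_one ‖A‖), hne] with z hz h0
    rw [norm_div, norm_zpow] at hz
    exact (div_le_iff₀ (zpow_pos (norm_pos_iff.2 (sub_ne_zero.2 h0)) n)).1 hz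
  have hm : ∀ᶠ x in l, ‖m x‖ ≤ C * (‖A‖ + 1) * ‖(x - p) ^ (n + 1)‖ := by
    filter_upwards [hC, radial hbd, hne] with x h1 h2 h3
    refine (h1 ((‖A‖ + 1) * ‖x - p‖ ^ n) fun z hz => hz ▸ h2 z hz).trans (le_of_eq ?_)
    rw [norm_zpow, zpow_add_one₀ (norm_pos_iff.2 (sub_ne_zero.2 h3)).ne']
    ring
  refine squeeze_zero_norm' (a := fun t => C * (‖A‖ + 1) * ‖s t * (γ t - p) ^ (n + 1)‖) ?_ ?_
  · filter_upwards [hγ.eventually hm] with t ht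
    rw [norm_mul, norm_mul]
    calc ‖s t‖ * ‖m (γ t)‖ ≤ ‖s t‖ * (C * (‖A‖ + 1) * ‖(γ t - p) ^ (n + 1)‖) := by gcongr
      _ = _ := by ring
  · simpa using hs.norm.const_mul (C * (‖A‖ + 1))

/-- Integer shifts of the exponents are honest rational functions, independent of the determinations
of the logarithms. Periods of one cycle against monomial forms thus encode all shifted parameters.
-/
theorem PathChart.branch_shift {γ : ℝ → ℂ} (κ : PathChart y γ) (i j k : ℤ) (v : ℝ) :
    κ.branch (a + k) (b + i) (c + (i + j)) v
      = κ.branch a b c v * monoForm y i j (-k) (κ.X v) := by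
  rw [monoForm, ← κ.exp₂ v (κ.full v), ← κ.exp₁ v (κ.full v)]
  conv_rhs => rw [← κ.exp₀ v (κ.full v)]
  rw [LogChart.branch, LogChart.branch, ← Complex.exp_int_mul, ← Complex.exp_int_mul,
    ← Complex.exp_int_mul, ← Complex.exp_add, ← Complex.exp_add, ← Complex.exp_add]
  congr 1
  push_cast
  ring

theorem exists_sigmoid_eq {t : ℝ} (ht : t ∈ Set.Ioo (0 : ℝ) 1) : ∃ v, Real.sigmoid v = t := by
  rwa [← Real.range_sigmoid] at ht

theorem branch1_shift (hS : ∀ t ∈ Set.Icc (0 : ℝ) 1, 1 - y * t ∈ Complex.slitPlane) (i j k : ℤ)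
    {t : ℝ} (ht : t ∈ Set.Ioo (0 : ℝ) 1) :
    branch1 (a + k) (b + i) (c + (i + j)) y t
      = branch1 a b c y t * monoForm y i j (-k) (path1 t) := by
  obtain ⟨v, rfl⟩ := exists_sigmoid_eq ht
  exact (pathChart1 hS).branch_shift i j k v

theorem branch2_shift (hS : ∀ t ∈ Set.Icc (0 : ℝ) 1, 1 - y * t ∈ Complex.slitPlane)
    {ly lm : ℂ} (hly : Complex.exp ly = y) (hlm : Complex.exp lm = -1) (i j k : ℤ)
    {t : ℝ} (ht : t ∈ Set.Ioo (0 : ℝ) 1) :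
    branch2 ly lm (a + k) (b + i) (c + (i + j)) y t
      = branch2 ly lm a b c y t * monoForm y i j (-k) (path2 y t) := by
  obtain ⟨v, rfl⟩ := exists_sigmoid_eq ht
  exact (pathChart2 hS hly hlm).branch_shift i j k v

theorem path1_mem (hS : ∀ t ∈ Set.Icc (0 : ℝ) 1, 1 - y * t ∈ Complex.slitPlane)
    {t : ℝ} (ht : t ∈ Set.Ioo (0 : ℝ) 1) : path1 t ∈ puncturedPlane y := by
  obtain ⟨v, rfl⟩ := exists_sigmoid_eq ht
  exact (pathChart1 hS).mem v trivial

theorem path2_mem (hS : ∀ t ∈ Set.Icc (0 : ℝ) 1, 1 - y * t ∈ Complex.slitPlane)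
    {ly lm : ℂ} (hly : Complex.exp ly = y) (hlm : Complex.exp lm = -1)
    {t : ℝ} (ht : t ∈ Set.Ioo (0 : ℝ) 1) : path2 y t ∈ puncturedPlane y := by
  obtain ⟨v, rfl⟩ := exists_sigmoid_eq ht
  exact (pathChart2 hS hly hlm).mem v trivial

/-- Without the factor coming from `dx / (x (1 - x))`, the branch along `p₂` is a constant times
`t^(a - c) (1 - t)^(-a) (1 - y t)^(c - b)`. Its limits at the ends follow from those of `branch1`.
-/
theorem branch2_eq (ly lm a b c y : ℂ) (t : ℝ) : branch2 ly lm a b c y t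
    = Complex.exp (-c * ly + (c - b - a) * lm) * branch1 (b - c) (a - c) (a - c + -a) y t := by
  rw [branch1, branch2, ← Complex.exp_add]
  congr 1
  ring

theorem Ioo_mem_nhdsGT_zero : Set.Ioo (0 : ℝ) 1 ∈ 𝓝[>] (0 : ℝ) := Ioo_mem_nhdsGT one_pos

theorem Ioo_mem_nhdsLT_one : Set.Ioo (0 : ℝ) 1 ∈ 𝓝[<] (1 : ℝ) := Ioo_mem_nhdsLT one_pos

theorem monoForm_mul_inv {z : ℂ} (hz : z ∈ puncturedPlane y) (i j k : ℤ) :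
    monoForm y (i - 1) (j - 1) k z = monoForm y i j k z * (1 / (z * (1 - z))) := by
  have h0 := ne_zero_of_mem hz
  have h1 := one_sub_ne_zero hz
  rw [monoForm, monoForm, zpow_sub_one₀ h0, zpow_sub_one₀ h1]
  field_simp

theorem chainInt_path1 (hS : ∀ t ∈ Set.Icc (0 : ℝ) 1, 1 - y * t ∈ Complex.slitPlane)
    (hy0 : y ≠ 0) (hy1 : y ≠ 1) (hg : Generic a b c) {C : RawChain y 1}
    (hC : C ∈ finChains a b c y 1) (hz : bdry C = 0) {D : RawChain y 2}
    (hD : D ∈ lfChains a b c y 2) (hCP : bdry D = C - pathChain y path1 (branch1 a b c y))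
    (i j k : ℤ) (hb : 0 < (b + i).re) (hd : 0 < (c - b + j).re) :
    chainInt (monoForm y (i - 1) (j - 1) (-k)) C
      = integralF y (a + k, b + i, b + i + (c - b + j)) := by
  obtain ⟨K, m, hKU, hK, hm, m0, m1, -, -⟩ := exists_solution_outside_compact hy0 hy1 hg
    (monoForm_differentiableOn (y := y) (i - 1) (j - 1) (-k))
  have hσ := (pathChart1 hS).locFin_verts (exists_endChart1_one hS).choose
    (exists_endChart1_zero hS).choose
  have hI : ∀ t ∈ Set.Ioo (0 : ℝ) 1, branch1 a b c y t
      * monoForm y (i - 1) (j - 1) (-k) (path1 t) * 1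
      = integrandF y (a + k, b + i, b + i + (c - b + j)) t := fun t ht => by
    rw [monoForm_mul_inv (path1_mem hS ht), integrandF,
      show b + i + (c - b + j) = c + (i + j) by ring, branch1_shift hS i j k ht]
    ring
  have hreg : (a + k, b + i, b + i + (c - b + j)) ∈ regF := ⟨hb, by
    rw [Complex.add_re (b + i)]; simp only; linarith⟩
  -- The two functions continuous at `0` and `1` are the form divided by `x^(i - 1)` and by `(x -
  -- 1)^(j - 1)`; their values there are the leading coefficients `A`.
  have hU0 : ContinuousAt (fun z : ℂ => (1 - z) ^ (j - 1) * (1 - y * z) ^ (-k)) 0 := by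
    refine ContinuousAt.mul (ContinuousAt.zpow₀ (by fun_prop) _ (Or.inl (by simp)))
      (ContinuousAt.zpow₀ (by fun_prop) _ (Or.inl (by simp)))
  have hU1 : ContinuousAt (fun z : ℂ => (-1) ^ (j - 1) * z ^ (i - 1) * (1 - y * z) ^ (-k)) 1 := by
    refine ContinuousAt.mul (ContinuousAt.mul (by fun_prop)
      (ContinuousAt.zpow₀ (by fun_prop) _ (Or.inl (by simp))))
      (ContinuousAt.zpow₀ (by fun_prop) _ (Or.inl ?_))
    exact fun h => hy1 (by linear_combination -h)
  rw [(pathChart1 hS).chainInt_eq_integral (γ' := fun _ => 1) (s := branch1 a b c y)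
    (fun v => rfl) (fun t _ => Complex.ofRealCLM.hasDerivAt) (fun t _ u _ h => by
      simpa [path1] using h) hσ (monoForm_differentiableOn _ _ _) ?_ hKU hK hm ?_ ?_ hC hz hD hCP]
  · exact intervalIntegral.integral_congr_Ioo_of_le zero_le_one hI
  · refine (integrandF_intervalIntegrable hS hreg).congr_uIoo fun t ht => ?_
    rw [Set.uIoo_of_le zero_le_one] at ht
    exact (hI t ht).symm
  · refine m0.tendsto_zero (radial_nhdsNE 0) self_mem_nhdsWithin (n := i - 1)
      (A := (1 - 0) ^ (j - 1) * (1 - y * 0) ^ (-k)) ?_ ?_ ?_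
    · refine (hU0.tendsto.mono_left nhdsWithin_le_nhds).congr' ?_
      filter_upwards [self_mem_nhdsWithin] with z (h : z ≠ 0)
      rw [sub_zero, monoForm]
      field_simp
    · refine tendsto_nhdsWithin_iff.2 ⟨tendsto_nhdsWithin_of_tendsto_nhds
        (Complex.continuous_ofReal.tendsto' _ _ (by simp)), ?_⟩
      filter_upwards [Ioo_mem_nhdsGT_zero] with t ht
      exact Complex.ofReal_ne_zero.2 ht.1.ne'
    -- Multiplying the branch by `x^i` turns the exponent `b` into `b + i`, whose real part is
    -- positive by hypothesis.
    · refine (branch1_tendsto_zero y a hb (d := c - b)).congr' ?_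
      filter_upwards [Ioo_mem_nhdsGT_zero] with t ht
      have := branch1_shift (a := a) (b := b) (c := c) hS i 0 0 ht
      simp only [Int.cast_zero, add_zero, monoForm, neg_zero, zpow_zero, mul_one] at this
      rw [sub_add_cancel, sub_zero, ← this]
      congr 1
      ring
  · refine m1.tendsto_zero (radial_nhdsNE 1) self_mem_nhdsWithin (n := j - 1)
      (A := (-1) ^ (j - 1) * 1 ^ (i - 1) * (1 - y * 1) ^ (-k)) ?_ ?_ ?_
    · refine (hU1.tendsto.mono_left nhdsWithin_le_nhds).congr' ?_
      filter_upwards [self_mem_nhdsWithin] with z (h : z ≠ 1)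
      have h' : z - 1 ≠ 0 := sub_ne_zero.2 h
      rw [monoForm, show 1 - z = -1 * (z - 1) by ring, mul_zpow]
      field_simp
    · refine tendsto_nhdsWithin_iff.2 ⟨tendsto_nhdsWithin_of_tendsto_nhds
        (Complex.continuous_ofReal.tendsto' _ _ (by simp)), ?_⟩
      filter_upwards [Ioo_mem_nhdsLT_one] with t ht
      exact fun h => ht.2.ne (by simpa [path1] using h)
    -- The sign `(-1)^j` accounts for using `x - 1` as local coordinate while the branch contains `1
    -- - x`.
    · have h1 := (branch1_tendsto_one hS a hd (b := b)).const_mul ((-1 : ℂ) ^ j)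
      rw [mul_zero] at h1
      refine h1.congr' ?_
      filter_upwards [Ioo_mem_nhdsLT_one] with t ht
      have := branch1_shift (a := a) (b := b) (c := c) hS 0 j 0 ht
      simp only [Int.cast_zero, add_zero, zero_add, monoForm, neg_zero, zpow_zero, mul_one,
        one_mul] at this
      rw [sub_add_cancel, show b + (c - b + j) = c + j by ring, this,
        show path1 t - 1 = -1 * (1 - path1 t) by ring, mul_zpow]
      ring

/-- The periods of a cycle corresponding to the first path. -/
theorem chainInt_path1_eq_calF (hS : ∀ t ∈ Set.Icc (0 : ℝ) 1, 1 - y * t ∈ Complex.slitPlane)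
    (hy0 : y ≠ 0) (hy1 : y ≠ 1) (hg : Generic a b c) {C : RawChain y 1}
    (hC : C ∈ finChains a b c y 1) (hz : bdry C = 0) {D : RawChain y 2}
    (hD : D ∈ lfChains a b c y 2) (hCP : bdry D = C - pathChain y path1 (branch1 a b c y))
    (i j k : ℤ) :
    chainInt (monoForm y (i - 1) (j - 1) (-k)) C
      = calF (a + k) (b + i) (b + i + (c - b + j)) y := by
  have hrel := fun i j k : ℤ => chainInt_monoForm hC hz (i - 1) (j - 1) (-k - 1) (β := b + i)
    (δ := c - b + j) (α := a + k) (by push_cast; ring) (by push_cast; ring) (by push_cast; ring)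
  simp only [sub_add_cancel] at hrel
  have e1 : ∀ n : ℤ, n + 1 - 1 = n := fun n => by ring
  have e2 : ∀ n : ℤ, -(n + 1) = -n - 1 := fun n => by ring
  refine eq_calF_of_contiguous hS (J := fun i j k => chainInt (monoForm y (i - 1) (j - 1) (-k)) C)
    (fun n => (hg n).2.1) (fun n => (hg n).2.2.2.2) (fun i j k => ?_) (fun i j k => ?_)
    (chainInt_path1 hS hy0 hy1 hg hC hz hD hCP) i j k
  · simp only [e1, e2]
    linear_combination (hrel i j k).1
  · simp only [e1, e2]
    linear_combination -(hrel i j k).2.1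

theorem chainInt_path2 (hS : ∀ t ∈ Set.Icc (0 : ℝ) 1, 1 - y * t ∈ Complex.slitPlane)
    (hy1 : y ≠ 1) {ly lm : ℂ} (hly : Complex.exp ly = y) (hlm : Complex.exp lm = -1)
    (hg : Generic a b c) {C : RawChain y 1}
    (hC : C ∈ finChains a b c y 1) (hz : bdry C = 0) {D : RawChain y 2}
    (hD : D ∈ lfChains a b c y 2)
    (hCP : bdry D = C - pathChain y (path2 y) (branch2 ly lm a b c y))
    (i j k : ℤ) (hb : 0 < (1 + a - c + k - i - j).re) (hd : 0 < (1 - a - k).re) :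
    chainInt (monoForm y (i - 1) (j - 1) (-k)) C
      = integralG ly lm y (a + k, b + i, c + (i + j)) := by
  have hy0 : y ≠ 0 := hly ▸ Complex.exp_ne_zero _
  obtain ⟨K, m, hKU, hK, hm, -, -, my, mi⟩ := exists_solution_outside_compact hy0 hy1 hg
    (monoForm_differentiableOn (y := y) (i - 1) (j - 1) (-k))
  have hσ := (pathChart2 hS hly hlm).locFin_verts (exists_endChart2_inv hS hly hlm).choose
    (exists_endChart2_infty hS hly hlm).choose
  have hI : ∀ t ∈ Set.Ioo (0 : ℝ) 1, branch2 ly lm a b c y t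
      * monoForm y (i - 1) (j - 1) (-k) (path2 y t) * (-(1 / (y * (t : ℂ) ^ 2)))
      = branch2 ly lm (a + k) (b + i) (c + (i + j)) y t
        * (1 / (path2 y t * (1 - path2 y t))) * (-(1 / (y * (t : ℂ) ^ 2))) := fun t ht => by
    rw [monoForm_mul_inv (path2_mem hS hly hlm ht), branch2_shift hS hly hlm i j k ht]
    ring
  -- The two hypotheses on real parts say exactly that the swapped parameters lie in the region of
  -- convergence of `𝓕`.
  have hreg : swapParams (a + k, b + i, c + (i + j)) ∈ regF := by
    simp only [regF, swapParams, Set.mem_ofPred_eq]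
    constructor
    · convert hb using 2; ring
    · rw [← sub_pos, ← Complex.sub_re]
      convert hd using 2; ring
  have hγ : ∀ t ∈ Set.Ioo (0 : ℝ) 1, HasDerivAt (path2 y) (-(1 / (y * (t : ℂ) ^ 2))) t := by
    intro t ht
    have h0 : (t : ℂ) ≠ 0 := Complex.ofReal_ne_zero.2 ht.1.ne'
    have h1 : HasDerivAt (fun t : ℝ => y * (t : ℂ)) (y * 1) t :=
      Complex.ofRealCLM.hasDerivAt.const_mul y
    have h2 := h1.fun_inv (mul_ne_zero hy0 h0)
    refine (h2.congr_deriv ?_).congr_of_eventuallyEq (Eventually.of_forall fun t => ?_)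
    · field_simp
    · exact one_div _
  have hinj : Set.InjOn (path2 y) (Set.Ioo 0 1) := fun t _ u _ h => by
    simpa [path2, hy0] using h
  have hUi : Tendsto (fun z : ℂ => (z⁻¹ - 1) ^ (j - 1) * (z⁻¹ - y) ^ (-k)) (Bornology.cobounded ℂ)
      (𝓝 ((0 - 1) ^ (j - 1) * (0 - y) ^ (-k))) := by
    have h := Filter.tendsto_inv₀_cobounded (α := ℂ)
    exact ((h.sub_const 1).zpow₀ _ (Or.inl (by simp))).mul
      ((h.sub_const y).zpow₀ _ (Or.inl (by simpa using hy0)))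
  have hUy : ContinuousAt (fun z : ℂ => z ^ (i - 1) * (1 - z) ^ (j - 1) * (-y) ^ (-k)) y⁻¹ := by
    refine ContinuousAt.mul (ContinuousAt.mul (ContinuousAt.zpow₀ (by fun_prop) _
      (Or.inl (inv_ne_zero hy0))) (ContinuousAt.zpow₀ (by fun_prop) _ (Or.inl ?_)))
      continuousAt_const
    exact sub_ne_zero.2 fun h => hy1 (inv_eq_one.1 h.symm)
  rw [(pathChart2 hS hly hlm).chainInt_eq_integral (γ' := fun t => -(1 / (y * (t : ℂ) ^ 2)))
    (s := branch2 ly lm a b c y) (fun v => rfl) hγ hinj hσ (monoForm_differentiableOn _ _ _)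
    ?_ hKU hK hm ?_ ?_ hC hz hD hCP]
  · exact intervalIntegral.integral_congr_Ioo_of_le zero_le_one hI
  · refine ((integrandF_intervalIntegrable hS hreg).const_mul
      (swapConst ly lm y (a + k, b + i, c + (i + j)))).congr_uIoo fun t ht => ?_
    rw [Set.uIoo_of_le zero_le_one] at ht
    refine ((hI t ht).trans ?_).symm
    exact branch2_mul_eq hy0 ht (Complex.slitPlane_ne_zero (hS t (Set.Ioo_subset_Icc_self ht))) ly
      lm (a + k, b + i, c + (i + j))
  · have hne : ∀ᶠ z in Bornology.cobounded ℂ, z ≠ 0 :=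
      Bornology.eventually_ne_cobounded 0
    refine mi.tendsto_zero radial_cobounded hne (n := i - 1 + (j - 1) + -k) (hUi.congr' ?_) ?_ ?_
    · filter_upwards [hne] with z h
      have e1 : z⁻¹ - 1 = (1 - z) / z := by field_simp
      have e2 : z⁻¹ - y = (1 - y * z) / z := by field_simp
      rw [e1, e2, div_zpow, div_zpow, sub_zero, monoForm, zpow_add₀ h, zpow_add₀ h]
      field_simp
    · have h : Tendsto (fun t : ℝ => (t : ℂ)) (𝓝[>] 0) (𝓝[≠] 0) := by
        refine tendsto_nhdsWithin_iff.2 ⟨tendsto_nhdsWithin_of_tendsto_nhds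
          (Complex.continuous_ofReal.tendsto' _ _ (by simp)), ?_⟩
        filter_upwards [Ioo_mem_nhdsGT_zero] with t ht
        exact Complex.ofReal_ne_zero.2 ht.1.ne'
      exact ((tendsto_inv_mul_cobounded hy0).comp h).congr fun t => (one_div _).symm
    -- The form grows like `x^(N - 1)` at infinity, hence `m` like `x^N`. Multiplying the branch by
    -- `x^N` leaves the exponent `a - c - N` of `t`, whose real part is positive by `hb`.
    · set N : ℤ := i - 1 + (j - 1) + -k + 1 with hN
      have hre : 0 < (a - (c + N)).re := by
        convert hb using 2
        rw [hN]; push_cast; ring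
      have h1 := (branch1_tendsto_zero y (b + N - (c + N)) hre (d := -a)).const_mul
        (Complex.exp (-(c + N) * ly + (c + N - (b + N) - a) * lm))
      rw [mul_zero] at h1
      refine h1.congr' ?_
      filter_upwards [Ioo_mem_nhdsGT_zero] with t ht
      have := branch2_shift (a := a) (b := b) (c := c) hS hly hlm N 0 0 ht
      simp only [Int.cast_zero, add_zero, monoForm, neg_zero, zpow_zero, mul_one] at this
      rw [← branch2_eq, sub_zero, ← this]
  · refine my.tendsto_zero (radial_nhdsNE y⁻¹) self_mem_nhdsWithin (n := -k)
      ((hUy.tendsto.mono_left nhdsWithin_le_nhds).congr' ?_) ?_ ?_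
    · filter_upwards [self_mem_nhdsWithin] with z (h : z ≠ y⁻¹)
      have h' : z - y⁻¹ ≠ 0 := sub_ne_zero.2 h
      rw [monoForm, show 1 - y * z = -y * (z - y⁻¹) by field_simp; ring, mul_zpow,
        eq_div_iff (zpow_ne_zero _ h')]
      ring
    · refine tendsto_nhdsWithin_iff.2 ⟨tendsto_nhdsWithin_of_tendsto_nhds ?_, ?_⟩
      · have : Tendsto (path2 y) (𝓝 1) (𝓝 (1 / (y * ((1 : ℝ) : ℂ)))) :=
          ContinuousAt.div continuousAt_const (by fun_prop) (by simpa using hy0)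
        simpa using this
      · filter_upwards [Ioo_mem_nhdsLT_one] with t ht h
        exact inv_notMem_puncturedPlane (h ▸ path2_mem hS hly hlm ht)
    -- At `y⁻¹` the form has order `-k`, so `m` has order `1 - k`. This lowers the shift of `a` from
    -- `k` to `k - 1` and leaves the exponent `1 - a - k` of `1 - t`.
    · have hre : 0 < (-(a + (k - 1 : ℤ))).re := by
        convert hd using 2
        push_cast; ring
      have h1 := (branch1_tendsto_one hS (b - c) (b := a + (k - 1 : ℤ) - c) hre).const_mul
        ((-y⁻¹) ^ (-k + 1) * Complex.exp (-c * ly + (c - b - (a + (k - 1 : ℤ))) * lm))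
      rw [mul_zero] at h1
      refine h1.congr' ?_
      filter_upwards [Ioo_mem_nhdsLT_one] with t ht
      have := branch2_shift (a := a) (b := b) (c := c) hS hly hlm 0 0 (k - 1) ht
      simp only [Int.cast_zero, add_zero, monoForm, zpow_zero, one_mul] at this
      rw [mul_assoc, ← branch2_eq, this,
        show path2 y t - y⁻¹ = -y⁻¹ * (1 - y * path2 y t) by field_simp; ring, mul_zpow,
        show -(k - 1) = -k + 1 by ring]
      ring

/-- Integer shifts change `swapConst` only by powers of `exp ly = y` and `exp lm = -1`, so no
determination of a logarithm enters the rescaled contiguity relations. -/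
theorem swapConst_shift {ly lm : ℂ} (hly : Complex.exp ly = y) (hlm : Complex.exp lm = -1)
    (a b c : ℂ) : swapConst ly lm y (a, b - 1, c - 1) = y * swapConst ly lm y (a, b, c) ∧
      swapConst ly lm y (a - 1, b - 1, c - 2) = y ^ 2 * swapConst ly lm y (a, b, c) ∧
      swapConst ly lm y (a - 1, b - 1, c - 1) = -y * swapConst ly lm y (a, b, c) := by
  have e : ∀ x y z w : ℂ, Complex.exp (x + y + (z + w)) = Complex.exp x * Complex.exp y *
      (Complex.exp z * Complex.exp w) := fun x y z w => by
    rw [Complex.exp_add, Complex.exp_add, Complex.exp_add]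
  simp only [swapConst]
  refine ⟨?_, ?_, ?_⟩
  · rw [show -(c - 1) * ly + (c - 1 - (b - 1) - a) * lm
      = ly + (-c * ly + (c - b - a) * lm) by ring, Complex.exp_add, hly]
  · rw [show -(c - 2) * ly + (c - 2 - (b - 1) - (a - 1)) * lm
      = ly + ly + (-c * ly + (c - b - a) * lm) by ring, Complex.exp_add, Complex.exp_add, hly]
    ring
  · rw [show -(c - 1) * ly + (c - 1 - (b - 1) - (a - 1)) * lm
      = ly + lm + (-c * ly + (c - b - a) * lm) by ring, Complex.exp_add, Complex.exp_add, hly, hlm]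
    ring

/-- The periods of a cycle corresponding to the second path. -/
theorem chainInt_path2_eq_calF (hS : ∀ t ∈ Set.Icc (0 : ℝ) 1, 1 - y * t ∈ Complex.slitPlane)
    (hy1 : y ≠ 1) {ly lm : ℂ} (hly : Complex.exp ly = y) (hlm : Complex.exp lm = -1)
    (hg : Generic a b c) {C : RawChain y 1}
    (hC : C ∈ finChains a b c y 1) (hz : bdry C = 0) {D : RawChain y 2}
    (hD : D ∈ lfChains a b c y 2)
    (hCP : bdry D = C - pathChain y (path2 y) (branch2 ly lm a b c y)) (i j k : ℤ) :
    chainInt (monoForm y (k - j - i - 1) (-k - 1) (-(-j))) C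
      = swapConst ly lm y (a - j, b + k - j - i, c - j - i)
        * calF (1 + b - c + k) (1 + a - c + i) (1 + a - c + i + (1 - a + j)) y := by
  have hy0 : y ≠ 0 := hly ▸ Complex.exp_ne_zero _
  have hne : ∀ p, swapConst ly lm y p ≠ 0 := fun p => mul_ne_zero hy0 (Complex.exp_ne_zero _)
  rw [mul_comm, ← div_eq_iff (hne _)]
  have hrel := fun i j k : ℤ => chainInt_monoForm hC hz (k - j - i - 2) (-k - 2) j
    (β := b + k - j - i - 1) (δ := c - b - k - 1) (α := a - j - 1) (by push_cast; ring)
    (by push_cast; ring) (by ring)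
  -- Shifting the swapped parameters `(1 + b - c, 1 + a - c, 1 - a)` by `(k, i, j)` amounts to
  -- replacing `a`, `b`, `c` by `a - j`, `b + k - j - i`, `c - j - i`. This dictates the exponents
  -- of the form. Division by the constant makes the family obey the relations of `𝓕` itself.
  refine eq_calF_of_contiguous hS
    (J := fun i j k => chainInt (monoForm y (k - j - i - 1) (-k - 1) (-(-j))) C
      / swapConst ly lm y (a - j, b + k - j - i, c - j - i)) (β := 1 + a - c) (δ := 1 - a)
    (α := 1 + b - c) (fun n h => (hg (1 - n)).2.2.2.1 ?_) (fun n h => (hg (1 - n)).1 ?_)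
    (fun i j k => ?_) (fun i j k => ?_) (fun i j k h1 h2 => ?_) i j k
  · push_cast; linear_combination -h
  · push_cast; linear_combination -h
  -- The first relation in the swapped indices is the third form of the exactness relation; the
  -- second one, in the next case, is its second form.
  · obtain ⟨-, -, h⟩ := hrel i j k
    obtain ⟨s1, s2, -⟩ := swapConst_shift hly hlm (a - j) (b + k - j - i) (c - j - i)
    have hS := hne (a - j, b + k - j - i, c - j - i)
    rw [show k - j - i - 2 + 1 = k - j - i - 1 by ring, show -k - 2 + 1 = -k - 1 by ring] at h
    rw [show k - j - (i + 1) - 1 = k - j - i - 2 by ring,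
      show k + 1 - (j + 1) - (i + 1) - 1 = k - j - i - 2 by ring,
      show -(k + 1) - 1 = -k - 2 by ring, neg_neg, neg_neg]
    push_cast
    rw [show b + k - j - (i + 1) = b + k - j - i - 1 by ring,
      show c - j - (i + 1) = c - j - i - 1 by ring, show a - (j + 1) = a - j - 1 by ring,
      show b + (k + 1) - (j + 1) - (i + 1) = b + k - j - i - 1 by ring,
      show c - (j + 1) - (i + 1) = c - j - i - 2 by ring, s1, s2]
    generalize swapConst ly lm y (a - j, b + k - j - i, c - j - i) = S at hS ⊢
    field_simp
    linear_combination h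
  · obtain ⟨-, h, -⟩ := hrel i j k
    obtain ⟨-, s2, s3⟩ := swapConst_shift hly hlm (a - j) (b + k - j - i) (c - j - i)
    have hS := hne (a - j, b + k - j - i, c - j - i)
    rw [show k - j - i - 2 + 1 = k - j - i - 1 by ring, show -k - 2 + 1 = -k - 1 by ring] at h
    rw [show k - (j + 1) - i - 1 = k - j - i - 2 by ring,
      show k + 1 - (j + 1) - (i + 1) - 1 = k - j - i - 2 by ring,
      show -(k + 1) - 1 = -k - 2 by ring, neg_neg, neg_neg]
    push_cast
    rw [show b + k - (j + 1) - i = b + k - j - i - 1 by ring,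
      show c - (j + 1) - i = c - j - i - 1 by ring, show a - (j + 1) = a - j - 1 by ring,
      show b + (k + 1) - (j + 1) - (i + 1) = b + k - j - i - 1 by ring,
      show c - (j + 1) - (i + 1) = c - j - i - 2 by ring, s2, s3]
    generalize swapConst ly lm y (a - j, b + k - j - i, c - j - i) = S at hS ⊢
    field_simp
    linear_combination -h
  · have h := chainInt_path2 hS hy1 hly hlm hg hC hz hD hCP (k - j - i) (-k) (-j) (by
      convert h1 using 2; push_cast; ring) (by convert h2 using 2; push_cast; ring)
    rw [div_eq_iff (hne _), h, integralG_eq hS hy0, mul_comm]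
    push_cast
    congr 2
    · simp only [swapParams]
      refine Prod.ext ?_ (Prod.ext ?_ ?_) <;> simp only <;> ring
    · refine Prod.ext ?_ (Prod.ext ?_ ?_) <;> simp only <;> ring

end Periods

/-! ### The period matrix -/

section PeriodMatrix

variable {a b c y : ℂ}

theorem domG_of_generic (hg : Generic a b c) : (a, b, c) ∈ domG := fun n =>
  ⟨by exact_mod_cast (hg (n + 1)).1, by exact_mod_cast (hg (n + 1)).2.2.2.1⟩

theorem Generic.add_one (hg : Generic a b c) : Generic (1 + a) (1 + b) (2 + c) := fun n =>
  ⟨fun h => (hg (n - 1)).1 (by push_cast; linear_combination h),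
    fun h => (hg (n - 1)).2.1 (by push_cast; linear_combination h),
    fun h => (hg (n - 2)).2.2.1 (by push_cast; linear_combination h),
    fun h => (hg (n - 1)).2.2.2.1 (by push_cast; linear_combination h),
    fun h => (hg (n - 1)).2.2.2.2 (by push_cast; linear_combination h)⟩

/-- Representatives of a class corresponding to a path. -/
theorem CorrespondsTo.exists_cycle {φ : MBdual a b c y} {γ s : ℝ → ℂ} (h : CorrespondsTo φ γ s) :
    ∃ (C : RawChain y 1) (hC : C ∈ finChains a b c y 1) (hz : bdry C = 0),
      φ = Submodule.Quotient.mk ⟨C, hC, hz⟩ ∧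
      ∃ D ∈ lfChains a b c y 2, bdry D = C - pathChain y γ s := by
  obtain ⟨⟨C, hC, hz⟩, rfl⟩ := Submodule.Quotient.mk_surjective _ φ
  obtain ⟨hP, h⟩ := h
  obtain ⟨D, hD, hDC⟩ := (Submodule.Quotient.eq _).1 h
  exact ⟨C, hC, hz, rfl, D, hD, hDC⟩

section Coeff

variable {K : Type*} [Field K] [Algebra K ℂ] {y : K}

theorem coeff_etaForm1 {z : ℂ} (hz : z ∈ puncturedPlane (algebraMap K ℂ y)) :
    coeff (etaForm1 y) z = monoForm (algebraMap K ℂ y) (-1) (-1) 0 z := by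
  rw [etaForm1, coeff_smul_D]
  simp only [fval_inverse (coordX_isUnit.mul coordOneSub_isUnit) hz, fval_mul, Pi.mul_apply,
    fval_coordX hz, fval_coordOneSub hz, deriv_fval_eq (fun z hz => fval_coordX hz) hz, deriv_id'',
    monoForm, zpow_neg_one, zpow_zero, mul_inv]

theorem coeff_etaForm2 {z : ℂ} (hz : z ∈ puncturedPlane (algebraMap K ℂ y)) :
    coeff (etaForm2 y) z = monoForm (algebraMap K ℂ y) 0 0 (-1) z := by
  rw [etaForm2, coeff_smul_D]
  simp only [fval_inverse coordOneSubY_isUnit hz, fval_coordOneSubY hz,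
    deriv_fval_eq (fun z hz => fval_coordX hz) hz, deriv_id'',
    monoForm, zpow_neg_one, zpow_zero, mul_one, one_mul]

end Coeff

theorem comp_eta_zero (k : Subfield ℂ) (y : k) {C : RawChain (y : ℂ) 1}
    (hC : C ∈ finChains a b c (y : ℂ) 1) (hz : bdry C = 0) :
    comp k y a b c (eta k y a b c 0) (Submodule.Quotient.mk ⟨C, hC, hz⟩)
      = chainInt (monoForm (y : ℂ) (-1) (-1) 0) C :=
  chainInt_congr (fun _ hz => coeff_etaForm1 (y := yDR k y a b c) hz) C

theorem comp_eta_one (k : Subfield ℂ) (y : k) {C : RawChain (y : ℂ) 1}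
    (hC : C ∈ finChains a b c (y : ℂ) 1) (hz : bdry C = 0) :
    comp k y a b c (eta k y a b c 1) (Submodule.Quotient.mk ⟨C, hC, hz⟩)
      = chainInt (monoForm (y : ℂ) 0 0 (-1)) C :=
  chainInt_congr (fun _ hz => coeff_etaForm2 (y := yDR k y a b c) hz) C

end PeriodMatrix

end TwistedPeriods

/-! ### Assembly of the period matrix. -/

theorem mainTheorem12 (k : Subfield ℂ) (y : k) (hy0 : (y : ℂ) ≠ 0) (hy1 : (y : ℂ) ≠ 1)
    (hy : ∀ r : ℝ, 1 < r → (y : ℂ) ≠ (r : ℂ)) (ly lm : ℂ)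
    (hly : Complex.exp ly = y) (hlm : Complex.exp lm = -1) :
    IsContinuation domF regF (integralF y) (fun p => calF p.1 p.2.1 p.2.2 y) ∧
    IsContinuation domG regG (integralG ly lm y) (fun p => calG ly lm p.1 p.2.1 p.2.2 y) ∧
    ∀ a b c : ℂ, Generic a b c →
      (∃ φ : Fin 2 → MBdual a b c (y : ℂ), IsBettiPair ly lm φ) ∧
      ∀ φ : Fin 2 → MBdual a b c (y : ℂ), IsBettiPair ly lm φ →
        periodMatrix k y a b c φ =
          !![calF a b c y, calF (1 + a) (1 + b) (2 + c) y;
             calG ly lm a b c y, calG ly lm (1 + a) (1 + b) (2 + c) y] := by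
  have hS : ∀ t ∈ Set.Icc (0 : ℝ) 1, 1 - (y : ℂ) * t ∈ Complex.slitPlane := fun t ht =>
    one_sub_mul_mem_slitPlane hy1 hy ht
  refine ⟨calF_isContinuation hS, calG_isContinuation hS hy0 ly lm, fun a b c hg => ⟨?_, ?_⟩⟩
  · obtain ⟨φ₁, h₁⟩ := exists_betti1 hS hg
    obtain ⟨φ₂, h₂⟩ := exists_betti2 hS hly hlm hg
    exact ⟨![φ₁, φ₂], h₁, h₂⟩
  · rintro φ ⟨h₁, h₂⟩
    obtain ⟨C₁, hC₁, hz₁, e₁, D₁, hD₁, hb₁⟩ := h₁.exists_cycle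
    obtain ⟨C₂, hC₂, hz₂, e₂, D₂, hD₂, hb₂⟩ := h₂.exists_cycle
    have p₁ := chainInt_path1_eq_calF hS hy0 hy1 hg hC₁ hz₁ hD₁ hb₁
    have p₂ := chainInt_path2_eq_calF hS hy1 hly hlm hg hC₂ hz₂ hD₂ hb₂
    have g₁ := calG_eq hS hy0 ly lm (domG_of_generic hg)
    have g₂ := calG_eq hS hy0 ly lm (domG_of_generic hg.add_one)
    -- `η₁` and `η₂` are the monomial forms with exponents `(-1, -1, 0)` and `(0, 0, -1)`, that is,
    -- the indices `(0, 0, 0)` and `(1, 1, 1)` of the first family.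
    have q₁ := (comp_eta_zero k y hC₁ hz₁).trans (p₁ 0 0 0)
    have q₂ := (comp_eta_one k y hC₁ hz₁).trans (p₁ 1 1 1)
    have q₃ := (comp_eta_zero k y hC₂ hz₂).trans (p₂ 0 0 0)
    -- In the swapped indexing the exponents `(0, 0, -1)` of `η₂` occur at `(-1, -1, -1)`, because
    -- raising `(a, b, c)` by `(1, 1, 2)` lowers all three of `1 + b - c`, `1 + a - c`, `1 - a` by
    -- one.
    have p₄ := p₂ (-1) (-1) (-1)
    rw [show (-1 : ℤ) - -1 - -1 - 1 = 0 by norm_num, show -(-1 : ℤ) - 1 = 0 by norm_num,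
      neg_neg] at p₄
    have q₄ := (comp_eta_one k y hC₂ hz₂).trans p₄
    rw [← e₁] at q₁ q₂
    rw [← e₂] at q₃ q₄
    have r₁ : calF (a + (0 : ℤ)) (b + (0 : ℤ)) (b + (0 : ℤ) + (c - b + (0 : ℤ))) (y : ℂ)
        = calF a b c y := by simp
    have r₂ : calF (a + (1 : ℤ)) (b + (1 : ℤ)) (b + (1 : ℤ) + (c - b + (1 : ℤ))) (y : ℂ)
        = calF (1 + a) (1 + b) (2 + c) y := by
      rw [Int.cast_one]
      ring_nf
    refine Matrix.ext fun i j => ?_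
    fin_cases i <;> fin_cases j
    · exact q₁.trans r₁
    · exact q₂.trans r₂
    · refine q₃.trans (Eq.trans ?_ g₁.symm)
      simp only [Int.cast_zero, add_zero, sub_zero]
      ring_nf
    · refine q₄.trans (Eq.trans ?_ g₂.symm)
      simp only [Int.cast_neg, Int.cast_one]
      ring_nf
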